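/- Let $V$ be a separable real Hilbert space with norm $|\cdot|$ and let $A$ be a linear operator in $V$ such that $-A$ is densely defined, symmetric and strictly positive and has a compact inverse, and such that $A$ generates a strongly continuous semigroup $S=(S(t))_{t\ge 0}$ on $V$ (this semigroup is then analytic and exponentially decreasing). Let $L_2(V)$ be the space of Hilbert–Schmidt operators on $V$ with its usual norm. Let $1/2<\beta<\beta'<1$, and let $\omega:\mathbb R\to V$ be $\beta'$-Hölder continuous on every compact interval, with $\omega(0)=0$. Let $G:V\to L_2(V)$ be twice Fréchet differentiable with bounded first and second derivatives, and let $u_0\in V$ and $T>0$. For $0<\alpha<1$ and $a<b$ put $$D_{a+}^{\alpha}Z[r]=\frac1{\Gamma(1-\alpha)}\Big(\frac{Z(r)}{(r-a)^\alpha}+\alpha\int_a^r\frac{Z(r)-Z(q)}{(r-q)^{1+\alpha}}\,dq\Big),$$ $$D_{b-}^{1-\alpha}\omega_{b-}[r]=\frac{(-1)^{1-\alpha}}{\Gamma(\alpha)}\Big(\frac{\omega(r)-\omega(b-)}{(b-r)^{1-\alpha}}+(1-\alpha)\int_r^b\frac{\omega(r)-\omega(q)}{(q-r)^{2-\alpha}}\,dq\Big),$$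 where $\omega(b-)$ is the left limit and $\omega_{b-}=\omega-\omega(b-)$, and, for $Z$ with values in $L_2(V)$, $$\int_a^b Z\,d\omega=(-1)^\alpha\int_a^b D_{a+}^{\alpha}Z[r]\,D_{b-}^{1-\alpha}\omega_{b-}[r]\,dr,\qquad(-1)^\alpha(-1)^{1-\alpha}=-1 .$$ This integral is said to be defined if the following hold: the one-sided limits of $\omega$ at $a+$ and $b-$ and of $\langle x,Z(\cdot)y\rangle$ at $a+$ exist for all $x,y\in V$; there are $p,p'\in[1,\infty]$ with $1/p+1/p'\le 1$ and $\alpha p<1$ such that $\langle x,Z(\cdot)y\rangle\in I_{a+}^{\alpha}(L_p((a,b);\mathbb R))$ and $\langle x,\omega_{b-}\rangle\in I_{b-}^{1-\alpha}(L_{p'}((a,b);\mathbb R))$ for all $x,y\in V$, where $I_{a+}^\alpha(L_p)$ and $I_{b-}^{1-\alpha}(L_{p'})$ are the images of $L_p$ and $L_{p'}$ under the left and right Riemann–Liouville fractional integrals; the inner integrals in the two derivatives converge absolutely in norm for almost every $r\in(a,b)$; and both $r\mapsto\|D_{a+}^{\alpha}Z[r]\|_{L_2(V)}\,|D_{b-}^{1-\alpha}\omega_{b-}[r]|$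 and the integrand $r\mapsto D_{a+}^{\alpha}Z[r]\,D_{b-}^{1-\alpha}\omega_{b-}[r]$ are integrable on $(a,b)$. Let $C^{\beta,\sim}([0,T];V)$ be the space of continuous $u:[0,T]\to V$ with $$\sup_{s\in[0,T]}|u(s)|+\sup_{0<s<t\le T}s^{\beta}\frac{|u(t)-u(s)|}{|t-s|^{\beta}}<\infty .$$ Then the mild equation $$u(t)=S(t)u_0+\int_0^tS(t-r)G(u(r))\,d\omega,\qquad t\in[0,T],$$ has a unique solution in $C^{\beta,\sim}([0,T];V)$. More precisely, there is $u\in C^{\beta,\sim}([0,T];V)$ such that for every $\alpha$ with $1-\beta'<\alpha<\beta$ the integrals of order $\alpha$ in the equation are defined for all $t\in(0,T]$ and the equation holds for all $t\in[0,T]$ (for $t=0$ the integral is zero); and every $v\in C^{\beta,\sim}([0,T];V)$ that satisfies this for some $\alpha$ with $1-\beta'<\alpha<\beta$ equals $u$ on $[0,T]$. -/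

import Mathlib

open MeasureTheory Set Filter Topology
open scoped NNReal ENNReal RealInnerProductSpace

theorem HilbertBasis.ofReal_norm_sq {V : Type*} [NormedAddCommGroup V] [InnerProductSpace ℝ V]
    {κ : Type*} (d : HilbertBasis κ ℝ V) (x : V) :
    ENNReal.ofReal (‖x‖ ^ 2) = ∑' k, ENNReal.ofReal (⟪d k, x⟫ ^ 2) := by
  have h' : HasSum (fun k => ⟪d k, x⟫ ^ 2) (‖x‖ ^ 2) := by
    rw [← real_inner_self_eq_norm_sq]
    refine (d.hasSum_inner_mul_inner x x).congr_fun fun k => ?_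
    rw [real_inner_comm x, sq]
  rw [← h'.tsum_eq, ENNReal.ofReal_tsum_of_nonneg (fun k => sq_nonneg _) h'.summable]

noncomputable section HilbertSchmidtOperators

variable (V : Type*) [NormedAddCommGroup V] [InnerProductSpace ℝ V] [CompleteSpace V]

/-- The index set of a chosen complete orthonormal system of `V`. -/
def onbIndex : Set V := (exists_hilbertBasis ℝ V).choose

/-- A chosen complete orthonormal system of `V`. It serves only to define the Hilbert-Schmidt norm,
which does not depend on it (`HilbertSchmidt.hasSum_norm_sq`). -/
def onb : HilbertBasis (onbIndex V) ℝ V := (exists_hilbertBasis ℝ V).choose_spec.choose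

/-- The bounded operators `T` on `V` with `∑ i, ‖T (e i)‖ ^ 2 < ∞`. -/
def hilbertSchmidtSubmodule : Submodule ℝ (V →L[ℝ] V) where
  carrier := {T | Memℓp (fun i => T (onb V i)) 2}
  add_mem' hS hT := hS.add hT
  zero_mem' := zero_memℓp
  smul_mem' c _ hT := hT.const_smul c

/-- The space `L₂(V)` of Hilbert-Schmidt operators from `V` to `V`. -/
def HilbertSchmidt : Type _ := hilbertSchmidtSubmodule V

namespace HilbertSchmidt

instance : AddCommGroup (HilbertSchmidt V) :=
  inferInstanceAs (AddCommGroup (hilbertSchmidtSubmodule V))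

instance : Module ℝ (HilbertSchmidt V) :=
  inferInstanceAs (Module ℝ (hilbertSchmidtSubmodule V))

/-- The map `T ↦ (T (e i))_i` from `L₂(V)` to the square summable families in `V`. -/
def toLp : HilbertSchmidt V →ₗ[ℝ] lp (fun _ : onbIndex V => V) 2 where
  toFun T := ⟨fun i => T.1 (onb V i), T.2⟩
  map_add' _ _ := rfl
  map_smul' _ _ := rfl

theorem toLp_injective : Function.Injective (toLp V) := by
  intro S T h
  apply Subtype.ext
  refine ContinuousLinearMap.ext_on (s := range (onb V)) ?_ ?_
  · exact Submodule.dense_iff_topologicalClosure_eq_top.2 (onb V).dense_span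
  · rintro _ ⟨i, rfl⟩
    exact congrFun (congrArg Subtype.val h) i

/-- The Hilbert-Schmidt norm `(∑ i, ‖T (e i)‖ ^ 2) ^ (1 / 2)`. -/
instance : NormedAddCommGroup (HilbertSchmidt V) :=
  NormedAddCommGroup.induced _ _ (toLp V) (toLp_injective V)

instance : NormedSpace ℝ (HilbertSchmidt V) :=
  NormedSpace.induced ℝ _ _ (toLp V)

variable {V}

/-- A Hilbert-Schmidt operator as a bounded operator. -/
def toCLM (T : HilbertSchmidt V) : V →L[ℝ] V := T.1

/-- The composition `L ∘ T` of a bounded operator `L` with a Hilbert-Schmidt operator `T`. -/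
def comp (L : V →L[ℝ] V) (T : HilbertSchmidt V) : HilbertSchmidt V :=
  ⟨L ∘L T.1, by
    have hp : 0 < (2 : ℝ≥0∞).toReal := by norm_num
    have hT : Memℓp (fun i => T.1 (onb V i)) 2 := T.2
    refine memℓp_gen (((hT.summable hp).mul_left (‖L‖ ^ (2 : ℝ≥0∞).toReal)).of_nonneg_of_le
      (fun i => by positivity) fun i => ?_)
    rw [← Real.mul_rpow (norm_nonneg _) (norm_nonneg _)]
    exact Real.rpow_le_rpow (norm_nonneg _) (L.le_opNorm _) hp.le⟩

theorem tsum_ofReal_norm_sq_adjoint {ι κ : Type*} (b : HilbertBasis ι ℝ V)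
    (c : HilbertBasis κ ℝ V) (T : V →L[ℝ] V) :
    ∑' i, ENNReal.ofReal (‖T (b i)‖ ^ 2)
      = ∑' j, ENNReal.ofReal (‖ContinuousLinearMap.adjoint T (c j)‖ ^ 2) := by
  simp_rw [fun i => c.ofReal_norm_sq (T (b i)),
    fun j => b.ofReal_norm_sq (ContinuousLinearMap.adjoint T (c j))]
  rw [ENNReal.tsum_comm]
  refine tsum_congr fun j => tsum_congr fun i => ?_
  rw [ContinuousLinearMap.adjoint_inner_right, real_inner_comm]

/-- The Hilbert-Schmidt norm can be computed in every complete orthonormal system. -/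
theorem hasSum_norm_sq {ι : Type*} (b : HilbertBasis ι ℝ V) (T : HilbertSchmidt V) :
    HasSum (fun i => ‖T.toCLM (b i)‖ ^ 2) (‖T‖ ^ 2) := by
  have h0 : HasSum (fun i => ‖T.toCLM (onb V i)‖ ^ 2) (‖T‖ ^ 2) := by
    have h := lp.hasSum_norm (p := 2) (by norm_num) (toLp V T)
    simp only [ENNReal.toReal_ofNat, Real.rpow_ofNat] at h
    exact h
  have h1 := (tsum_ofReal_norm_sq_adjoint b (onb V) T.toCLM).trans
    (tsum_ofReal_norm_sq_adjoint (onb V) (onb V) T.toCLM).symm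
  rw [← ENNReal.ofReal_tsum_of_nonneg (fun i => sq_nonneg _) h0.summable, h0.tsum_eq] at h1
  have hs : Summable fun i => ‖T.toCLM (b i)‖ ^ 2 := by
    have := ENNReal.summable_toReal (h1.trans_ne ENNReal.ofReal_ne_top)
    simpa [ENNReal.toReal_ofReal] using this
  rw [← ENNReal.ofReal_tsum_of_nonneg (fun i => sq_nonneg _) hs,
    ENNReal.ofReal_eq_ofReal_iff (tsum_nonneg fun i => sq_nonneg _) (sq_nonneg _)] at h1
  rw [← h1]
  exact hs.hasSum

theorem toLp_surjective : Function.Surjective (toLp V) := by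
  intro f
  have hf : Memℓp (fun i => ‖f i‖) 2 := (lp.memℓp f).norm
  let g : lp (fun _ : onbIndex V => ℝ) 2 := ⟨fun i => ‖f i‖, hf⟩
  have hx : ∀ x : V, Memℓp (fun i => ‖(onb V).repr x i‖) 2 :=
    fun x => (lp.memℓp ((onb V).repr x)).norm
  let a : V → lp (fun _ : onbIndex V => ℝ) 2 := fun x => ⟨fun i => ‖(onb V).repr x i‖, hx x⟩
  have ha : ∀ x, ‖a x‖ = ‖x‖ := by
    intro x
    rw [← (onb V).repr.norm_map x, lp.norm_eq_tsum_rpow (by norm_num),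
      lp.norm_eq_tsum_rpow (by norm_num)]
    simp [a]
  have hsum : ∀ x : V, HasSum (fun i => ‖(onb V).repr x i • f i‖) ⟪g, a x⟫ := by
    intro x
    have h := lp.hasSum_inner (𝕜 := ℝ) g (a x)
    simpa [g, a, norm_smul] using h
  let T : V →L[ℝ] V := LinearMap.mkContinuous
    { toFun := fun x => ∑' i, (onb V).repr x i • f i
      map_add' := by
        intro x y
        rw [← (hsum x).summable.of_norm.tsum_add (hsum y).summable.of_norm]
        simp [add_smul]
      map_smul' := by
        intro c x
        simp [mul_smul, (hsum x).summable.of_norm.tsum_const_smul] } ‖g‖ (by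
      intro x
      calc ‖∑' i, (onb V).repr x i • f i‖ ≤ ∑' i, ‖(onb V).repr x i • f i‖ :=
            norm_tsum_le_tsum_norm (hsum x).summable
        _ = ⟪g, a x⟫ := (hsum x).tsum_eq
        _ ≤ ‖g‖ * ‖a x‖ := real_inner_le_norm _ _
        _ = ‖g‖ * ‖x‖ := by rw [ha])
  have hT : ∀ k, T (onb V k) = f k := by
    intro k
    classical
    change ∑' i, (onb V).repr (onb V k) i • f i = f k
    rw [tsum_eq_single k]
    · simp [HilbertBasis.repr_self]
    · intro i hi
      simp [HilbertBasis.repr_self, lp.single_apply, hi]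
  refine ⟨⟨T, ?_⟩, ?_⟩
  · change Memℓp (fun i => T (onb V i)) 2
    simp_rw [hT]
    exact lp.memℓp f
  · ext k
    exact hT k

instance : CompleteSpace (HilbertSchmidt V) := by
  let e : HilbertSchmidt V ≃ₗᵢ[ℝ] lp (fun _ : onbIndex V => V) 2 :=
    { LinearEquiv.ofBijective (toLp V) ⟨toLp_injective V, toLp_surjective⟩ with
      norm_map' := fun _ => rfl }
  exact e.toIsometryEquiv.completeSpace_iff.2 inferInstance

end HilbertSchmidt

end HilbertSchmidtOperators

noncomputable section Semigroups

variable {V : Type*} [NormedAddCommGroup V] [InnerProductSpace ℝ V]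

/-- A strictly positive symmetric (densely defined) operator with a compact inverse. -/
structure IsPosSymmWithCompactInverse (B : V →ₗ.[ℝ] V) : Prop where
  dense_domain : Dense (B.domain : Set V)
  symmetric : B.IsFormalAdjoint B
  pos : ∀ x : B.domain, (x : V) ≠ 0 → 0 < ⟪B x, (x : V)⟫
  compact_inverse : ∃ K : V →L[ℝ] V, IsCompactOperator K ∧
    (∀ y : V, ∃ h : K y ∈ B.domain, B ⟨K y, h⟩ = y) ∧ ∀ x : B.domain, K (B x) = x

/-- `(S t)_{t ≥ 0}` is a strongly continuous semigroup of bounded operators; the values `S t`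
with `t < 0` are irrelevant. -/
structure IsC0Semigroup (S : ℝ → V →L[ℝ] V) : Prop where
  zero : S 0 = ContinuousLinearMap.id ℝ V
  add : ∀ s t, 0 ≤ s → 0 ≤ t → S (s + t) = S s ∘L S t
  tendsto_zero : ∀ x, Tendsto (fun t => S t x) (𝓝[>] 0) (𝓝 x)

/-- `A` is the infinitesimal generator of the strongly continuous semigroup `S`: `x` lies in the
domain of `A` and `A x = y` if and only if `(S h x - x) / h` tends to `y` as `h` decreases
to `0`. -/
structure IsGeneratorOf (A : V →ₗ.[ℝ] V) (S : ℝ → V →L[ℝ] V) : Prop where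
  semigroup : IsC0Semigroup S
  mem_graph_iff : ∀ x y : V,
    (x, y) ∈ A.graph ↔ Tendsto (fun h : ℝ => h⁻¹ • (S h x - x)) (𝓝[>] 0) (𝓝 y)

end Semigroups

noncomputable section FractionalCalculus

variable {E : Type*} [NormedAddCommGroup E] [NormedSpace ℝ E]

/-- The integrand of the integral in the left Weyl derivative of order `α` at `r`. -/
def weylLeftKernel (α : ℝ) (Z : ℝ → E) (r q : ℝ) : E :=
  (r - q) ^ (-(1 + α)) • (Z r - Z q)

/-- The left Weyl derivative `D_{a+}^α Z [r]`. -/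
def weylLeft (α a : ℝ) (Z : ℝ → E) (r : ℝ) : E :=
  (Real.Gamma (1 - α))⁻¹ •
    ((r - a) ^ (-α) • Z r + α • ∫ q in a..r, weylLeftKernel α Z r q)

/-- The integrand of the integral in the right Weyl derivative of order `γ` at `r`. -/
def weylRightKernel (γ : ℝ) (f : ℝ → E) (r q : ℝ) : E :=
  (q - r) ^ (-(1 + γ)) • (f r - f q)

/-- The right Weyl derivative `D_{b-}^γ f [r]` of order `γ`, without its complex factor
`(-1) ^ γ`; see `zahleIntegral` for the treatment of this factor. -/
def weylRight (γ b : ℝ) (f : ℝ → E) (r : ℝ) : E :=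
  (Real.Gamma (1 - γ))⁻¹ •
    ((b - r) ^ (-γ) • f r + γ • ∫ q in r..b, weylRightKernel γ f r q)

/-- `f_{b-} = f - f(b-)`, where `f(b-)` is the left limit of `f` at `b`. -/
def subLeftLim (f : ℝ → E) (b : ℝ) (r : ℝ) : E := f r - Function.leftLim f b

/-- `f ∈ I_{a+}^α (L_p ((a, b); ℝ))`: on `(a, b)`, `f` is almost everywhere the left
Riemann-Liouville fractional integral of order `α` of a function in `L_p`. -/
def MemFracIntegralLeft (α : ℝ) (p : ℝ≥0∞) (a b : ℝ) (f : ℝ → ℝ) : Prop :=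
  ∃ φ : ℝ → ℝ, MemLp φ p (volume.restrict (Ioo a b)) ∧
    ∀ᵐ r ∂volume.restrict (Ioo a b),
      f r = (Real.Gamma α)⁻¹ * ∫ q in a..r, (r - q) ^ (α - 1) * φ q

/-- `f ∈ I_{b-}^γ (L_p ((a, b); ℝ))`: on `(a, b)`, `f` is almost everywhere the right
Riemann-Liouville fractional integral of order `γ` of a function in `L_p`. -/
def MemFracIntegralRight (γ : ℝ) (p : ℝ≥0∞) (a b : ℝ) (f : ℝ → ℝ) : Prop :=
  ∃ φ : ℝ → ℝ, MemLp φ p (volume.restrict (Ioo a b)) ∧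
    ∀ᵐ r ∂volume.restrict (Ioo a b),
      f r = (Real.Gamma γ)⁻¹ * ∫ q in r..b, (q - r) ^ (γ - 1) * φ q

variable {V : Type*} [NormedAddCommGroup V] [InnerProductSpace ℝ V] [CompleteSpace V]

/-- The integrand `D_{a+}^α Z [r] (D_{b-}^{1-α} ω_{b-} [r])` of the pathwise integral. -/
def zahleIntegrand (α : ℝ) (Z : ℝ → HilbertSchmidt V) (ω : ℝ → V) (a b r : ℝ) : V :=
  (weylLeft α a Z r).toCLM (weylRight (1 - α) b (subLeftLim ω b) r)

/-- The pathwise integral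
`∫_a^b Z dω = (-1) ^ α * ∫_a^b D_{a+}^α Z [r] D_{b-}^{1-α} ω_{b-} [r] dr`.
The factor `(-1) ^ (1 - α)` of the right derivative, which `weylRight` omits, and the factor
`(-1) ^ α` in front of the integral have the product `(-1) ^ α * (-1) ^ (1 - α) = -1`. -/
def zahleIntegral (α : ℝ) (Z : ℝ → HilbertSchmidt V) (ω : ℝ → V) (a b : ℝ) : V :=
  -∫ r in a..b, zahleIntegrand α Z ω a b r

/-- The conditions under which the integral `∫_a^b Z dω` of order `α` is defined, for `a < b`.
The conditions on the components of `Z` and `ω` are imposed in all directions, not only along one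
orthonormal basis. -/
structure ZahleIntegrable (α : ℝ) (Z : ℝ → HilbertSchmidt V) (ω : ℝ → V) (a b : ℝ) : Prop where
  lim_integrand : ∀ x y : V, ∃ l, Tendsto (fun r => ⟪x, (Z r).toCLM y⟫) (𝓝[>] a) (𝓝 l)
  lim_left : ∃ l, Tendsto ω (𝓝[>] a) (𝓝 l)
  lim_right : ∃ l, Tendsto ω (𝓝[<] b) (𝓝 l)
  components : ∃ p p' : ℝ≥0∞, 1 ≤ p ∧ 1 ≤ p' ∧ p⁻¹ + p'⁻¹ ≤ 1 ∧ ENNReal.ofReal α * p < 1 ∧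
    (∀ x y : V, MemFracIntegralLeft α p a b fun r => ⟪x, (Z r).toCLM y⟫) ∧
    ∀ x : V, MemFracIntegralRight (1 - α) p' a b fun r => ⟪x, subLeftLim ω b r⟫
  left_kernel : ∀ᵐ r ∂volume.restrict (Ioo a b),
    IntervalIntegrable (weylLeftKernel α Z r) volume a r
  right_kernel : ∀ᵐ r ∂volume.restrict (Ioo a b),
    IntervalIntegrable (weylRightKernel (1 - α) (subLeftLim ω b) r) volume r b
  norm_mul_norm : IntegrableOn
    (fun r => ‖weylLeft α a Z r‖ * ‖weylRight (1 - α) b (subLeftLim ω b) r‖) (Ioo a b)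
  integrand : IntegrableOn (zahleIntegrand α Z ω a b) (Ioo a b)

end FractionalCalculus

noncomputable section MildSolutions

variable {V : Type*} [NormedAddCommGroup V] [InnerProductSpace ℝ V]

/-- The space `C^{β,∼}([T₁, T₂]; V)`: continuous functions on `[T₁, T₂]` such that
`(s - T₁) ^ β * ‖u t - u s‖ / (t - s) ^ β` is bounded for `T₁ < s < t ≤ T₂`. The values of `u`
outside `[T₁, T₂]` are irrelevant. -/
structure MemWeightedHolder (β T₁ T₂ : ℝ) (u : ℝ → V) : Prop where
  continuousOn : ContinuousOn u (Icc T₁ T₂)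
  bounded : ∃ C : ℝ, ∀ s t, T₁ < s → s < t → t ≤ T₂ →
    (s - T₁) ^ β * (‖u t - u s‖ / (t - s) ^ β) ≤ C

/-- The set `Ω` of paths that are zero at zero and `β'`-Hölder continuous on every compact
interval. -/
def holderPaths (V : Type*) [NormedAddCommGroup V] (β' : ℝ) : Set (ℝ → V) :=
  {ω | ω 0 = 0 ∧ ∀ a b : ℝ, ∃ C : ℝ≥0, HolderOnWith C β'.toNNReal ω (Icc a b)}

/-- `G` is twice Fréchet differentiable with bounded first and second derivatives. -/
structure IsTwiceDiffBounded {E F : Type*} [NormedAddCommGroup E] [NormedSpace ℝ E]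
    [NormedAddCommGroup F] [NormedSpace ℝ F] (G : E → F) : Prop where
  differentiable : Differentiable ℝ G
  differentiable_fderiv : Differentiable ℝ (fderiv ℝ G)
  bounded_fderiv : ∃ C : ℝ, ∀ x, ‖fderiv ℝ G x‖ ≤ C
  bounded_fderiv_fderiv : ∃ C : ℝ, ∀ x, ‖fderiv ℝ (fderiv ℝ G) x‖ ≤ C

variable [CompleteSpace V]

/-- The integrand `r ↦ S(t - r) G(u(r))` of the mild equation. -/
def mildIntegrand (S : ℝ → V →L[ℝ] V) (G : V → HilbertSchmidt V) (u : ℝ → V) (t r : ℝ) :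
    HilbertSchmidt V :=
  HilbertSchmidt.comp (S (t - r)) (G (u r))

/-- `u` solves `u(t) = S(t) u₀ + ∫_0^t S(t - r) G(u(r)) dω` for `t ∈ [0, T]`, where the integral
is the pathwise integral of order `α`. The integral has to be defined for every `t ∈ (0, T]`; it is
zero for `t = 0`. -/
structure IsMildSolution (S : ℝ → V →L[ℝ] V) (G : V → HilbertSchmidt V) (ω : ℝ → V) (u₀ : V)
    (T α : ℝ) (u : ℝ → V) : Prop where
  integrable : ∀ t ∈ Ioc 0 T, ZahleIntegrable α (mildIntegrand S G u t) ω 0 t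
  equation : ∀ t ∈ Icc 0 T, u t = S t u₀ + zahleIntegral α (mildIntegrand S G u t) ω 0 t

end MildSolutions

/-! The solution is the fixed point of the right-hand side of the mild equation. Contraction is
obtained on the whole interval at once, by measuring functions with an exponential weight `e ^ (-ρ
t)` and letting `ρ` be large (`WeightedBound`).

The operator estimates are spectral. The inverse of `-A` is compact and symmetric, so its
eigenvectors span a dense subspace, and on an eigenvector the semigroup is multiplication by `e ^
(-l t)` with `l > 0`. Any linear combination of operators `S t` is therefore bounded by the supremum
over `l` of the same combination of exponentials (`norm_sum_smul_semigroup_le`). This gives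
contractivity, a bound on increments and a bound on second differences of `S`, all with explicit
singularities at time zero.

The pathwise integral pairs an integrable left Weyl derivative of `S(t - r) g(r)` with a bounded
right Weyl derivative of the Hölder path. Reflection turns right derivatives into left ones. Weyl
derivatives invert fractional integrals, and those of different orders differ by a fractional
integral (`WeylAdmissible.ae_eq_fracInt_weylLeft`, `WeylAdmissible.ae_weylLeft_eq_fracInt`). The
first fact gives the membership conditions in the definition of the integral. The second, with
fractional integration by parts, shows that the integral does not depend on its order, so one fixed
order suffices for existence and uniqueness.

The central estimate is `exists_weightedBound_pathConvolution`: the convolution maps the weighted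
space to itself with norm at most `C * ρ ^ (-η)`. The singularities of the two derivatives are Beta
kernels with some integrability to spare. A spare power `(t - r) ^ (-η)` is exchanged for `ρ ^ (-η)`
by `e ^ (ρ r) ≤ e ^ (ρ t) (ρ (t - r)) ^ (-η)`.

The map `u ↦ G ∘ u` grows linearly in the weighted norm, so for a suitable `ρ` a ball is invariant.
Differences of Hölder increments of `G ∘ u - G ∘ v` contain a quadratic term, so the Lipschitz
constant depends on the radius of the ball. A second weight, chosen after that radius, makes the map
halve distances there. Picard iteration then gives existence. For uniqueness, the two solutions are
put in a common ball, on which a further weight gives contraction. The weight `s ^ β` says nothing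
about continuity at zero; this is supplied separately by `tendsto_pathConvolution_zero`. -/

/-! ### Hilbert-Schmidt norms of operators and compositions. -/

section HilbertSchmidtBounds

variable {V : Type*} [NormedAddCommGroup V] [InnerProductSpace ℝ V] [CompleteSpace V]

namespace HilbertSchmidt

theorem norm_toCLM_le (T : HilbertSchmidt V) : ‖T.toCLM‖ ≤ ‖T‖ := by
  -- The Hilbert-Schmidt norm controls only the vectors `T (e i)`. The adjoint has the same operator
  -- norm, and its coordinates `⟪e i, T* x⟫ = ⟪T (e i), x⟫` involve just these vectors.
  rw [← LinearIsometryEquiv.norm_map ContinuousLinearMap.adjoint T.toCLM]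
  refine ContinuousLinearMap.opNorm_le_bound _ (norm_nonneg _) fun x => ?_
  refine le_of_sq_le_sq ?_ (by positivity)
  have h1 : HasSum (fun i => ⟪onb V i, ContinuousLinearMap.adjoint T.toCLM x⟫ ^ 2)
      (‖ContinuousLinearMap.adjoint T.toCLM x‖ ^ 2) := by
    rw [← real_inner_self_eq_norm_sq]
    refine ((onb V).hasSum_inner_mul_inner _ _).congr_fun fun k => ?_
    rw [real_inner_comm (onb V k), sq]
  refine hasSum_le (fun i => ?_) h1 (((hasSum_norm_sq (onb V) T).mul_right (‖x‖ ^ 2)).congr_fun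
    fun _ => rfl) |>.trans_eq (by ring)
  rw [ContinuousLinearMap.adjoint_inner_right, ← mul_pow, sq_le_sq, abs_of_nonneg
    (mul_nonneg (norm_nonneg _) (norm_nonneg _))]
  exact abs_real_inner_le_norm _ _

theorem norm_comp_le (L : V →L[ℝ] V) (T : HilbertSchmidt V) : ‖comp L T‖ ≤ ‖L‖ * ‖T‖ := by
  refine le_of_sq_le_sq ?_ (by positivity)
  rw [mul_pow]
  refine hasSum_le (fun i => ?_) (hasSum_norm_sq (onb V) (comp L T))
    ((hasSum_norm_sq (onb V) T).mul_left (‖L‖ ^ 2))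
  rw [← mul_pow]
  gcongr
  exact L.le_opNorm _

/-- The inclusion of the Hilbert-Schmidt operators into the bounded operators. -/
noncomputable def toCLML : HilbertSchmidt V →L[ℝ] V →L[ℝ] V :=
  LinearMap.mkContinuous
    { toFun := toCLM
      map_add' := fun _ _ => rfl
      map_smul' := fun _ _ => rfl } 1 fun T => by
      rw [one_mul]; exact norm_toCLM_le T

theorem ext_toCLM {S T : HilbertSchmidt V} (h : ∀ x, S.toCLM x = T.toCLM x) : S = T :=
  Subtype.ext (ContinuousLinearMap.ext h)

/-- Composition with a bounded operator as a bounded bilinear map. -/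
noncomputable def compL : (V →L[ℝ] V) →L[ℝ] HilbertSchmidt V →L[ℝ] HilbertSchmidt V :=
  LinearMap.mkContinuous₂
    (LinearMap.mk₂ ℝ comp (fun _ _ _ => rfl) (fun _ _ _ => rfl)
      (fun L S T => ext_toCLM fun x => map_add L (S.toCLM x) (T.toCLM x))
      (fun c L T => ext_toCLM fun x => map_smul L c (T.toCLM x))) 1
    fun L T => by rw [one_mul]; exact norm_comp_le L T

@[simp] theorem compL_apply (L : V →L[ℝ] V) (T : HilbertSchmidt V) : compL L T = comp L T := rfl

theorem comp_sub_right (L : V →L[ℝ] V) (S T : HilbertSchmidt V) :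
    comp L (S - T) = comp L S - comp L T := map_sub (compL L) S T

theorem comp_sub_left (K L : V →L[ℝ] V) (T : HilbertSchmidt V) :
    comp (K - L) T = comp K T - comp L T := by
  rw [← compL_apply, map_sub]; rfl

end HilbertSchmidt

end HilbertSchmidtBounds

/-! ### Spectral calculus for the semigroup. -/

section SpectralEstimates

variable {V : Type*} [NormedAddCommGroup V] [InnerProductSpace ℝ V]

/-- For `s > t` the slope is `S t` applied to the difference quotient at zero, because `S s = S t ∘
S (s - t)`. Only right derivatives come for free from the generator, and they suffice below. -/
theorem IsC0Semigroup.hasDerivWithinAt {S : ℝ → V →L[ℝ] V} (hS : IsC0Semigroup S) {x y : V}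
    (hxy : Tendsto (fun h : ℝ => h⁻¹ • (S h x - x)) (𝓝[>] 0) (𝓝 y)) {t : ℝ} (ht : 0 ≤ t) :
    HasDerivWithinAt (fun t => S t x) (S t y) (Ici t) t := by
  rw [← hasDerivWithinAt_Ioi_iff_Ici, hasDerivWithinAt_iff_tendsto_slope' self_notMem_Ioi]
  have h1 : Tendsto (fun s => s - t) (𝓝[>] t) (𝓝[>] 0) := by
    refine tendsto_nhdsWithin_iff.2 ⟨?_, ?_⟩
    · have : Tendsto (fun s => s - t) (𝓝 t) (𝓝 (t - t)) := tendsto_id.sub_const t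
      rw [sub_self] at this
      exact this.mono_left nhdsWithin_le_nhds
    · filter_upwards [self_mem_nhdsWithin] with s hs
      exact sub_pos.2 (mem_Ioi.1 hs)
  refine (((S t).continuous.tendsto y).comp (hxy.comp h1)).congr' ?_
  filter_upwards [self_mem_nhdsWithin] with s hs
  have : S s = S t ∘L S (s - t) := by
    rw [← hS.add _ _ ht (sub_nonneg.2 (le_of_lt hs))]; congr 1; ring
  simp [slope_def_module, this, map_smul, map_sub]

variable [CompleteSpace V]

/-- Otherwise there are times `h n → 0` with `‖S (h n)‖ > n`, while `S (h n) x → x` is bounded for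
each `x`; this contradicts the uniform boundedness principle. -/
theorem IsC0Semigroup.exists_norm_le_near_zero {S : ℝ → V →L[ℝ] V} (hS : IsC0Semigroup S) :
    ∃ δ > 0, ∃ M, ∀ h, 0 ≤ h → h ≤ δ → ‖S h‖ ≤ M := by
  by_contra! hcon
  have hc : ∀ n : ℕ, ∃ h, 0 ≤ h ∧ h ≤ 1 / ((n : ℝ) + 1) ∧ (n : ℝ) < ‖S h‖ :=
    fun n => hcon _ (by positivity) n
  choose h h0 h1 h2 using hc
  have hlim : Tendsto h atTop (𝓝 0) :=
    squeeze_zero h0 h1 tendsto_one_div_add_atTop_nhds_zero_nat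
  have hSx : ∀ x, Tendsto (fun t => S t x) (𝓝[≥] 0) (𝓝 x) := by
    intro x
    rw [← Ioi_union_left, nhdsWithin_union, tendsto_sup]
    refine ⟨hS.tendsto_zero x, ?_⟩
    rw [nhdsWithin_singleton]
    have := tendsto_pure_nhds (fun t => S t x) 0
    simpa [hS.zero] using this
  have hb : ∀ x, ∃ C, ∀ n, ‖S (h n) x‖ ≤ C := by
    intro x
    have ht : Tendsto (fun n => S (h n) x) atTop (𝓝 x) :=
      (hSx x).comp (tendsto_nhdsWithin_iff.2 ⟨hlim, Eventually.of_forall h0⟩)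
    obtain ⟨C, hC⟩ := ht.norm.bddAbove_range
    exact ⟨C, fun n => hC ⟨n, rfl⟩⟩
  obtain ⟨C, hC⟩ := banach_steinhaus hb
  obtain ⟨n, hn⟩ := exists_nat_gt C
  exact absurd (hC n) (not_le.2 (hn.trans (h2 n)))

theorem IsC0Semigroup.exists_norm_le {S : ℝ → V →L[ℝ] V} (hS : IsC0Semigroup S) (b : ℝ) :
    ∃ M, ∀ h, 0 ≤ h → h ≤ b → ‖S h‖ ≤ M := by
  obtain ⟨δ, hδ, M, hM⟩ := hS.exists_norm_le_near_zero
  have key : ∀ n : ℕ, ∃ M, ∀ h, 0 ≤ h → h ≤ (n + 1 : ℝ) * δ → ‖S h‖ ≤ M := by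
    intro n
    induction n with
    | zero => exact ⟨M, fun h h0 h1 => hM h h0 (by simpa using h1)⟩
    | succ n ih =>
      obtain ⟨M', hM'⟩ := ih
      refine ⟨max M (M * M'), fun h h0 h1 => ?_⟩
      rcases le_total h δ with hh | hh
      · exact (hM h h0 hh).trans (le_max_left _ _)
      · have : S h = S δ ∘L S (h - δ) := by
          rw [← hS.add _ _ hδ.le (by linarith)]; congr 1; ring
        rw [this]
        refine (ContinuousLinearMap.opNorm_comp_le _ _).trans (le_trans ?_ (le_max_right _ _))
        push_cast at h1
        exact mul_le_mul (hM δ hδ.le le_rfl) (hM' _ (by linarith) (by linarith)) (norm_nonneg _)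
          ((norm_nonneg _).trans (hM 0 le_rfl hδ.le))
  obtain ⟨n, hn⟩ := exists_nat_gt (b / δ)
  obtain ⟨M', hM'⟩ := key n
  refine ⟨M', fun h h0 h1 => hM' h h0 (h1.trans ?_)⟩
  rw [div_lt_iff₀ hδ] at hn
  nlinarith

theorem IsC0Semigroup.continuousOn_of_tendsto {S : ℝ → V →L[ℝ] V} (hS : IsC0Semigroup S)
    (x : V) (b : ℝ) : ContinuousOn (fun t => S t x) (Icc 0 b) := by
  obtain ⟨M, hM⟩ := hS.exists_norm_le b
  have key : ∀ ε > 0, ∃ δ > 0, ∀ h, 0 ≤ h → h < δ → ‖S h x - x‖ < ε := by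
    intro ε hε
    have := (Metric.tendsto_nhdsWithin_nhds.1 (hS.tendsto_zero x)) ε hε
    obtain ⟨δ, hδ, h⟩ := this
    refine ⟨δ, hδ, fun k hk0 hk => ?_⟩
    rcases hk0.eq_or_lt with rfl | hk0
    · simpa [hS.zero] using hε
    · rw [← dist_eq_norm]
      exact h hk0 (by simpa [abs_of_pos hk0] using hk)
  -- With the operator at the smaller time factored out, this one inequality yields continuity from
  -- both sides.
  have key2 : ∀ s t, 0 ≤ s → s ≤ t → t ≤ b → ‖S t x - S s x‖ ≤ M * ‖S (t - s) x - x‖ := by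
    intro s t hs hst htb
    have : S t = S s ∘L S (t - s) := by
      rw [← hS.add _ _ hs (sub_nonneg.2 hst)]; congr 1; ring
    rw [this, ContinuousLinearMap.comp_apply, ← map_sub]
    exact (S s).le_of_opNorm_le (hM s hs (hst.trans htb)) _
  rcases lt_or_ge b 0 with hb | hb
  · simp [Icc_eq_empty (not_le.2 hb)]
  have hM0 : 0 ≤ M := (norm_nonneg _).trans (hM 0 le_rfl hb)
  intro t ht
  rw [Metric.continuousWithinAt_iff]
  intro ε hε
  obtain ⟨δ, hδ, h⟩ := key (ε / (M + 1)) (by positivity)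
  refine ⟨δ, hδ, fun {s} hs hd => ?_⟩
  have aux : ∀ r : V, ‖r‖ < ε / (M + 1) → M * ‖r‖ < ε := fun r hr => by
    rw [lt_div_iff₀ (by positivity)] at hr
    nlinarith [norm_nonneg r]
  rw [Real.dist_eq] at hd
  rcases le_total s t with hst | hst
  · rw [dist_comm, dist_eq_norm]
    refine (key2 s t hs.1 hst ht.2).trans_lt (aux _ (h _ (by linarith) ?_))
    rw [abs_sub_comm, abs_of_nonneg (by linarith)] at hd; exact hd
  · rw [dist_eq_norm]
    refine (key2 t s ht.1 hst hs.2).trans_lt (aux _ (h _ (by linarith) ?_))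
    rwa [abs_of_nonneg (by linarith)] at hd

/-- The continuous function `e ^ (-c t) • S t x` has right derivative zero, hence is constant. -/
theorem IsC0Semigroup.apply_eq_exp_smul {S : ℝ → V →L[ℝ] V} (hS : IsC0Semigroup S) {x : V}
    {c : ℝ} (hx : Tendsto (fun h : ℝ => h⁻¹ • (S h x - x)) (𝓝[>] 0) (𝓝 (c • x)))
    {t : ℝ} (ht : 0 ≤ t) : S t x = Real.exp (c * t) • x := by
  have hd : ∀ s ∈ Ico 0 t,
      HasDerivWithinAt (fun s => Real.exp (-(c * s)) • S s x) 0 (Ici s) s := by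
    intro s hs
    have h1 : HasDerivAt (fun s => Real.exp (-(c * s))) (Real.exp (-(c * s)) * -c) s := by
      have := ((hasDerivAt_id s).const_mul c).neg.exp
      simpa using this
    have := h1.hasDerivWithinAt.smul (hS.hasDerivWithinAt hx hs.1)
    refine HasDerivWithinAt.congr_deriv this ?_
    rw [map_smul, smul_smul, ← add_smul]
    simp
  have hcont : ContinuousOn (fun s => Real.exp (-(c * s)) • S s x) (Icc 0 t) :=
    (by fun_prop : Continuous fun s => Real.exp (-(c * s))).continuousOn.smul
      (hS.continuousOn_of_tendsto x t)
  have := constant_of_has_deriv_right_zero hcont hd t ⟨ht, le_rfl⟩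
  simp only [mul_zero, neg_zero, Real.exp_zero, hS.zero, one_smul,
    ContinuousLinearMap.id_apply] at this
  nth_rw 2 [← this]
  rw [smul_smul, ← Real.exp_add]
  simp

/-- The compact inverse `K` of `-A` is symmetric because `-A` is, so the spectral theorem for
compact symmetric operators applies to it. An eigenvector of `K` for `μ` is an eigenvector of `A`
for `-μ⁻¹`; positivity of `-A` forces `μ > 0`, since `⟪-A (K x), K x⟫ = μ ‖x‖ ^ 2`. -/
theorem exists_eigenspaces {A : V →ₗ.[ℝ] V} (hA : IsPosSymmWithCompactInverse (-A))
    {S : ℝ → V →L[ℝ] V} (hS : IsGeneratorOf A S) :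
    ∃ K : V →L[ℝ] V, (K : V →ₗ[ℝ] V).IsSymmetric ∧
      (⨆ μ, Module.End.eigenspace (K : V →ₗ[ℝ] V) μ)ᗮ = ⊥ ∧
      ∀ μ, ∀ x ∈ Module.End.eigenspace (K : V →ₗ[ℝ] V) μ, x ≠ 0 →
        0 < μ ∧ ∀ t, 0 ≤ t → S t x = Real.exp (-μ⁻¹ * t) • x := by
  obtain ⟨K, hK, hBK, hKB⟩ := hA.compact_inverse
  have hsymm : (K : V →ₗ[ℝ] V).IsSymmetric := by
    intro x y
    obtain ⟨hx, hx'⟩ := hBK x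
    obtain ⟨hy, hy'⟩ := hBK y
    have := hA.symmetric ⟨K x, hx⟩ ⟨K y, hy⟩
    rw [hx', hy'] at this
    exact this.symm
  refine ⟨K, hsymm, ContinuousLinearMap.orthogonalComplement_iSup_eigenspaces_eq_bot hK hsymm, ?_⟩
  intro μ x hx hx0
  rw [Module.End.mem_eigenspace_iff] at hx
  have hx : K x = μ • x := hx
  obtain ⟨hd, hBx⟩ := hBK x
  have hKx : K x ≠ 0 := by
    intro h0
    have : (⟨K x, hd⟩ : (-A).domain) = 0 := Subtype.ext h0
    rw [this, LinearPMap.map_zero] at hBx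
    exact hx0 hBx.symm
  have hpos := hA.pos ⟨K x, hd⟩ hKx
  rw [hBx] at hpos
  simp only [hx, inner_smul_right, real_inner_self_eq_norm_sq] at hpos
  have hμ : 0 < μ := by
    by_contra hcon
    exact absurd hpos (not_lt.2 (mul_nonpos_of_nonpos_of_nonneg (not_lt.1 hcon) (sq_nonneg _)))
  refine ⟨hμ, fun t ht => hS.semigroup.apply_eq_exp_smul ?_ ht⟩
  rw [← hS.mem_graph_iff]
  have hxK : x = μ⁻¹ • K x := by rw [hx, smul_smul, inv_mul_cancel₀ hμ.ne', one_smul]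
  have hg : (K x, -x) ∈ A.graph := by
    rw [LinearPMap.mem_graph_iff]
    refine ⟨⟨K x, hd⟩, rfl, ?_⟩
    rw [LinearPMap.neg_apply] at hBx
    exact neg_eq_iff_eq_neg.1 hBx
  have := A.graph.smul_mem μ⁻¹ hg
  rwa [Prod.smul_mk, ← hxK, smul_neg, ← neg_smul] at this

/-- Linear combinations of the operators of the semigroup are bounded by the supremum of the
corresponding combinations of exponentials over the spectrum. -/
theorem norm_sum_smul_semigroup_le {A : V →ₗ.[ℝ] V} (hA : IsPosSymmWithCompactInverse (-A))
    {S : ℝ → V →L[ℝ] V} (hS : IsGeneratorOf A S) {ι : Type*} (s : Finset ι) (c τ : ι → ℝ)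
    (hτ : ∀ i ∈ s, 0 ≤ τ i) (C : ℝ)
    (hC : ∀ l : ℝ, 0 < l → |∑ i ∈ s, c i * Real.exp (-(l * τ i))| ≤ C) :
    ‖∑ i ∈ s, c i • S (τ i)‖ ≤ C := by
  classical
  have hC0 : 0 ≤ C := (abs_nonneg _).trans (hC 1 one_pos)
  obtain ⟨K, hsymm, hbot, heig⟩ := exists_eigenspaces hA hS
  set L := ∑ i ∈ s, c i • S (τ i) with hL
  set m : ℝ → ℝ := fun μ => ∑ i ∈ s, c i * Real.exp (-μ⁻¹ * τ i) with hm
  have hLx : ∀ μ, ∀ x ∈ Module.End.eigenspace (K : V →ₗ[ℝ] V) μ, L x = m μ • x := by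
    intro μ x hx
    rcases eq_or_ne x 0 with rfl | hx0
    · simp
    · rw [hL, hm, sum_apply, Finset.sum_smul]
      refine Finset.sum_congr rfl fun i hi => ?_
      rw [smul_apply, (heig μ x hx hx0).2 _ (hτ i hi), smul_smul]
  have hmle : ∀ μ, ∀ x ∈ Module.End.eigenspace (K : V →ₗ[ℝ] V) μ,
      ‖m μ • x‖ ^ 2 ≤ C ^ 2 * ‖x‖ ^ 2 := by
    intro μ x hx
    rcases eq_or_ne x 0 with rfl | hx0
    · simp
    · rw [← mul_pow, norm_smul]
      gcongr
      simpa [hm] using hC μ⁻¹ (inv_pos.2 (heig μ x hx hx0).1)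
  -- Eigenspaces of a symmetric operator are orthogonal, so Pythagoras reduces the bound on their
  -- span to the bound on each of them. Density extends it to `V`.
  have hspan : ∀ x ∈ ⨆ μ, Module.End.eigenspace (K : V →ₗ[ℝ] V) μ, ‖L x‖ ≤ C * ‖x‖ := by
    intro x hx
    obtain ⟨f, rfl⟩ := (Submodule.mem_iSup_iff_exists_dfinsupp' _ x).1 hx
    have hof := hsymm.orthogonalFamily_eigenspaces
    have h1 := hof.norm_sum (fun μ => f μ) f.support
    have h2 := hof.norm_sum (fun μ => m μ • f μ) f.support
    refine le_of_sq_le_sq ?_ (by positivity)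
    rw [DFinsupp.sum, map_sum, mul_pow]
    simp only [Submodule.coe_subtypeₗᵢ, Submodule.subtype_apply, Submodule.coe_smul] at h1 h2
    rw [Finset.sum_congr rfl fun μ _ => hLx μ (f μ) (f μ).2, h1, h2, Finset.mul_sum]
    exact Finset.sum_le_sum fun μ _ => hmle μ (f μ) (f μ).2
  refine ContinuousLinearMap.opNorm_le_bound _ hC0 fun x => ?_
  have hdense : Dense ((⨆ μ, Module.End.eigenspace (K : V →ₗ[ℝ] V) μ : Submodule ℝ V) : Set V) :=
    Submodule.dense_iff_topologicalClosure_eq_top.2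
      ((Submodule.topologicalClosure_eq_top_iff).2 hbot)
  exact hdense.induction (P := fun x => ‖L x‖ ≤ C * ‖x‖) hspan
    (isClosed_le (by fun_prop) (by fun_prop)) x

theorem Real.rpow_le_one_add_of_le_one {y p : ℝ} (hy : 0 ≤ y) (hp : 0 ≤ p) (hp1 : p ≤ 1) :
    y ^ p ≤ 1 + y := by
  rcases le_total y 1 with h | h
  · exact (Real.rpow_le_one hy h hp).trans (by linarith)
  · exact (Real.rpow_le_rpow_of_exponent_le h hp1).trans (by rw [Real.rpow_one]; linarith)

/-- With the next bound, this is all that is needed on the spectral side: decay of the exponential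
pays for a power of `l` at the price of a singularity in time, while `1 - e ^ (-y) ≤ y ^ p` produces
that power from an increment. -/
theorem Real.exp_neg_mul_rpow_le {y p : ℝ} (hy : 0 ≤ y) (hp : 0 ≤ p) (hp1 : p ≤ 1) :
    Real.exp (-y) * y ^ p ≤ 1 := by
  have h1 : y ^ p ≤ Real.exp y :=
    (Real.rpow_le_one_add_of_le_one hy hp hp1).trans (by linarith [Real.add_one_le_exp y])
  calc Real.exp (-y) * y ^ p ≤ Real.exp (-y) * Real.exp y := by gcongr
    _ = 1 := by rw [← Real.exp_add]; simp

theorem Real.one_sub_exp_neg_le_rpow {y p : ℝ} (hy : 0 ≤ y) (hp : 0 ≤ p) (hp1 : p ≤ 1) :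
    1 - Real.exp (-y) ≤ y ^ p := by
  have h1 : 1 - Real.exp (-y) ≤ y := by linarith [Real.add_one_le_exp (-y)]
  rcases le_total y 1 with h | h
  · refine h1.trans ?_
    simpa using Real.rpow_le_rpow_of_exponent_ge' hy h hp hp1
  · exact (by linarith [Real.exp_pos (-y)] : _ ≤ (1 : ℝ)).trans (Real.one_le_rpow h hp)

variable {A : V →ₗ.[ℝ] V} {S : ℝ → V →L[ℝ] V}

theorem norm_semigroup_le_one (hA : IsPosSymmWithCompactInverse (-A)) (hS : IsGeneratorOf A S)
    {t : ℝ} (ht : 0 ≤ t) : ‖S t‖ ≤ 1 := by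
  have := norm_sum_smul_semigroup_le hA hS (Finset.univ : Finset (Fin 1)) ![1] ![t]
    (by simpa using ht) 1 (fun l hl => by
      simp only [Finset.univ_unique, Finset.sum_singleton, Fin.default_eq_zero,
        Matrix.cons_val_fin_one, one_mul, abs_of_pos (Real.exp_pos _)]
      exact Real.exp_le_one_iff.2 (neg_nonpos.2 (by positivity)))
  simpa using this

/-- For each spectral value, `e ^ (-l x) (1 - e ^ (-l h)) ≤ e ^ (-l x) (l h) ^ γ ≤ h ^ γ x ^ (-γ)`.
-/
theorem norm_semigroup_sub_le (hA : IsPosSymmWithCompactInverse (-A)) (hS : IsGeneratorOf A S)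
    {γ x h : ℝ} (hγ : 0 ≤ γ) (hγ1 : γ ≤ 1) (hx : 0 < x) (hh : 0 ≤ h) :
    ‖S (x + h) - S x‖ ≤ h ^ γ * x ^ (-γ) := by
  have := norm_sum_smul_semigroup_le hA hS (Finset.univ : Finset (Fin 2)) ![1, -1] ![x + h, x]
    (by simp [Fin.forall_fin_two]; constructor <;> positivity) (h ^ γ * x ^ (-γ)) (fun l hl => by
      have e : Real.exp (-(l * (x + h))) = Real.exp (-(l * x)) * Real.exp (-(l * h)) := by
        rw [← Real.exp_add]; ring_nf
      have h1 := Real.exp_neg_mul_rpow_le (mul_pos hl hx).le hγ hγ1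
      have h2 := Real.one_sub_exp_neg_le_rpow (mul_nonneg hl.le hh) hγ hγ1
      have h3 : Real.exp (-(l * h)) ≤ 1 := Real.exp_le_one_iff.2 (neg_nonpos.2 (by positivity))
      simp only [Fin.sum_univ_two, Matrix.cons_val_zero, Matrix.cons_val_one, one_mul]
      rw [e, show Real.exp (-(l * x)) * Real.exp (-(l * h)) + -1 * Real.exp (-(l * x))
        = - (Real.exp (-(l * x)) * (1 - Real.exp (-(l * h)))) by ring, abs_neg,
        abs_of_nonneg (mul_nonneg (Real.exp_pos _).le (by linarith))]
      rw [Real.mul_rpow hl.le hx.le] at h1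
      rw [Real.mul_rpow hl.le hh] at h2
      have hxγ : 0 < x ^ γ := Real.rpow_pos_of_pos hx _
      rw [Real.rpow_neg hx.le, ← div_eq_mul_inv, le_div_iff₀ hxγ]
      calc Real.exp (-(l * x)) * (1 - Real.exp (-(l * h))) * x ^ γ
          ≤ Real.exp (-(l * x)) * (l ^ γ * h ^ γ) * x ^ γ := by gcongr
        _ = (Real.exp (-(l * x)) * (l ^ γ * x ^ γ)) * h ^ γ := by ring
        _ ≤ 1 * h ^ γ := by gcongr
        _ = h ^ γ := one_mul _)
  simpa [sub_eq_add_neg] using this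

/-- The second difference of exponentials factors as `e ^ (-l x) (1 - e ^ (-l h)) (1 - e ^ (-l k))`.
The first factor is split into two copies of `e ^ (-l x / 2)`, one for each power of `l`; the
halving costs `2 ^ p * 2 ^ γ ≤ 4`. -/
theorem norm_semigroup_second_difference_le (hA : IsPosSymmWithCompactInverse (-A))
    (hS : IsGeneratorOf A S) {p γ x h k : ℝ} (hp : 0 ≤ p) (hp1 : p ≤ 1) (hγ : 0 ≤ γ)
    (hγ1 : γ ≤ 1) (hx : 0 < x) (hh : 0 ≤ h) (hk : 0 ≤ k) :
    ‖S (x + h + k) - S (x + h) - (S (x + k) - S x)‖ ≤ 4 * (h ^ p * k ^ γ * x ^ (-(p + γ))) := by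
  have hx2 : 0 < x / 2 := half_pos hx
  have := norm_sum_smul_semigroup_le hA hS (Finset.univ : Finset (Fin 4)) ![1, -1, -1, 1]
    ![x + h + k, x + h, x + k, x]
    (by simp [Fin.forall_fin_succ]; refine ⟨?_, ?_, ?_, ?_⟩ <;> positivity)
    (4 * (h ^ p * k ^ γ * x ^ (-(p + γ)))) (fun l hl => by
      have e1 : Real.exp (-(l * (x + h + k)))
          = Real.exp (-(l * x)) * Real.exp (-(l * h)) * Real.exp (-(l * k)) := by
        rw [← Real.exp_add, ← Real.exp_add]; ring_nf
      have e2 : Real.exp (-(l * (x + h))) = Real.exp (-(l * x)) * Real.exp (-(l * h)) := by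
        rw [← Real.exp_add]; ring_nf
      have e3 : Real.exp (-(l * (x + k))) = Real.exp (-(l * x)) * Real.exp (-(l * k)) := by
        rw [← Real.exp_add]; ring_nf
      have e4 : Real.exp (-(l * x)) = Real.exp (-(l * (x / 2))) * Real.exp (-(l * (x / 2))) := by
        rw [← Real.exp_add]; ring_nf
      have h1 := Real.exp_neg_mul_rpow_le (mul_pos hl hx2).le hp hp1
      have h1' := Real.exp_neg_mul_rpow_le (mul_pos hl hx2).le hγ hγ1
      have h2 := Real.one_sub_exp_neg_le_rpow (mul_nonneg hl.le hh) hp hp1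
      have h2' := Real.one_sub_exp_neg_le_rpow (mul_nonneg hl.le hk) hγ hγ1
      have h3 : Real.exp (-(l * h)) ≤ 1 := Real.exp_le_one_iff.2 (neg_nonpos.2 (by positivity))
      have h3' : Real.exp (-(l * k)) ≤ 1 := Real.exp_le_one_iff.2 (neg_nonpos.2 (by positivity))
      simp only [Fin.sum_univ_four, Matrix.cons_val_zero, Matrix.cons_val_one, Matrix.cons_val,
        one_mul]
      rw [e1, e2, e3, show ∀ a b c : ℝ, a * b * c + -1 * (a * b) + -1 * (a * c) + a
        = a * ((1 - b) * (1 - c)) from fun a b c => by ring,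
        abs_of_nonneg (mul_nonneg (Real.exp_pos _).le
          (mul_nonneg (by linarith) (by linarith)))]
      rw [Real.mul_rpow hl.le hx2.le, Real.div_rpow hx.le two_pos.le] at h1 h1'
      rw [Real.mul_rpow hl.le hh] at h2
      rw [Real.mul_rpow hl.le hk] at h2'
      have hxp : 0 < x ^ p := Real.rpow_pos_of_pos hx _
      have hxγ : 0 < x ^ γ := Real.rpow_pos_of_pos hx _
      have t1 : (2 : ℝ) ^ p ≤ 2 := by
        simpa using Real.rpow_le_rpow_of_exponent_le one_le_two hp1
      have t2 : (2 : ℝ) ^ γ ≤ 2 := by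
        simpa using Real.rpow_le_rpow_of_exponent_le one_le_two hγ1
      have t3 : (0 : ℝ) < 2 ^ p := by positivity
      have t4 : (0 : ℝ) < 2 ^ γ := by positivity
      rw [Real.rpow_neg hx.le, Real.rpow_add hx, ← div_eq_mul_inv, ← mul_div_assoc,
        le_div_iff₀ (by positivity)]
      set E := Real.exp (-(l * (x / 2)))
      have hE : 0 < E := Real.exp_pos _
      have g1 : E * (l ^ p * x ^ p) ≤ 2 := by
        rw [← mul_div_assoc, ← mul_div_assoc, div_le_one t3] at h1
        exact h1.trans t1
      have g2 : E * (l ^ γ * x ^ γ) ≤ 2 := by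
        rw [← mul_div_assoc, ← mul_div_assoc, div_le_one t4] at h1'
        exact h1'.trans t2
      rw [e4]
      calc E * E * ((1 - Real.exp (-(l * h))) * (1 - Real.exp (-(l * k)))) * (x ^ p * x ^ γ)
          ≤ E * E * ((l ^ p * h ^ p) * (l ^ γ * k ^ γ)) * (x ^ p * x ^ γ) := by
            gcongr
        _ = (E * (l ^ p * x ^ p)) * (E * (l ^ γ * x ^ γ)) * (h ^ p * k ^ γ) := by ring
        _ ≤ 2 * 2 * (h ^ p * k ^ γ) := by gcongr
        _ = 4 * (h ^ p * k ^ γ) := by ring)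
  convert this using 2
  simp [Fin.sum_univ_four]
  abel

end SpectralEstimates

/-! ### Real Beta integrals. -/

section BetaIntegral

theorem integral_rpow_mul_sub_rpow {a b x : ℝ} (ha : 0 < a) (hb : 0 < b) (hx : 0 < x) :
    ∫ r in 0..x, r ^ (a - 1) * (x - r) ^ (b - 1)
      = Real.Gamma a * Real.Gamma b / Real.Gamma (a + b) * x ^ (a + b - 1) := by
  have h1 := Complex.betaIntegral_scaled a b hx
  have h2 := Complex.Gamma_mul_Gamma_eq_betaIntegral (s := a) (t := b) (by simpa) (by simpa)
  rw [← Complex.ofReal_add, Complex.Gamma_ofReal, Complex.Gamma_ofReal, Complex.Gamma_ofReal] at h2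
  have h3 : ∫ r in 0..x, ((r : ℝ) : ℂ) ^ ((a : ℂ) - 1) * ((x : ℂ) - r) ^ ((b : ℂ) - 1)
      = ((∫ r in 0..x, r ^ (a - 1) * (x - r) ^ (b - 1) : ℝ) : ℂ) := by
    rw [← intervalIntegral.integral_ofReal]
    refine intervalIntegral.integral_congr fun r hr => ?_
    rw [uIcc_of_le hx.le] at hr
    push_cast
    rw [Complex.ofReal_cpow hr.1, Complex.ofReal_cpow (sub_nonneg.2 hr.2)]
    push_cast
    rfl
  have hG : (Real.Gamma (a + b) : ℂ) ≠ 0 :=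
    Complex.ofReal_ne_zero.2 (Real.Gamma_pos_of_pos (add_pos ha hb)).ne'
  rw [h3] at h1
  have h4 : Complex.betaIntegral a b
      = ((Real.Gamma a * Real.Gamma b / Real.Gamma (a + b) : ℝ) : ℂ) := by
    push_cast
    rw [eq_div_iff hG, mul_comm, h2]
  rw [h4, show ((a : ℂ) + b - 1) = ((a + b - 1 : ℝ) : ℂ) by push_cast; ring,
    ← Complex.ofReal_cpow hx.le, ← Complex.ofReal_mul, Complex.ofReal_inj] at h1
  rw [h1, mul_comm]

theorem integral_sub_rpow_mul_sub_rpow {a b q x : ℝ} (ha : 0 < a) (hb : 0 < b) (hx : q < x) :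
    ∫ r in q..x, (x - r) ^ (a - 1) * (r - q) ^ (b - 1)
      = Real.Gamma a * Real.Gamma b / Real.Gamma (a + b) * (x - q) ^ (a + b - 1) := by
  rw [← integral_rpow_mul_sub_rpow ha hb (sub_pos.2 hx)]
  have := intervalIntegral.integral_comp_sub_left (a := q) (b := x)
    (fun s => s ^ (a - 1) * (x - q - s) ^ (b - 1)) x
  rw [sub_self] at this
  rw [← this]
  refine intervalIntegral.integral_congr fun r _ => ?_
  ring_nf

theorem intervalIntegrable_sub_rpow_mul_sub_rpow {a b q x : ℝ} (ha : 0 < a) (hb : 0 < b)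
    (hx : q < x) :
    IntervalIntegrable (fun r => (x - r) ^ (a - 1) * (r - q) ^ (b - 1)) volume q x := by
  -- The integral of a non-integrable function is zero by convention, whereas the Beta value is
  -- positive.
  refine intervalIntegral.intervalIntegrable_of_integral_ne_zero ?_
  rw [integral_sub_rpow_mul_sub_rpow ha hb hx]
  have := Real.Gamma_pos_of_pos ha
  have := Real.Gamma_pos_of_pos hb
  have := Real.Gamma_pos_of_pos (add_pos ha hb)
  have := Real.rpow_pos_of_pos (sub_pos.2 hx) (a + b - 1)
  positivity

end BetaIntegral

/-! ### Fubini's theorem on a triangle. -/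

section Triangle

variable {E : Type*} [NormedAddCommGroup E]

theorem intervalIntegrable_iff_Ioo {f : ℝ → E} {a b : ℝ} (h : a ≤ b) :
    IntervalIntegrable f volume a b ↔ IntegrableOn f (Ioo a b) :=
  intervalIntegrable_iff_integrableOn_Ioo_of_le h

variable [NormedSpace ℝ E]

theorem intervalIntegral_eq_Ioo {f : ℝ → E} {a b : ℝ} (h : a ≤ b) :
    ∫ r in a..b, f r = ∫ r in Ioo a b, f r := by
  rw [intervalIntegral.integral_of_le h, integral_Ioc_eq_integral_Ioo]

theorem intervalIntegral_congr_Ioo {f g : ℝ → E} {a b : ℝ} (h : a ≤ b)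
    (hfg : ∀ r ∈ Ioo a b, f r = g r) : ∫ r in a..b, f r = ∫ r in a..b, g r := by
  rw [intervalIntegral_eq_Ioo h, intervalIntegral_eq_Ioo h]
  exact setIntegral_congr_fun measurableSet_Ioo hfg

theorem intervalIntegral_congr_ae_Ioo {f g : ℝ → E} {a b : ℝ} (h : a ≤ b)
    (hfg : ∀ᵐ r ∂volume.restrict (Ioo a b), f r = g r) :
    ∫ r in a..b, f r = ∫ r in a..b, g r := by
  rw [intervalIntegral_eq_Ioo h, intervalIntegral_eq_Ioo h]
  exact integral_congr_ae hfg

/-- The set of pairs `(r, q)` with `q < r`. -/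
def lowerTriangle : Set (ℝ × ℝ) := {p | p.2 < p.1}

theorem isOpen_lowerTriangle : IsOpen lowerTriangle := isOpen_lt continuous_snd continuous_fst

/-- Integrability of `F` on the triangle `0 < q < r < x`. -/
def TriangleIntegrable {E : Type*} [NormedAddCommGroup E] (x : ℝ) (F : ℝ → ℝ → E) : Prop :=
  Integrable (lowerTriangle.indicator fun p => F p.1 p.2)
    ((volume.restrict (Ioo 0 x)).prod (volume.restrict (Ioo 0 x)))

omit [NormedSpace ℝ E] in
theorem lowerTriangle_indicator_left (F : ℝ → ℝ → E) (r : ℝ) :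
    (fun q => lowerTriangle.indicator (fun p => F p.1 p.2) (r, q)) = (Iio r).indicator (F r) := by
  ext q
  by_cases h : q < r <;> simp [indicator, lowerTriangle, h]

omit [NormedSpace ℝ E] in
theorem lowerTriangle_indicator_right (F : ℝ → ℝ → E) (q : ℝ) :
    (fun r => lowerTriangle.indicator (fun p => F p.1 p.2) (r, q))
      = (Ioi q).indicator fun r => F r q := by
  ext r
  by_cases h : q < r <;> simp [indicator, lowerTriangle, h]

theorem restrict_Ioo_Iio {x r : ℝ} (hr : r ∈ Ioo 0 x) :
    (volume.restrict (Ioo 0 x)).restrict (Iio r) = volume.restrict (Ioo 0 r) := by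
  rw [Measure.restrict_restrict measurableSet_Iio]
  congr 1
  ext q
  simp only [mem_inter_iff, mem_Iio, mem_Ioo]
  constructor
  · rintro ⟨h1, h2, h3⟩; exact ⟨h2, h1⟩
  · rintro ⟨h1, h2⟩; exact ⟨h2, h1, h2.trans hr.2⟩

theorem restrict_Ioo_Ioi {x q : ℝ} (hq : q ∈ Ioo 0 x) :
    (volume.restrict (Ioo 0 x)).restrict (Ioi q) = volume.restrict (Ioo q x) := by
  rw [Measure.restrict_restrict measurableSet_Ioi]
  congr 1
  ext r
  simp only [mem_inter_iff, mem_Ioi, mem_Ioo]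
  constructor
  · rintro ⟨h1, h2, h3⟩; exact ⟨h1, h3⟩
  · rintro ⟨h1, h2⟩; exact ⟨h1, hq.1.trans h1, h2⟩

theorem integral_triangle_left (F : ℝ → ℝ → E) {x r : ℝ} (hr : r ∈ Ioo 0 x) :
    ∫ q in Ioo 0 x, lowerTriangle.indicator (fun p => F p.1 p.2) (r, q)
      = ∫ q in 0..r, F r q := by
  rw [lowerTriangle_indicator_left, integral_indicator measurableSet_Iio, restrict_Ioo_Iio hr,
    intervalIntegral_eq_Ioo hr.1.le]

theorem integral_triangle_right (F : ℝ → ℝ → E) {x q : ℝ} (hq : q ∈ Ioo 0 x) :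
    ∫ r in Ioo 0 x, lowerTriangle.indicator (fun p => F p.1 p.2) (r, q)
      = ∫ r in q..x, F r q := by
  rw [lowerTriangle_indicator_right, integral_indicator measurableSet_Ioi, restrict_Ioo_Ioi hq,
    intervalIntegral_eq_Ioo hq.2.le]

omit [NormedSpace ℝ E] in
theorem integrable_triangle_left_iff (F : ℝ → ℝ → E) {x r : ℝ} (hr : r ∈ Ioo 0 x) :
    Integrable (fun q => lowerTriangle.indicator (fun p => F p.1 p.2) (r, q))
      (volume.restrict (Ioo 0 x)) ↔ IntervalIntegrable (F r) volume 0 r := by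
  rw [lowerTriangle_indicator_left, integrable_indicator_iff measurableSet_Iio, IntegrableOn,
    restrict_Ioo_Iio hr, intervalIntegrable_iff_Ioo hr.1.le, IntegrableOn]

omit [NormedSpace ℝ E] in
theorem integrable_triangle_right_iff (F : ℝ → ℝ → E) {x q : ℝ} (hq : q ∈ Ioo 0 x) :
    Integrable (fun r => lowerTriangle.indicator (fun p => F p.1 p.2) (r, q))
      (volume.restrict (Ioo 0 x)) ↔ IntervalIntegrable (fun r => F r q) volume q x := by
  rw [lowerTriangle_indicator_right, integrable_indicator_iff measurableSet_Ioi, IntegrableOn,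
    restrict_Ioo_Ioi hq, intervalIntegrable_iff_Ioo hq.2.le, IntegrableOn]

theorem TriangleIntegrable.integral_swap {F : ℝ → ℝ → E} {x : ℝ} (hx : 0 ≤ x)
    (hF : TriangleIntegrable x F) :
    ∫ r in 0..x, ∫ q in 0..r, F r q = ∫ q in 0..x, ∫ r in q..x, F r q := by
  have h := (integral_prod _ hF).symm.trans (integral_prod_symm _ hF)
  rw [intervalIntegral_eq_Ioo hx, intervalIntegral_eq_Ioo hx]
  convert h using 1
  · exact setIntegral_congr_fun measurableSet_Ioo fun r hr => (integral_triangle_left F hr).symm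
  · exact setIntegral_congr_fun measurableSet_Ioo fun r hr => (integral_triangle_right F hr).symm

theorem TriangleIntegrable.integral_prod_eq {F : ℝ → ℝ → E} {x : ℝ} (hx : 0 ≤ x)
    (hF : TriangleIntegrable x F) :
    ∫ p, lowerTriangle.indicator (fun p => F p.1 p.2) p
      ∂(volume.restrict (Ioo 0 x)).prod (volume.restrict (Ioo 0 x))
      = ∫ r in 0..x, ∫ q in 0..r, F r q := by
  rw [integral_prod _ hF, intervalIntegral_eq_Ioo hx]
  exact setIntegral_congr_fun measurableSet_Ioo fun r hr => integral_triangle_left F hr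

theorem TriangleIntegrable.integrableOn_left {F : ℝ → ℝ → E} {x : ℝ}
    (hF : TriangleIntegrable x F) : IntegrableOn (fun r => ∫ q in 0..r, F r q) (Ioo 0 x) := by
  have := hF.integral_prod_left
  exact IntegrableOn.congr_fun this (fun r hr => integral_triangle_left F hr) measurableSet_Ioo

omit [NormedSpace ℝ E] in
theorem TriangleIntegrable.ae_left {F : ℝ → ℝ → E} {x : ℝ} (hF : TriangleIntegrable x F) :
    ∀ᵐ r ∂volume.restrict (Ioo 0 x), IntervalIntegrable (F r) volume 0 r := by
  filter_upwards [hF.prod_right_ae, ae_restrict_mem measurableSet_Ioo] with r h hr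
  exact (integrable_triangle_left_iff F hr).1 h

omit [NormedSpace ℝ E] in
theorem TriangleIntegrable.mono {F : ℝ → ℝ → E} {x y : ℝ} (hF : TriangleIntegrable y F)
    (h : x ≤ y) : TriangleIntegrable x F := by
  unfold TriangleIntegrable at *
  rw [Measure.prod_restrict] at *
  exact IntegrableOn.mono_set hF (prod_mono (Ioo_subset_Ioo_right h) (Ioo_subset_Ioo_right h))

-- Tonelli's criterion with the inner integral in `q`: integrable slices and an integrable majorant
-- of the slice norms. `triangleIntegrable_of_right` is the same with the inner integral in `r`.
omit [NormedSpace ℝ E] in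
theorem triangleIntegrable_of_left {F : ℝ → ℝ → E} {x : ℝ} {m : ℝ → ℝ}
    (hF : AEStronglyMeasurable (lowerTriangle.indicator fun p => F p.1 p.2)
      ((volume.restrict (Ioo 0 x)).prod (volume.restrict (Ioo 0 x))))
    (h1 : ∀ r ∈ Ioo 0 x, IntervalIntegrable (F r) volume 0 r)
    (h2 : ∀ r ∈ Ioo 0 x, ∫ q in 0..r, ‖F r q‖ ≤ m r) (hm : IntegrableOn m (Ioo 0 x)) :
    TriangleIntegrable x F := by
  refine (integrable_prod_iff hF).2 ⟨?_, ?_⟩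
  · filter_upwards [ae_restrict_mem measurableSet_Ioo] with r hr
    exact (integrable_triangle_left_iff F hr).2 (h1 r hr)
  · refine Integrable.mono' hm hF.norm.integral_prod_right' ?_
    filter_upwards [ae_restrict_mem measurableSet_Ioo] with r hr
    rw [Real.norm_of_nonneg (integral_nonneg fun _ => norm_nonneg _)]
    refine le_trans (le_of_eq ?_) (h2 r hr)
    rw [← integral_triangle_left (fun r q => ‖F r q‖) hr]
    simp only [norm_indicator_eq_indicator_norm]

omit [NormedSpace ℝ E] in
theorem triangleIntegrable_of_right {F : ℝ → ℝ → E} {x : ℝ} {m : ℝ → ℝ}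
    (hF : AEStronglyMeasurable (lowerTriangle.indicator fun p => F p.1 p.2)
      ((volume.restrict (Ioo 0 x)).prod (volume.restrict (Ioo 0 x))))
    (h1 : ∀ q ∈ Ioo 0 x, IntervalIntegrable (fun r => F r q) volume q x)
    (h2 : ∀ q ∈ Ioo 0 x, ∫ r in q..x, ‖F r q‖ ≤ m q) (hm : IntegrableOn m (Ioo 0 x)) :
    TriangleIntegrable x F := by
  refine (integrable_prod_iff' hF).2 ⟨?_, ?_⟩
  · filter_upwards [ae_restrict_mem measurableSet_Ioo] with q hq
    exact (integrable_triangle_right_iff F hq).2 (h1 q hq)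
  · refine Integrable.mono' hm hF.norm.prod_swap.integral_prod_right' ?_
    filter_upwards [ae_restrict_mem measurableSet_Ioo] with r hr
    rw [Real.norm_of_nonneg (integral_nonneg fun _ => norm_nonneg _)]
    refine le_trans (le_of_eq ?_) (h2 r hr)
    rw [← integral_triangle_right (fun r q => ‖F r q‖) hr]
    simp only [norm_indicator_eq_indicator_norm]

end Triangle

/-! ### Riemann-Liouville integrals and their semigroup property. -/

section FractionalIntegral

variable {E : Type*} [NormedAddCommGroup E] [NormedSpace ℝ E]

/-- The left Riemann-Liouville fractional integral of order `a` with base point `0`. -/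
noncomputable def fracInt (a : ℝ) (φ : ℝ → E) (x : ℝ) : E :=
  (Real.Gamma a)⁻¹ • ∫ q in 0..x, (x - q) ^ (a - 1) • φ q

theorem fracInt_one (φ : ℝ → E) (x : ℝ) : fracInt 1 φ x = ∫ q in 0..x, φ q := by
  simp [fracInt]

theorem fracInt_congr {a x : ℝ} {φ ψ : ℝ → E} (hx : 0 ≤ x) (h : ∀ q ∈ Ioo 0 x, φ q = ψ q) :
    fracInt a φ x = fracInt a ψ x := by
  rw [fracInt, fracInt, intervalIntegral_congr_Ioo hx fun q hq => by rw [h q hq]]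

/-- Integrating the norm in `r` first gives a Beta integral, a multiple of `‖(x - q) ^ (a + b - 1) •
φ q‖`. This justifies the exchange of integrals in `fracInt_fracInt`. -/
theorem triangleIntegrable_rpow_mul_rpow_smul {a b x : ℝ} (ha : 0 < a) (hb : 0 < b)
    {φ : ℝ → E} (hφ : AEStronglyMeasurable φ (volume.restrict (Ioo 0 x)))
    (hφ' : IntegrableOn (fun q => (x - q) ^ (a + b - 1) • φ q) (Ioo 0 x)) :
    TriangleIntegrable x fun r q => ((x - r) ^ (a - 1) * (r - q) ^ (b - 1)) • φ q := by
  refine triangleIntegrable_of_right (m := fun q =>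
    Real.Gamma a * Real.Gamma b / Real.Gamma (a + b) * ‖(x - q) ^ (a + b - 1) • φ q‖) ?_ ?_ ?_
    (hφ'.norm.const_mul _)
  · refine AEStronglyMeasurable.indicator ?_ isOpen_lowerTriangle.measurableSet
    refine AEStronglyMeasurable.smul ?_ hφ.comp_snd
    exact (by fun_prop : Measurable fun p : ℝ × ℝ =>
      (x - p.1) ^ (a - 1) * (p.1 - p.2) ^ (b - 1)).aestronglyMeasurable
  · intro q hq
    rw [intervalIntegrable_iff_Ioo hq.2.le]
    exact Integrable.smul_const ((intervalIntegrable_iff_Ioo hq.2.le).1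
      (intervalIntegrable_sub_rpow_mul_sub_rpow ha hb hq.2)) _
  · intro q hq
    have h1 : ∀ r ∈ Ioo q x, ‖((x - r) ^ (a - 1) * (r - q) ^ (b - 1)) • φ q‖
        = (x - r) ^ (a - 1) * (r - q) ^ (b - 1) * ‖φ q‖ := by
      intro r hr
      rw [norm_smul, Real.norm_of_nonneg]
      have := sub_pos.2 hr.1
      have := sub_pos.2 hr.2
      positivity
    rw [intervalIntegral_congr_Ioo hq.2.le h1, intervalIntegral.integral_mul_const,
      integral_sub_rpow_mul_sub_rpow ha hb hq.2, norm_smul, Real.norm_of_nonneg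
        (Real.rpow_nonneg (sub_nonneg.2 hq.2.le) _), mul_assoc]

/-- The semigroup property of the fractional integrals. -/
theorem fracInt_fracInt [CompleteSpace E] {a b x : ℝ} (ha : 0 < a) (hb : 0 < b) (hx : 0 ≤ x)
    {φ : ℝ → E} (hφ : AEStronglyMeasurable φ (volume.restrict (Ioo 0 x)))
    (hφ' : IntegrableOn (fun q => (x - q) ^ (a + b - 1) • φ q) (Ioo 0 x)) :
    fracInt a (fracInt b φ) x = fracInt (a + b) φ x := by
  have h := (triangleIntegrable_rpow_mul_rpow_smul ha hb hφ hφ').integral_swap hx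
  have h1 : ∀ r, ∫ q in 0..r, ((x - r) ^ (a - 1) * (r - q) ^ (b - 1)) • φ q
      = Real.Gamma b • ((x - r) ^ (a - 1) • fracInt b φ r) := by
    intro r
    simp_rw [mul_smul]
    rw [intervalIntegral.integral_smul, fracInt, smul_comm, smul_smul (Real.Gamma b),
      mul_inv_cancel₀ (Real.Gamma_pos_of_pos hb).ne', one_smul]
  have h2 : ∀ q ∈ Ioo 0 x, ∫ r in q..x, ((x - r) ^ (a - 1) * (r - q) ^ (b - 1)) • φ q
      = (Real.Gamma a * Real.Gamma b / Real.Gamma (a + b)) • ((x - q) ^ (a + b - 1) • φ q) := by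
    intro q hq
    rw [intervalIntegral.integral_smul_const, integral_sub_rpow_mul_sub_rpow ha hb hq.2, mul_smul]
  rw [intervalIntegral_congr_Ioo hx h2, intervalIntegral.integral_smul] at h
  simp_rw [h1] at h
  rw [intervalIntegral.integral_smul] at h
  rw [fracInt, fracInt]
  have hga := (Real.Gamma_pos_of_pos ha).ne'
  have hgb := (Real.Gamma_pos_of_pos hb).ne'
  rw [eq_comm, ← inv_smul_eq_iff₀ hgb] at h
  rw [← h, smul_smul, smul_smul]
  congr 1
  field_simp

theorem integrableOn_rpow_smul {a x : ℝ} (ha : 0 ≤ a) {φ : ℝ → E}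
    (hφ : IntegrableOn φ (Ioo 0 x)) : IntegrableOn (fun q => (x - q) ^ a • φ q) (Ioo 0 x) := by
  refine Integrable.bdd_smul hφ (x ^ a) ?_ ?_
  · exact (by fun_prop : Measurable fun q : ℝ => (x - q) ^ a).aestronglyMeasurable
  · filter_upwards [ae_restrict_mem measurableSet_Ioo] with q hq
    rw [Real.norm_of_nonneg (Real.rpow_nonneg (sub_nonneg.2 hq.2.le) _)]
    exact Real.rpow_le_rpow (sub_nonneg.2 hq.2.le) (by linarith [hq.1]) ha

theorem integrableOn_fracInt {b x : ℝ} (hb : 0 < b) {φ : ℝ → E}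
    (hφ : IntegrableOn φ (Ioo 0 x)) : IntegrableOn (fracInt b φ) (Ioo 0 x) := by
  -- For `a = 1` the outer kernel is the constant `1`, so the inner integral is `fracInt b φ` up to
  -- a Gamma factor.
  have h := (triangleIntegrable_rpow_mul_rpow_smul (a := 1) one_pos hb hφ.aestronglyMeasurable
    (integrableOn_rpow_smul (by linarith) hφ)).integrableOn_left
  simp only [sub_self, Real.rpow_zero, one_mul] at h
  exact h.smul _

theorem integrableOn_sub_rpow {c x : ℝ} (hc : -1 < c) :
    IntegrableOn (fun q => (x - q) ^ c) (Ioo 0 x) := by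
  have := (intervalIntegral.intervalIntegrable_rpow' (a := 0) (b := x) hc).comp_sub_left x
  simp only [sub_zero, sub_self] at this
  exact (this.symm.1).mono_set Ioo_subset_Ioc_self

theorem integrableOn_rpow {c x : ℝ} (hc : -1 < c) :
    IntegrableOn (fun q : ℝ => q ^ c) (Ioo 0 x) :=
  (intervalIntegral.intervalIntegrable_rpow' (a := 0) (b := x) hc).1.mono_set Ioo_subset_Ioc_self

theorem MeasureTheory.IntegrableOn.smul_of_bounded {w : ℝ → ℝ} {s : Set ℝ} (hs : MeasurableSet s)
    (hw : IntegrableOn w s) {φ : ℝ → E} (hφ : AEStronglyMeasurable φ (volume.restrict s)) {M : ℝ}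
    (hM : ∀ r ∈ s, ‖φ r‖ ≤ M) : IntegrableOn (fun r => w r • φ r) s :=
  Integrable.smul_bdd hw M hφ ((ae_restrict_mem hs).mono hM)

/-- Both functions are almost everywhere the derivative of their common primitive (Lebesgue
differentiation). Identities between fractional operators are proved below by comparing primitives
in this way. -/
theorem ae_eq_of_forall_intervalIntegral_eq [CompleteSpace E] {t : ℝ} {φ ψ : ℝ → E}
    (hφ : IntegrableOn φ (Ioo 0 t)) (hψ : IntegrableOn ψ (Ioo 0 t))
    (h : ∀ x ∈ Ioo 0 t, ∫ q in 0..x, φ q = ∫ q in 0..x, ψ q) :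
    ∀ᵐ r ∂volume.restrict (Ioo 0 t), φ r = ψ r := by
  rcases le_or_gt t 0 with ht | ht
  · simp [Ioo_eq_empty (not_lt.2 ht)]
  rw [ae_restrict_iff' measurableSet_Ioo]
  have h1 := ((intervalIntegrable_iff_Ioo ht.le).2 hφ).ae_hasDerivAt_integral
  have h2 := ((intervalIntegrable_iff_Ioo ht.le).2 hψ).ae_hasDerivAt_integral
  filter_upwards [h1, h2] with r hr1 hr2 hr
  have hm : r ∈ uIcc 0 t := by rw [uIcc_of_le ht.le]; exact Ioo_subset_Icc_self hr
  have d1 := hr1 hm 0 left_mem_uIcc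
  have d2 := hr2 hm 0 left_mem_uIcc
  refine d1.unique (d2.congr_of_eventuallyEq ?_)
  filter_upwards [Ioo_mem_nhds hr.1 hr.2] with x hx
  exact h x hx

end FractionalIntegral

/-! ### Weyl derivatives as inverses of fractional integrals. -/

section WeylInversion

variable {E : Type*} [NormedAddCommGroup E] [NormedSpace ℝ E]

/-- Functions on `(0, t)` whose left Weyl derivative of order `α` converges absolutely. -/
structure WeylAdmissible (α t : ℝ) (f : ℝ → E) : Prop where
  aestronglyMeasurable : AEStronglyMeasurable f (volume.restrict (Ioo 0 t))
  bounded : ∃ M, ∀ r ∈ Ioo 0 t, ‖f r‖ ≤ M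
  kernel : TriangleIntegrable t (weylLeftKernel α f)

theorem WeylAdmissible.mono {α t x : ℝ} {f : ℝ → E} (hf : WeylAdmissible α t f) (h : x ≤ t) :
    WeylAdmissible α x f where
  aestronglyMeasurable := hf.aestronglyMeasurable.mono_set (Ioo_subset_Ioo_right h)
  bounded := hf.bounded.imp fun _ hM r hr => hM r ⟨hr.1, hr.2.trans_le h⟩
  kernel := hf.kernel.mono h

theorem WeylAdmissible.integrableOn_rpow_smul {α t c : ℝ} {f : ℝ → E} (hf : WeylAdmissible α t f)
    (hc : -1 < c) : IntegrableOn (fun r => r ^ c • f r) (Ioo 0 t) := by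
  obtain ⟨M, hM⟩ := hf.bounded
  exact (integrableOn_rpow hc).smul_of_bounded measurableSet_Ioo hf.aestronglyMeasurable hM

theorem WeylAdmissible.integrableOn_sub_rpow_smul {α t c : ℝ} {f : ℝ → E}
    (hf : WeylAdmissible α t f) (hc : -1 < c) :
    IntegrableOn (fun r => (t - r) ^ c • f r) (Ioo 0 t) := by
  obtain ⟨M, hM⟩ := hf.bounded
  exact (integrableOn_sub_rpow hc).smul_of_bounded measurableSet_Ioo hf.aestronglyMeasurable hM

theorem WeylAdmissible.integrableOn {α t : ℝ} {f : ℝ → E} (hf : WeylAdmissible α t f) :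
    IntegrableOn f (Ioo 0 t) := by
  simpa using hf.integrableOn_rpow_smul (c := 0) (by norm_num)

theorem WeylAdmissible.integrableOn_weylLeft {α t : ℝ} (hα1 : α < 1) {f : ℝ → E}
    (hf : WeylAdmissible α t f) : IntegrableOn (weylLeft α 0 f) (Ioo 0 t) := by
  have h1 := hf.integrableOn_rpow_smul (c := -α) (by linarith)
  have h2 := hf.kernel.integrableOn_left.smul α
  refine IntegrableOn.congr_fun ((h1.add h2).smul (Real.Gamma (1 - α))⁻¹) (fun r _ => ?_)
    measurableSet_Ioo
  simp [weylLeft]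

/-- Dominated convergence with majorant `w ^ (-α) * M`. It serves for the distances `w r = r` and `w
r = t - r` to the two end points. -/
theorem tendsto_integral_add_rpow_smul {t α M : ℝ} (hα : 0 < α) {w : ℝ → ℝ}
    (hw : Measurable w) (hw0 : ∀ r ∈ Ioo 0 t, 0 < w r)
    (hwi : IntegrableOn (fun r => w r ^ (-α)) (Ioo 0 t))
    {f : ℝ → E} (hf : AEStronglyMeasurable f (volume.restrict (Ioo 0 t)))
    (hM : ∀ r ∈ Ioo 0 t, ‖f r‖ ≤ M) :
    Tendsto (fun ε => ∫ r in Ioo 0 t, (w r + ε) ^ (-α) • f r) (𝓝[>] 0)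
      (𝓝 (∫ r in Ioo 0 t, w r ^ (-α) • f r)) := by
  refine tendsto_integral_filter_of_dominated_convergence (fun r => w r ^ (-α) * M) ?_ ?_
    (hwi.mul_const M) ?_
  · refine Eventually.of_forall fun ε => AEStronglyMeasurable.smul ?_ hf
    exact ((hw.add_const ε).pow_const _).aestronglyMeasurable
  · filter_upwards [self_mem_nhdsWithin] with ε hε
    filter_upwards [ae_restrict_mem measurableSet_Ioo] with r hr
    have h0 := hw0 r hr
    have hε : 0 < ε := hε
    rw [norm_smul, Real.norm_of_nonneg (Real.rpow_nonneg (by linarith) _)]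
    refine mul_le_mul ?_ (hM r hr) (norm_nonneg _) (Real.rpow_nonneg h0.le _)
    exact Real.rpow_le_rpow_of_nonpos h0 (by linarith) (by linarith)
  · filter_upwards [ae_restrict_mem measurableSet_Ioo] with r hr
    refine Tendsto.smul_const ?_ _
    have h1 : Tendsto (fun ε => w r + ε) (𝓝[>] 0) (𝓝 (w r)) := by
      have : Tendsto (fun ε => w r + ε) (𝓝 0) (𝓝 (w r + 0)) := tendsto_id.const_add _
      rw [add_zero] at this
      exact this.mono_left nhdsWithin_le_nhds
    exact h1.rpow_const (Or.inl (hw0 r hr).ne')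

theorem integral_regularized_kernel {α ε y : ℝ} (hα : 0 < α) (hε : 0 < ε) (hy : 0 ≤ y) :
    ∫ s in ε..y + ε, s ^ (-(1 + α)) = α⁻¹ * (ε ^ (-α) - (y + ε) ^ (-α)) := by
  rw [integral_rpow (Or.inr ⟨by linarith, ?_⟩)]
  · rw [show -(1 + α) + 1 = -α by ring]
    field_simp
    ring
  · rw [uIcc_of_le (by linarith)]
    exact fun h => absurd h.1 (not_le.2 hε)

/-- The shift by `ε` makes the kernel bounded, so the terms with `f r` and `f q` may be integrated
separately, the second after an exchange of integrals. They give `ε ^ (-α) - (r + ε) ^ (-α)` and `ε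
^ (-α) - (t - q + ε) ^ (-α)` as weights, and the parts that diverge as `ε → 0` cancel. -/
theorem WeylAdmissible.regularized_identity [CompleteSpace E] {α t ε : ℝ} (hα : 0 < α)
    (hε : 0 < ε) (ht : 0 ≤ t) {f : ℝ → E} (hf : WeylAdmissible α t f) :
    α • (∫ r in 0..t, ∫ q in 0..r, (r - q + ε) ^ (-(1 + α)) • (f r - f q))
      + ∫ r in Ioo 0 t, (r + ε) ^ (-α) • f r = ∫ r in Ioo 0 t, (t - r + ε) ^ (-α) • f r := by
  obtain ⟨M, hM⟩ := hf.bounded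
  have hbd : ∀ (g : ℝ × ℝ → E) , AEStronglyMeasurable g
      ((volume.restrict (Ioo 0 t)).prod (volume.restrict (Ioo 0 t))) →
      (∀ p ∈ Ioo 0 t ×ˢ Ioo 0 t, ‖g p‖ ≤ M) →
      TriangleIntegrable t fun r q => (r - q + ε) ^ (-(1 + α)) • g (r, q) := by
    intro g hg hgM
    unfold TriangleIntegrable
    refine Integrable.of_bound ?_ (ε ^ (-(1 + α)) * M) ?_
    · refine AEStronglyMeasurable.indicator ?_ isOpen_lowerTriangle.measurableSet
      exact AEStronglyMeasurable.smul (by fun_prop : Measurable fun p : ℝ × ℝ =>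
        (p.1 - p.2 + ε) ^ (-(1 + α))).aestronglyMeasurable hg
    · rw [Measure.prod_restrict]
      filter_upwards [ae_restrict_mem (measurableSet_Ioo.prod measurableSet_Ioo)] with p hp
      have hM0 : 0 ≤ M := (norm_nonneg _).trans (hgM p hp)
      by_cases h : p ∈ lowerTriangle
      · rw [indicator_of_mem h, norm_smul]
        have h : 0 < p.1 - p.2 := sub_pos.2 h
        rw [
          Real.norm_of_nonneg (Real.rpow_nonneg (by linarith) _)]
        exact mul_le_mul (Real.rpow_le_rpow_of_nonpos hε (by linarith) (by linarith))
          (hgM p hp) (norm_nonneg _) (Real.rpow_nonneg hε.le _)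
      · rw [indicator_of_notMem h, norm_zero]
        positivity
  have hG := hbd (fun p => f p.1) hf.aestronglyMeasurable.comp_fst fun p hp => hM _ hp.1
  have hH := hbd (fun p => f p.2) hf.aestronglyMeasurable.comp_snd fun p hp => hM _ hp.2
  have hw : ∀ w : ℝ → ℝ, Measurable w → (∀ r ∈ Ioo 0 t, 0 ≤ w r) →
      IntegrableOn (fun r => (w r + ε) ^ (-α) • f r) (Ioo 0 t) := by
    intro w hw hw0
    refine Integrable.bdd_smul hf.integrableOn (ε ^ (-α))
      ((hw.add_const ε).pow_const _).aestronglyMeasurable ?_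
    filter_upwards [ae_restrict_mem measurableSet_Ioo] with r hr
    have := hw0 r hr
    rw [Real.norm_of_nonneg (Real.rpow_nonneg (by linarith) _)]
    exact Real.rpow_le_rpow_of_nonpos hε (by linarith) (by linarith)
  have hf0 : IntegrableOn (fun r => ε ^ (-α) • f r) (Ioo 0 t) := hf.integrableOn.smul _
  have hw1 := hw (fun r => r) measurable_id fun r hr => hr.1.le
  have hw2 := hw (fun r => t - r) (by fun_prop) fun r hr => (sub_pos.2 hr.2).le
  have e1 : ∫ r in 0..t, ∫ q in 0..r, (r - q + ε) ^ (-(1 + α)) • f r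
      = α⁻¹ • ∫ r in Ioo 0 t, (ε ^ (-α) • f r - (r + ε) ^ (-α) • f r) := by
    rw [intervalIntegral_eq_Ioo ht, ← integral_smul]
    refine setIntegral_congr_fun measurableSet_Ioo fun r hr => ?_
    rw [intervalIntegral.integral_smul_const, ← sub_smul, smul_smul,
      ← integral_regularized_kernel hα hε hr.1.le]
    congr 1
    have := intervalIntegral.integral_comp_sub_left (a := 0) (b := r)
      (fun s : ℝ => s ^ (-(1 + α))) (r + ε)
    rw [show r + ε - r = ε by ring, sub_zero] at this
    rw [← this]
    exact intervalIntegral.integral_congr fun q _ => by ring_nf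
  have e2 : ∫ r in 0..t, ∫ q in 0..r, (r - q + ε) ^ (-(1 + α)) • f q
      = α⁻¹ • ∫ r in Ioo 0 t, (ε ^ (-α) • f r - (t - r + ε) ^ (-α) • f r) := by
    rw [hH.integral_swap ht, intervalIntegral_eq_Ioo ht, ← integral_smul]
    refine setIntegral_congr_fun measurableSet_Ioo fun q hq => ?_
    dsimp only
    rw [intervalIntegral.integral_smul_const, ← sub_smul, smul_smul,
      ← integral_regularized_kernel hα hε (sub_pos.2 hq.2).le]
    congr 1
    have := intervalIntegral.integral_comp_add_right (a := q) (b := t)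
      (fun s : ℝ => s ^ (-(1 + α))) (ε - q)
    rw [show q + (ε - q) = ε by ring, show t + (ε - q) = t - q + ε by ring] at this
    rw [← this]
    exact intervalIntegral.integral_congr fun r _ => by ring_nf
  have e3 : ∫ r in 0..t, ∫ q in 0..r, (r - q + ε) ^ (-(1 + α)) • (f r - f q)
      = (∫ r in 0..t, ∫ q in 0..r, (r - q + ε) ^ (-(1 + α)) • f r)
        - ∫ r in 0..t, ∫ q in 0..r, (r - q + ε) ^ (-(1 + α)) • f q := by
    rw [← intervalIntegral.integral_sub ((intervalIntegrable_iff_Ioo ht).2 hG.integrableOn_left)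
      ((intervalIntegrable_iff_Ioo ht).2 hH.integrableOn_left)]
    refine intervalIntegral_congr_ae_Ioo ht ?_
    filter_upwards [hG.ae_left, hH.ae_left] with r h1 h2
    rw [← intervalIntegral.integral_sub h1 h2]
    simp only [smul_sub]
  rw [e3, e1, e2, ← smul_sub, smul_smul, mul_inv_cancel₀ hα.ne', one_smul,
    integral_sub hf0 hw1, integral_sub hf0 hw2]
  abel

/-- This is `I^1 D^α f = I^(1-α) f`, the limit `ε → 0` of `WeylAdmissible.regularized_identity`. The
unshifted kernel, integrable by admissibility, dominates the shifted ones. -/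
theorem WeylAdmissible.integral_weylLeft [CompleteSpace E] {α t : ℝ} (hα : 0 < α) (hα1 : α < 1)
    (ht : 0 ≤ t) {f : ℝ → E} (hf : WeylAdmissible α t f) :
    fracInt 1 (weylLeft α 0 f) t = fracInt (1 - α) f t := by
  obtain ⟨M, hM⟩ := hf.bounded
  have l1 := tendsto_integral_add_rpow_smul hα measurable_id (fun r hr => hr.1)
    (integrableOn_rpow (by linarith)) hf.aestronglyMeasurable hM
  have l2 := tendsto_integral_add_rpow_smul hα (w := fun r => t - r) (by fun_prop)
    (fun r hr => sub_pos.2 hr.2) (integrableOn_sub_rpow (by linarith)) hf.aestronglyMeasurable hM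
  set μ := (volume.restrict (Ioo 0 t)).prod (volume.restrict (Ioo 0 t))
  have hmeas : ∀ ε : ℝ, AEStronglyMeasurable (lowerTriangle.indicator fun p : ℝ × ℝ =>
      (p.1 - p.2 + ε) ^ (-(1 + α)) • (f p.1 - f p.2)) μ := by
    intro ε
    refine AEStronglyMeasurable.indicator ?_ isOpen_lowerTriangle.measurableSet
    exact AEStronglyMeasurable.smul (by fun_prop : Measurable fun p : ℝ × ℝ =>
      (p.1 - p.2 + ε) ^ (-(1 + α))).aestronglyMeasurable
        (hf.aestronglyMeasurable.comp_fst.sub hf.aestronglyMeasurable.comp_snd)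
  have hdom : ∀ ε : ℝ, 0 < ε → ∀ p : ℝ × ℝ, ‖lowerTriangle.indicator (fun p : ℝ × ℝ =>
      (p.1 - p.2 + ε) ^ (-(1 + α)) • (f p.1 - f p.2)) p‖
      ≤ ‖lowerTriangle.indicator (fun p => weylLeftKernel α f p.1 p.2) p‖ := by
    intro ε hε p
    by_cases h : p ∈ lowerTriangle
    · rw [indicator_of_mem h, indicator_of_mem h, weylLeftKernel, norm_smul, norm_smul]
      have h : 0 < p.1 - p.2 := sub_pos.2 h
      rw [Real.norm_of_nonneg (Real.rpow_nonneg (by linarith) _),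
        Real.norm_of_nonneg (Real.rpow_nonneg h.le _)]
      gcongr ?_ * _
      exact Real.rpow_le_rpow_of_nonpos h (by linarith) (by linarith)
    · rw [indicator_of_notMem h, indicator_of_notMem h]
  have l3 : Tendsto (fun ε => ∫ p, lowerTriangle.indicator (fun p : ℝ × ℝ =>
      (p.1 - p.2 + ε) ^ (-(1 + α)) • (f p.1 - f p.2)) p ∂μ) (𝓝[>] 0)
      (𝓝 (∫ p, lowerTriangle.indicator (fun p => weylLeftKernel α f p.1 p.2) p ∂μ)) := by
    refine tendsto_integral_filter_of_dominated_convergence _ (Eventually.of_forall hmeas) ?_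
      hf.kernel.norm ?_
    · filter_upwards [self_mem_nhdsWithin] with ε hε
      exact Eventually.of_forall (hdom ε hε)
    · refine Eventually.of_forall fun p => ?_
      by_cases h : p ∈ lowerTriangle
      · simp only [indicator_of_mem h, weylLeftKernel]
        refine Tendsto.smul_const ?_ _
        have h : 0 < p.1 - p.2 := sub_pos.2 h
        have h1 : Tendsto (fun ε => p.1 - p.2 + ε) (𝓝[>] 0) (𝓝 (p.1 - p.2)) := by
          have : Tendsto (fun ε => p.1 - p.2 + ε) (𝓝 0) (𝓝 (p.1 - p.2 + 0)) :=
            tendsto_id.const_add _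
          rw [add_zero] at this
          exact this.mono_left nhdsWithin_le_nhds
        exact h1.rpow_const (Or.inl h.ne')
      · simp only [indicator_of_notMem h]
        exact tendsto_const_nhds
  rw [hf.kernel.integral_prod_eq ht] at l3
  have key := tendsto_nhds_unique (((l3.const_smul α).add l1).congr' ?_) l2
  · rw [fracInt_one, fracInt]
    simp only [weylLeft, sub_zero]
    rw [intervalIntegral.integral_smul]
    congr 1
    rw [show (1 - α - 1) = -α by ring, intervalIntegral_eq_Ioo ht, intervalIntegral_eq_Ioo ht,
      ← key, intervalIntegral_eq_Ioo ht, add_comm, ← integral_smul]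
    exact integral_add (hf.integrableOn_rpow_smul (by linarith))
      (hf.kernel.integrableOn_left.smul α)
  · filter_upwards [self_mem_nhdsWithin] with ε hε
    rw [← hf.regularized_identity hα hε ht, ← TriangleIntegrable.integral_prod_eq ht]
    · rfl
    · exact Integrable.mono hf.kernel (hmeas ε) (Eventually.of_forall (hdom ε hε))

/-- A function is the fractional integral of its Weyl derivative. -/
theorem WeylAdmissible.ae_eq_fracInt_weylLeft [CompleteSpace E] {α t : ℝ} (hα : 0 < α)
    (hα1 : α < 1) {f : ℝ → E} (hf : WeylAdmissible α t f) :
    ∀ᵐ r ∂volume.restrict (Ioo 0 t), f r = fracInt α (weylLeft α 0 f) r := by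
  have hi := hf.integrableOn_weylLeft hα1
  -- Compare primitives: `I^1 I^α D^α f = I^α I^1 D^α f = I^α I^(1-α) f = I^1 f`.
  refine ae_eq_of_forall_intervalIntegral_eq hf.integrableOn (integrableOn_fracInt hα hi) ?_
  intro x hx
  have hfx := hf.mono hx.2.le
  have hix := hfx.integrableOn_weylLeft hα1
  rw [← fracInt_one, ← fracInt_one,
    fracInt_fracInt one_pos hα hx.1.le hix.aestronglyMeasurable
      (_root_.integrableOn_rpow_smul (by linarith) hix), add_comm,
    ← fracInt_fracInt hα one_pos hx.1.le hix.aestronglyMeasurable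
      (_root_.integrableOn_rpow_smul (by linarith) hix),
    fracInt_congr hx.1.le fun q hq =>
      (hf.mono (hq.2.trans hx.2).le).integral_weylLeft hα hα1 hq.1.le,
    fracInt_fracInt hα (sub_pos.2 hα1) hx.1.le hfx.aestronglyMeasurable
      (_root_.integrableOn_rpow_smul (by linarith) hfx.integrableOn)]
  congr 1
  ring

/-- Weyl derivatives of lower order are fractional integrals of those of higher order. -/
theorem WeylAdmissible.ae_weylLeft_eq_fracInt [CompleteSpace E] {α α' t : ℝ} (hα : 0 < α)
    (hαα' : α < α') (hα1 : α' < 1) {f : ℝ → E} (hf : WeylAdmissible α t f)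
    (hf' : WeylAdmissible α' t f) :
    ∀ᵐ r ∂volume.restrict (Ioo 0 t),
      weylLeft α 0 f r = fracInt (α' - α) (weylLeft α' 0 f) r := by
  have hα' := hα.trans hαα'
  have hi := hf.integrableOn_weylLeft (hαα'.trans hα1)
  have hi' := hf'.integrableOn_weylLeft hα1
  have hδ : 0 < α' - α := sub_pos.2 hαα'
  -- Compare primitives: `I^1 I^(α'-α) D^α' f = I^(α'-α) I^(1-α') f = I^(1-α) f = I^1 D^α f`.
  refine ae_eq_of_forall_intervalIntegral_eq hi (integrableOn_fracInt hδ hi') ?_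
  intro x hx
  have hfx := hf'.mono hx.2.le
  have hix := hfx.integrableOn_weylLeft hα1
  rw [← fracInt_one, ← fracInt_one, (hf.mono hx.2.le).integral_weylLeft hα (hαα'.trans hα1) hx.1.le,
    fracInt_fracInt one_pos hδ hx.1.le hix.aestronglyMeasurable
      (_root_.integrableOn_rpow_smul (by linarith) hix), add_comm,
    ← fracInt_fracInt hδ one_pos hx.1.le hix.aestronglyMeasurable
      (_root_.integrableOn_rpow_smul (by linarith) hix),
    fracInt_congr hx.1.le fun q hq =>
      (hf'.mono (hq.2.trans hx.2).le).integral_weylLeft hα' hα1 hq.1.le,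
    fracInt_fracInt hδ (sub_pos.2 hα1) hx.1.le hfx.aestronglyMeasurable
      (hfx.integrableOn_sub_rpow_smul (by linarith))]
  congr 1
  ring

end WeylInversion

/-! ### Pointwise bounds of Weyl derivatives, reflection and integration by parts. -/

section WeylBounds

variable {E : Type*} [NormedAddCommGroup E]

theorem integrableOn_reflect_Ioo {t : ℝ} {f : ℝ → E} (hf : IntegrableOn f (Ioo 0 t)) :
    IntegrableOn (fun r => f (t - r)) (Ioo 0 t) := by
  rcases le_or_gt t 0 with ht | ht
  · simp [Ioo_eq_empty (not_lt.2 ht)]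
  have := ((intervalIntegrable_iff_Ioo ht.le).2 hf).comp_sub_left t
  rw [sub_zero, sub_self] at this
  exact (intervalIntegrable_iff_Ioo ht.le).1 this.symm

variable [NormedSpace ℝ E]

/-- The constant in the pointwise bound of a left Weyl derivative. -/
noncomputable def weylConst (α γ : ℝ) : ℝ :=
  (Real.Gamma (1 - α))⁻¹ *
    (1 + α * (Real.Gamma (γ - α) * Real.Gamma (1 - γ) / Real.Gamma (1 - α)))

theorem weylConst_nonneg {α γ : ℝ} (hα : 0 < α) (hαγ : α < γ) (hγ : γ < 1) :
    0 ≤ weylConst α γ := by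
  have := Real.Gamma_pos_of_pos (sub_pos.2 hαγ)
  have := Real.Gamma_pos_of_pos (sub_pos.2 hγ)
  have := Real.Gamma_pos_of_pos (sub_pos.2 (hαγ.trans hγ))
  unfold weylConst
  positivity

theorem weyl_beta_integral {α γ r : ℝ} (hαγ : α < γ) (hγ : γ < 1) (hr : 0 < r) :
    IntervalIntegrable (fun q => (r - q) ^ (γ - α - 1) * q ^ (-γ)) volume 0 r ∧
    ∫ q in 0..r, (r - q) ^ (γ - α - 1) * q ^ (-γ)
      = Real.Gamma (γ - α) * Real.Gamma (1 - γ) / Real.Gamma (1 - α) * r ^ (-α) := by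
  have h1 := intervalIntegrable_sub_rpow_mul_sub_rpow (sub_pos.2 hαγ) (sub_pos.2 hγ) hr
  have h2 := integral_sub_rpow_mul_sub_rpow (sub_pos.2 hαγ) (sub_pos.2 hγ) hr
  simp only [sub_zero] at h1 h2
  rw [show γ - α + (1 - γ) = 1 - α by ring, show 1 - α - 1 = -α by ring] at h2
  rw [show 1 - γ - 1 = -γ by ring] at h1 h2
  exact ⟨h1, h2⟩

theorem norm_weylLeftKernel_le {α γ r N : ℝ} {f : ℝ → E}
    (hN : ∀ q ∈ Ioo 0 r, ‖f r - f q‖ ≤ N * ((r - q) ^ γ * q ^ (-γ))) {q : ℝ} (hq : q ∈ Ioo 0 r) :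
    ‖weylLeftKernel α f r q‖ ≤ N * ((r - q) ^ (γ - α - 1) * q ^ (-γ)) := by
  have h := sub_pos.2 hq.2
  rw [weylLeftKernel, norm_smul, Real.norm_of_nonneg (Real.rpow_nonneg h.le _)]
  calc (r - q) ^ (-(1 + α)) * ‖f r - f q‖
      ≤ (r - q) ^ (-(1 + α)) * (N * ((r - q) ^ γ * q ^ (-γ))) := by
        gcongr
        exact hN q hq
    _ = N * ((r - q) ^ (γ - α - 1) * q ^ (-γ)) := by
        rw [show γ - α - 1 = -(1 + α) + γ by ring, Real.rpow_add h]
        ring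

theorem intervalIntegrable_weylLeftKernel {α γ r N : ℝ} (hαγ : α < γ) (hγ : γ < 1) (hr : 0 < r)
    {f : ℝ → E} (hf : AEStronglyMeasurable f (volume.restrict (Ioo 0 r)))
    (hN : ∀ q ∈ Ioo 0 r, ‖f r - f q‖ ≤ N * ((r - q) ^ γ * q ^ (-γ))) :
    IntervalIntegrable (weylLeftKernel α f r) volume 0 r := by
  obtain ⟨hi, -⟩ := weyl_beta_integral hαγ hγ hr
  rw [intervalIntegrable_iff_Ioo hr.le] at hi ⊢
  refine Integrable.mono' (hi.const_mul N) ?_ ?_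
  · refine AEStronglyMeasurable.smul (by fun_prop : Measurable fun q : ℝ =>
      (r - q) ^ (-(1 + α))).aestronglyMeasurable ?_
    exact aestronglyMeasurable_const.sub hf
  · filter_upwards [ae_restrict_mem measurableSet_Ioo] with q hq
    exact norm_weylLeftKernel_le hN hq

/-- The increment bound turns the kernel into the Beta kernel `(r - q) ^ (γ - α - 1) * q ^ (-γ)`,
whose integral is a multiple of `r ^ (-α)`, the same power as in the boundary term. -/
theorem norm_weylLeft_le {α γ r M N : ℝ} (hα : 0 < α) (hαγ : α < γ) (hγ : γ < 1) (hr : 0 < r)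
    {f : ℝ → E} (hM0 : 0 ≤ M) (hN0 : 0 ≤ N) (hM : ‖f r‖ ≤ M)
    (hN : ∀ q ∈ Ioo 0 r, ‖f r - f q‖ ≤ N * ((r - q) ^ γ * q ^ (-γ))) :
    ‖weylLeft α 0 f r‖ ≤ weylConst α γ * (r ^ (-α) * (M + N)) := by
  have hg1 := Real.Gamma_pos_of_pos (sub_pos.2 hαγ)
  have hg2 := Real.Gamma_pos_of_pos (sub_pos.2 hγ)
  have hg3 := Real.Gamma_pos_of_pos (sub_pos.2 (hαγ.trans hγ))
  obtain ⟨hi, hI⟩ := weyl_beta_integral hαγ hγ hr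
  set B := Real.Gamma (γ - α) * Real.Gamma (1 - γ) / Real.Gamma (1 - α) with hB
  have hB0 : 0 ≤ B := by positivity
  have hr0 : 0 ≤ r ^ (-α) := Real.rpow_nonneg hr.le _
  have h1 : ‖∫ q in 0..r, weylLeftKernel α f r q‖ ≤ N * (B * r ^ (-α)) := by
    rw [← hI, ← intervalIntegral.integral_const_mul, intervalIntegral_eq_Ioo hr.le,
      intervalIntegral_eq_Ioo hr.le]
    refine norm_integral_le_of_norm_le (((intervalIntegrable_iff_Ioo hr.le).1 hi).const_mul N) ?_
    filter_upwards [ae_restrict_mem measurableSet_Ioo] with q hq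
    exact norm_weylLeftKernel_le hN hq
  rw [weylLeft, norm_smul, Real.norm_of_nonneg (by positivity), weylConst, mul_assoc, sub_zero,
    ← hB]
  gcongr
  refine (norm_add_le _ _).trans ?_
  rw [norm_smul, norm_smul, Real.norm_of_nonneg hr0, Real.norm_of_nonneg hα.le]
  calc r ^ (-α) * ‖f r‖ + α * ‖∫ q in 0..r, weylLeftKernel α f r q‖
      ≤ r ^ (-α) * M + α * (N * (B * r ^ (-α))) := by gcongr
    -- Nonnegative cross terms are added so that the bound factors through `M + N`.
    _ ≤ r ^ (-α) * M + α * (N * (B * r ^ (-α))) + (r ^ (-α) * N + α * B * r ^ (-α) * M) := by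
        have : 0 ≤ r ^ (-α) * N + α * B * r ^ (-α) * M := by positivity
        linarith
    _ = (1 + α * B) * (r ^ (-α) * (M + N)) := by ring

/-- The factor `(t - r) ^ (-γ)` allows for the singularity of `S (t - r)` at the end point.
Integrating the kernel in `q` leaves a multiple of `(t - r) ^ (-γ) * r ^ (-α)`, again a Beta kernel.
-/
theorem weylAdmissible_of_norm_le {α γ t M C : ℝ} (hαγ : α < γ) (hγ : γ < 1)
    {f : ℝ → E} (hf : ContinuousOn f (Ioo 0 t)) (hM : ∀ r ∈ Ioo 0 t, ‖f r‖ ≤ M)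
    (hC : ∀ r ∈ Ioo 0 t, ∀ q ∈ Ioo 0 r,
      ‖f r - f q‖ ≤ C * ((r - q) ^ γ * q ^ (-γ) * (t - r) ^ (-γ))) :
    WeylAdmissible α t f := by
  have hmeas := hf.aestronglyMeasurable (μ := volume) measurableSet_Ioo
  refine ⟨hmeas, ⟨M, hM⟩, ?_⟩
  have hC' : ∀ r ∈ Ioo 0 t, ∀ q ∈ Ioo 0 r,
      ‖f r - f q‖ ≤ C * (t - r) ^ (-γ) * ((r - q) ^ γ * q ^ (-γ)) :=
    fun r hr q hq => (hC r hr q hq).trans_eq (by ring)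
  have hslice : ∀ r ∈ Ioo 0 t, IntervalIntegrable (weylLeftKernel α f r) volume 0 r :=
    fun r hr => intervalIntegrable_weylLeftKernel hαγ hγ hr.1
      (hmeas.mono_set (Ioo_subset_Ioo_right hr.2.le)) (hC' r hr)
  refine triangleIntegrable_of_left (m := fun r => C * (Real.Gamma (γ - α) * Real.Gamma (1 - γ) /
    Real.Gamma (1 - α)) * ((t - r) ^ (-γ) * r ^ (-α))) ?_ hslice ?_ ?_
  · refine AEStronglyMeasurable.indicator ?_ isOpen_lowerTriangle.measurableSet
    exact AEStronglyMeasurable.smul (by fun_prop : Measurable fun p : ℝ × ℝ =>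
      (p.1 - p.2) ^ (-(1 + α))).aestronglyMeasurable (hmeas.comp_fst.sub hmeas.comp_snd)
  · intro r hr
    obtain ⟨hi, hI⟩ := weyl_beta_integral hαγ hγ hr.1
    calc ∫ q in 0..r, ‖weylLeftKernel α f r q‖
        ≤ ∫ q in 0..r, C * (t - r) ^ (-γ) * ((r - q) ^ (γ - α - 1) * q ^ (-γ)) := by
          rw [intervalIntegral_eq_Ioo hr.1.le, intervalIntegral_eq_Ioo hr.1.le]
          refine setIntegral_mono_on ((intervalIntegrable_iff_Ioo hr.1.le).1 (hslice r hr)).norm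
            (((intervalIntegrable_iff_Ioo hr.1.le).1 hi).const_mul _) measurableSet_Ioo ?_
          exact fun q hq => norm_weylLeftKernel_le (hC' r hr) hq
      _ = _ := by rw [intervalIntegral.integral_const_mul, hI]; ring
  · refine Integrable.const_mul ?_ _
    rcases le_or_gt t 0 with ht | ht
    · simp [Ioo_eq_empty (not_lt.2 ht)]
    have := intervalIntegrable_sub_rpow_mul_sub_rpow (sub_pos.2 hγ)
      (sub_pos.2 (hαγ.trans hγ)) ht
    rw [intervalIntegrable_iff_Ioo ht.le] at this
    simp only [sub_zero] at this
    rwa [show 1 - γ - 1 = -γ by ring, show 1 - α - 1 = -α by ring] at this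

variable {F : Type*} [NormedAddCommGroup F] [NormedSpace ℝ F]

theorem weylLeftKernel_clm (L : E →L[ℝ] F) (α : ℝ) (f : ℝ → E) (r q : ℝ) :
    weylLeftKernel α (fun s => L (f s)) r q = L (weylLeftKernel α f r q) := by
  simp [weylLeftKernel]

theorem WeylAdmissible.clm_comp {α t : ℝ} {f : ℝ → E} (hf : WeylAdmissible α t f)
    (L : E →L[ℝ] F) : WeylAdmissible α t fun s => L (f s) where
  aestronglyMeasurable := L.continuous.comp_aestronglyMeasurable hf.aestronglyMeasurable
  bounded := by
    obtain ⟨M, hM⟩ := hf.bounded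
    exact ⟨‖L‖ * M, fun r hr => L.le_opNorm_of_le (hM r hr)⟩
  kernel := by
    have := L.integrable_comp hf.kernel
    refine this.congr (Eventually.of_forall fun p => ?_)
    by_cases h : p ∈ lowerTriangle
    · simp only [indicator_of_mem h, weylLeftKernel_clm]
    · simp only [indicator_of_notMem h, map_zero]

theorem weylLeft_clm [CompleteSpace E] [CompleteSpace F] (L : E →L[ℝ] F) {α r : ℝ} {f : ℝ → E}
    (h : IntervalIntegrable (weylLeftKernel α f r) volume 0 r) :
    weylLeft α 0 (fun s => L (f s)) r = L (weylLeft α 0 f r) := by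
  simp only [weylLeft, weylLeftKernel_clm]
  rw [L.intervalIntegral_comp_comm h]
  simp

theorem weylLeft_sub {α r : ℝ} {f g : ℝ → E}
    (hf : IntervalIntegrable (weylLeftKernel α f r) volume 0 r)
    (hg : IntervalIntegrable (weylLeftKernel α g r) volume 0 r) :
    weylLeft α 0 (fun s => f s - g s) r = weylLeft α 0 f r - weylLeft α 0 g r := by
  have : ∀ q, weylLeftKernel α (fun s => f s - g s) r q
      = weylLeftKernel α f r q - weylLeftKernel α g r q := by
    intro q
    simp only [weylLeftKernel, ← smul_sub]
    congr 1
    abel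
  simp only [weylLeft, this]
  rw [intervalIntegral.integral_sub hf hg, ← smul_sub]
  congr 1
  rw [smul_sub, smul_sub]
  abel

/-- The reflection `r ↦ t - r` makes the theory of left derivatives available for right ones. -/
theorem weylRight_eq_weylLeft (γ t : ℝ) (f : ℝ → E) (r : ℝ) :
    weylRight γ t f r = weylLeft γ 0 (fun s => f (t - s)) (t - r) := by
  have := intervalIntegral.integral_comp_sub_left (a := r) (b := t)
    (weylLeftKernel γ (fun s => f (t - s)) (t - r)) t
  rw [sub_self] at this
  simp only [weylRight, weylLeft, ← this, sub_zero, sub_sub_cancel]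
  congr 3
  refine intervalIntegral.integral_congr fun q _ => ?_
  simp only [weylRightKernel, weylLeftKernel, sub_sub_cancel]
  congr 2
  ring

theorem fracInt_reflect (δ t q : ℝ) (φ : ℝ → E) :
    fracInt δ (fun s => φ (t - s)) (t - q)
      = (Real.Gamma δ)⁻¹ • ∫ r in q..t, (r - q) ^ (δ - 1) • φ r := by
  have := intervalIntegral.integral_comp_sub_left (a := q) (b := t)
    (fun s => (t - q - s) ^ (δ - 1) • φ (t - s)) t
  rw [sub_self] at this
  rw [fracInt, ← this]
  congr 1
  refine intervalIntegral.integral_congr fun r _ => ?_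
  simp only [sub_sub_cancel]
  congr 2
  ring

theorem ae_reflect_Ioo {t : ℝ} {p : ℝ → Prop} (h : ∀ᵐ s ∂volume.restrict (Ioo 0 t), p s) :
    ∀ᵐ r ∂volume.restrict (Ioo 0 t), p (t - r) := by
  rw [ae_restrict_iff' measurableSet_Ioo] at h ⊢
  filter_upwards [(Measure.measurePreserving_sub_left volume t).quasiMeasurePreserving.ae h] with r hr hr'
  exact hr ⟨sub_pos.2 hr'.2, by linarith [hr'.1]⟩

variable {G : Type*} [NormedAddCommGroup G] [NormedSpace ℝ G]

/-- Fractional integration by parts. -/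
theorem integral_fracInt_bilin [CompleteSpace E] [CompleteSpace F] [CompleteSpace G]
    (B : E →L[ℝ] F →L[ℝ] G) {δ t M : ℝ}
    (hδ : 0 < δ) (ht : 0 ≤ t) {ψ : ℝ → E} {φ : ℝ → F} (hψ : IntegrableOn ψ (Ioo 0 t))
    (hφ : AEStronglyMeasurable φ (volume.restrict (Ioo 0 t))) (hM : ∀ r ∈ Ioo 0 t, ‖φ r‖ ≤ M) :
    ∫ r in 0..t, B (fracInt δ ψ r) (φ r)
      = ∫ q in 0..t, B (ψ q) (fracInt δ (fun s => φ (t - s)) (t - q)) := by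
  have hδ' : -1 < δ - 1 := by linarith
  have hpow : ∀ q ∈ Ioo 0 t, IntegrableOn (fun r => (r - q) ^ (δ - 1)) (Ioo q t) := by
    intro q hq
    have := (intervalIntegral.intervalIntegrable_rpow' (a := 0) (b := t - q) hδ').comp_sub_right q
    rw [zero_add, sub_add_cancel] at this
    exact (intervalIntegrable_iff_Ioo hq.2.le).1 this
  have hφi : ∀ q ∈ Ioo 0 t, IntegrableOn (fun r => (r - q) ^ (δ - 1) • φ r) (Ioo q t) :=
    fun q hq => (hpow q hq).smul_of_bounded measurableSet_Ioo
      (hφ.mono_set (Ioo_subset_Ioo_left hq.1.le)) fun r hr => hM r ⟨hq.1.trans hr.1, hr.2⟩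
  have hpi : ∀ q ∈ Ioo 0 t, ∫ r in q..t, (r - q) ^ (δ - 1) = (t - q) ^ δ / δ := by
    intro q hq
    rw [intervalIntegral.integral_comp_sub_right (fun s => s ^ (δ - 1)), sub_self,
      integral_rpow (Or.inl hδ'), sub_add_cancel, Real.zero_rpow hδ.ne', sub_zero]
  have hT : TriangleIntegrable t fun r q => (r - q) ^ (δ - 1) • B (ψ q) (φ r) := by
    -- `φ` is bounded by `M`, and `(r - q) ^ (δ - 1)` integrates over `r` to at most `t ^ δ / δ`.
    refine triangleIntegrable_of_right (m := fun q => (‖B‖ * M * (t ^ δ / δ)) * ‖ψ q‖)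
      ?_ ?_ ?_ (hψ.norm.const_mul _)
    · refine AEStronglyMeasurable.indicator ?_ isOpen_lowerTriangle.measurableSet
      exact AEStronglyMeasurable.smul (by fun_prop : Measurable fun p : ℝ × ℝ =>
        (p.1 - p.2) ^ (δ - 1)).aestronglyMeasurable
        (B.aestronglyMeasurable_comp₂ hψ.aestronglyMeasurable.comp_snd hφ.comp_fst)
    · intro q hq
      rw [intervalIntegrable_iff_Ioo hq.2.le]
      refine IntegrableOn.congr_fun ((B (ψ q)).integrable_comp (hφi q hq)) (fun r _ => ?_)
        measurableSet_Ioo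
      simp
    · intro q hq
      have hM0 : 0 ≤ M := (norm_nonneg _).trans (hM q hq)
      have h1 : ∀ r ∈ Ioo q t, ‖(r - q) ^ (δ - 1) • B (ψ q) (φ r)‖
          ≤ (r - q) ^ (δ - 1) * (‖B‖ * ‖ψ q‖ * M) := by
        intro r hr
        have h0 := Real.rpow_nonneg (sub_pos.2 hr.1).le (δ - 1)
        rw [norm_smul, Real.norm_of_nonneg h0]
        gcongr
        refine (B.le_opNorm₂ _ _).trans ?_
        gcongr
        exact hM r ⟨hq.1.trans hr.1, hr.2⟩
      calc ∫ r in q..t, ‖(r - q) ^ (δ - 1) • B (ψ q) (φ r)‖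
          ≤ ∫ r in q..t, (r - q) ^ (δ - 1) * (‖B‖ * ‖ψ q‖ * M) := by
            rw [intervalIntegral_eq_Ioo hq.2.le, intervalIntegral_eq_Ioo hq.2.le]
            refine setIntegral_mono_on (IntegrableOn.congr_fun
              ((B (ψ q)).integrable_comp (hφi q hq)).norm (fun r _ => by simp) measurableSet_Ioo)
              ((hpow q hq).mul_const _) measurableSet_Ioo h1
        _ = (t - q) ^ δ / δ * (‖B‖ * ‖ψ q‖ * M) := by
            rw [intervalIntegral.integral_mul_const, hpi q hq]
        _ ≤ t ^ δ / δ * (‖B‖ * ‖ψ q‖ * M) := by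
            gcongr
            · exact sub_nonneg.2 hq.2.le
            · linarith [hq.1]
        _ = _ := by ring
  -- Since `ψ` is only integrable, the integral defining `fracInt δ ψ r` is known to converge for
  -- almost every `r`; only there may `B` be moved inside.
  have hae := (triangleIntegrable_rpow_mul_rpow_smul (a := 1) one_pos hδ hψ.aestronglyMeasurable
    (integrableOn_rpow_smul (by linarith) hψ)).ae_left
  simp only [sub_self, Real.rpow_zero, one_mul] at hae
  have hswap := hT.integral_swap ht
  have h1 : ∫ r in 0..t, B (fracInt δ ψ r) (φ r)
      = (Real.Gamma δ)⁻¹ • ∫ r in 0..t, ∫ q in 0..r, (r - q) ^ (δ - 1) • B (ψ q) (φ r) := by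
    rw [← intervalIntegral.integral_smul]
    refine intervalIntegral_congr_ae_Ioo ht ?_
    filter_upwards [hae] with r hr
    have := (B.flip (φ r)).intervalIntegral_comp_comm hr
    simp only [ContinuousLinearMap.flip_apply, map_smul] at this
    rw [this, fracInt, map_smul, smul_apply]
  have h2 : ∫ q in 0..t, B (ψ q) (fracInt δ (fun s => φ (t - s)) (t - q))
      = (Real.Gamma δ)⁻¹ • ∫ q in 0..t, ∫ r in q..t, (r - q) ^ (δ - 1) • B (ψ q) (φ r) := by
    rw [← intervalIntegral.integral_smul]
    refine intervalIntegral_congr_Ioo ht fun q hq => ?_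
    have := (B (ψ q)).intervalIntegral_comp_comm ((intervalIntegrable_iff_Ioo hq.2.le).2 (hφi q hq))
    simp only [map_smul] at this
    rw [this, fracInt_reflect, map_smul]
  rw [h1, h2, hswap]

end WeylBounds

/-! ### The pathwise integral: existence and independence of the order. -/

section ZahleIntegral

variable {V : Type*} [NormedAddCommGroup V]

/-- The path `ω_{t-}` read backwards from `t`. -/
noncomputable def reversedPath (ω : ℝ → V) (t s : ℝ) : V := subLeftLim ω t (t - s)

variable [NormedSpace ℝ V]

theorem weylRight_subLeftLim (γ t : ℝ) (ω : ℝ → V) (r : ℝ) :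
    weylRight γ t (subLeftLim ω t) r = weylLeft γ 0 (reversedPath ω t) (t - r) :=
  weylRight_eq_weylLeft γ t _ r

theorem weylRightKernel_subLeftLim (γ t : ℝ) (ω : ℝ → V) (r q : ℝ) :
    weylRightKernel γ (subLeftLim ω t) r q
      = weylLeftKernel γ (reversedPath ω t) (t - r) (t - q) := by
  simp only [weylRightKernel, weylLeftKernel, reversedPath, sub_sub_cancel]
  congr 2
  ring

variable {V : Type*} [NormedAddCommGroup V] [InnerProductSpace ℝ V] [CompleteSpace V]

theorem zahleIntegrand_eq (α : ℝ) (Z : ℝ → HilbertSchmidt V) (ω : ℝ → V) (t r : ℝ) :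
    zahleIntegrand α Z ω 0 t r = HilbertSchmidt.toCLML (weylLeft α 0 Z r)
      (weylLeft (1 - α) 0 (reversedPath ω t) (t - r)) := by
  rw [zahleIntegrand, weylRight_subLeftLim]; rfl

/-- The pathwise integral does not depend on its order. -/
theorem zahleIntegral_eq_of_lt {α α' t M : ℝ} (hα : 0 < α) (hαα' : α < α') (hα' : α' < 1)
    (ht : 0 ≤ t) {Z : ℝ → HilbertSchmidt V} {ω : ℝ → V} (hZ : WeylAdmissible α t Z)
    (hZ' : WeylAdmissible α' t Z) (hω : WeylAdmissible (1 - α) t (reversedPath ω t))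
    (hω' : WeylAdmissible (1 - α') t (reversedPath ω t))
    (hM : ∀ s ∈ Ioo 0 t, ‖weylLeft (1 - α) 0 (reversedPath ω t) s‖ ≤ M) :
    zahleIntegral α Z ω 0 t = zahleIntegral α' Z ω 0 t := by
  rw [zahleIntegral, zahleIntegral]
  congr 1
  simp only [zahleIntegrand_eq]
  -- With `δ = α' - α`, both `D^α Z = I^δ D^α' Z` and, for the reversed path, `D^(1-α') ω = I^δ
  -- D^(1-α) ω` hold. Integration by parts moves `I^δ` from one factor to the other.
  have h1 := hZ.ae_weylLeft_eq_fracInt hα hαα' hα' hZ'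
  have h2 := ae_reflect_Ioo (hω'.ae_weylLeft_eq_fracInt (α' := 1 - α) (by linarith) (by linarith)
    (by linarith) hω)
  rw [show 1 - α - (1 - α') = α' - α by ring] at h2
  have hi := integrableOn_reflect_Ioo (hω.integrableOn_weylLeft (by linarith))
  have key := integral_fracInt_bilin HilbertSchmidt.toCLML (sub_pos.2 hαα') ht
    (hZ'.integrableOn_weylLeft hα') hi.aestronglyMeasurable
    fun r hr => hM _ ⟨sub_pos.2 hr.2, by linarith [hr.1]⟩
  simp only [sub_sub_cancel] at key
  rw [intervalIntegral_congr_ae_Ioo ht (h1.mono fun r hr => by rw [hr]), key]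
  exact intervalIntegral_congr_ae_Ioo ht (h2.mono fun r hr => by rw [hr])

theorem integrableOn_zahleIntegrand {α t M : ℝ} (hα : 0 < α) (hα1 : α < 1)
    {Z : ℝ → HilbertSchmidt V} {ω : ℝ → V} (hZ : WeylAdmissible α t Z)
    (hω : WeylAdmissible (1 - α) t (reversedPath ω t))
    (hM : ∀ s ∈ Ioo 0 t, ‖weylLeft (1 - α) 0 (reversedPath ω t) s‖ ≤ M) :
    IntegrableOn (fun r => HilbertSchmidt.toCLML (weylLeft α 0 Z r)
      (weylLeft (1 - α) 0 (reversedPath ω t) (t - r))) (Ioo 0 t) ∧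
    IntegrableOn (fun r => ‖weylLeft α 0 Z r‖ *
      ‖weylLeft (1 - α) 0 (reversedPath ω t) (t - r)‖) (Ioo 0 t) := by
  have hz := hZ.integrableOn_weylLeft hα1
  have hi := integrableOn_reflect_Ioo (hω.integrableOn_weylLeft (by linarith))
  have hb : ∀ᵐ r ∂volume.restrict (Ioo 0 t),
      ‖weylLeft (1 - α) 0 (reversedPath ω t) (t - r)‖ ≤ M := by
    filter_upwards [ae_restrict_mem measurableSet_Ioo] with r hr
    exact hM _ ⟨sub_pos.2 hr.2, by linarith [hr.1]⟩
  have h2 : IntegrableOn (fun r => ‖weylLeft α 0 Z r‖ *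
      ‖weylLeft (1 - α) 0 (reversedPath ω t) (t - r)‖) (Ioo 0 t) := by
    refine Integrable.mul_bdd (c := M) hz.norm hi.aestronglyMeasurable.norm ?_
    simpa using hb
  refine ⟨Integrable.mono' h2 (HilbertSchmidt.toCLML.aestronglyMeasurable_comp₂
    hz.aestronglyMeasurable hi.aestronglyMeasurable) (Eventually.of_forall fun r => ?_), h2⟩
  exact (ContinuousLinearMap.le_opNorm _ _).trans
    (mul_le_mul_of_nonneg_right (HilbertSchmidt.norm_toCLM_le _) (norm_nonneg _))

theorem zahleIntegrable_of_weylAdmissible {α t M : ℝ} (hα : 0 < α) (hα1 : α < 1) (ht : 0 < t)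
    {Z : ℝ → HilbertSchmidt V} {ω : ℝ → V} (hZ : WeylAdmissible α t Z)
    (hlim : ∃ l, Tendsto Z (𝓝[>] 0) (𝓝 l)) (hωc : ContinuousOn ω (Icc 0 t))
    (hω : WeylAdmissible (1 - α) t (reversedPath ω t))
    (hM : ∀ s ∈ Ioo 0 t, ‖weylLeft (1 - α) 0 (reversedPath ω t) s‖ ≤ M) :
    ZahleIntegrable α Z ω 0 t where
  lim_integrand := by
    obtain ⟨l, hl⟩ := hlim
    intro x y
    refine ⟨⟪x, l.toCLM y⟫, ?_⟩
    have hc : Continuous fun T : HilbertSchmidt V => ⟪x, HilbertSchmidt.toCLML T y⟫ := by fun_prop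
    exact (hc.tendsto l).comp hl
  lim_left := ⟨ω 0, ((hωc 0 (left_mem_Icc.2 ht.le)).mono_of_mem_nhdsWithin
    (Icc_mem_nhdsGT ht)).tendsto⟩
  lim_right := ⟨ω t, ((hωc t (right_mem_Icc.2 ht.le)).mono_of_mem_nhdsWithin
    (Icc_mem_nhdsLT ht)).tendsto⟩
  components := by
    -- The exponents are `p = 1` and `p' = ∞`: the derivative of `Z` is integrable and that of the
    -- path is bounded. The condition `α p < 1` reads `α < 1`.
    refine ⟨1, ⊤, le_rfl, le_top, by simp, by simpa using hα1, fun x y => ?_, fun x => ?_⟩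
    · let L : HilbertSchmidt V →L[ℝ] ℝ := innerSL ℝ x ∘L
        (ContinuousLinearMap.apply ℝ V y) ∘L HilbertSchmidt.toCLML
      have hL := hZ.clm_comp L
      refine ⟨weylLeft α 0 fun r => L (Z r),
        memLp_one_iff_integrable.2 (hL.integrableOn_weylLeft hα1), ?_⟩
      exact hL.ae_eq_fracInt_weylLeft hα hα1
    · have hL := hω.clm_comp (innerSL ℝ x)
      have hγ : 0 < 1 - α := by linarith
      have hγ1 : 1 - α < 1 := by linarith
      refine ⟨fun r => weylLeft (1 - α) 0 (fun s => innerSL ℝ x (reversedPath ω t s)) (t - r),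
        ?_, ?_⟩
      · have hi := integrableOn_reflect_Ioo (hL.integrableOn_weylLeft hγ1)
        refine memLp_top_of_bound hi.aestronglyMeasurable (‖innerSL ℝ x‖ * M) ?_
        filter_upwards [ae_reflect_Ioo hω.kernel.ae_left, ae_restrict_mem measurableSet_Ioo]
          with r hr hr'
        rw [weylLeft_clm _ hr]
        exact ContinuousLinearMap.le_opNorm_of_le _
          (hM _ ⟨sub_pos.2 hr'.2, by linarith [hr'.1]⟩)
      · filter_upwards [ae_reflect_Ioo (hL.ae_eq_fracInt_weylLeft hγ hγ1)] with r hr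
        have h2 := fracInt_reflect (1 - α) t r fun r =>
          weylLeft (1 - α) 0 (fun s => innerSL ℝ x (reversedPath ω t s)) (t - r)
        simp only [sub_sub_cancel] at h2
        rw [h2] at hr
        simpa [reversedPath] using hr
  left_kernel := hZ.kernel.ae_left
  right_kernel := by
    filter_upwards [ae_reflect_Ioo hω.kernel.ae_left] with r hr
    have := hr.comp_sub_left t
    rw [sub_zero, sub_sub_cancel] at this
    refine this.symm.congr fun q _ => ?_
    exact (weylRightKernel_subLeftLim _ _ _ _ _).symm
  norm_mul_norm := by
    simpa only [weylRight_subLeftLim] using (integrableOn_zahleIntegrand hα hα1 hZ hω hM).2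
  integrand := by
    have := (integrableOn_zahleIntegrand hα hα1 hZ hω hM).1
    exact this.congr_fun (fun r _ => (zahleIntegrand_eq α Z ω t r).symm) measurableSet_Ioo

end ZahleIntegral

/-! ### Weyl derivatives of a Hölder path. -/

section HolderPath

theorem rpow_le_rpow_sub_mul_rpow {x T a b : ℝ} (hx : 0 < x) (hxT : x ≤ T) (h : b ≤ a) :
    x ^ a ≤ T ^ (a - b) * x ^ b := by
  calc x ^ a = x ^ (a - b) * x ^ b := by rw [← Real.rpow_add hx, sub_add_cancel]
    _ ≤ T ^ (a - b) * x ^ b := by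
      gcongr

/-- Inserting this factor gives a summand a singularity that it lacks, so that several summands fit
one common bound. -/
theorem one_le_rpow_mul_rpow_neg {x T γ : ℝ} (hx : 0 < x) (hxT : x ≤ T) (h : 0 ≤ γ) :
    1 ≤ T ^ γ * x ^ (-γ) := by
  rw [Real.rpow_neg hx.le, ← div_eq_mul_inv, one_le_div (Real.rpow_pos_of_pos hx _)]
  exact Real.rpow_le_rpow hx.le hxT h

variable {V : Type*} [NormedAddCommGroup V]

/-- `ω` is Hölder continuous on `[0, T]` with exponent `β'` and constant `K`. -/
def HolderBound (β' K T : ℝ) (ω : ℝ → V) : Prop :=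
  ∀ r ∈ Icc 0 T, ∀ q ∈ Icc 0 T, ‖ω r - ω q‖ ≤ K * |r - q| ^ β'

variable {β' K T : ℝ} {ω : ℝ → V}

theorem HolderBound.continuousOn (hω : HolderBound β' K T ω) (hβ' : 0 < β') :
    ContinuousOn ω (Icc 0 T) := by
  intro r hr
  rw [ContinuousWithinAt, tendsto_iff_norm_sub_tendsto_zero]
  have h1 : Tendsto (fun q => K * |q - r| ^ β') (𝓝[Icc 0 T] r) (𝓝 0) := by
    have : Tendsto (fun q => K * |q - r| ^ β') (𝓝 r) (𝓝 (K * |r - r| ^ β')) := by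
      refine Continuous.tendsto ?_ r
      exact continuous_const.mul ((continuous_abs.comp (continuous_id.sub continuous_const)).rpow_const
        fun _ => Or.inr hβ'.le)
    rw [sub_self, abs_zero, Real.zero_rpow hβ'.ne', mul_zero] at this
    exact this.mono_left nhdsWithin_le_nhds
  refine squeeze_zero' (Eventually.of_forall fun _ => norm_nonneg _) ?_ h1
  filter_upwards [self_mem_nhdsWithin] with q hq
  exact hω q hq r hr

theorem subLeftLim_eq (hω : ContinuousOn ω (Icc 0 T)) {t : ℝ} (ht : t ∈ Ioc 0 T) (r : ℝ) :
    subLeftLim ω t r = ω r - ω t := by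
  rw [subLeftLim, leftLim_eq_of_tendsto]
  exact ((hω t ⟨ht.1.le, ht.2⟩).mono_of_mem_nhdsWithin (mem_of_superset (Icc_mem_nhdsLT ht.1)
    (Icc_subset_Icc_right ht.2))).tendsto

theorem HolderBound.norm_reversedPath_sub_le (hω : HolderBound β' K T ω) {t : ℝ}
    (ht : t ∈ Ioc 0 T) {s q : ℝ} (hs : s ∈ Icc 0 t) (hq : q ∈ Icc 0 s) :
    ‖reversedPath ω t s - reversedPath ω t q‖ ≤ K * (s - q) ^ β' := by
  have := hω (t - s) ⟨by linarith [hs.2], by linarith [hs.1, ht.2]⟩ (t - q)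
    ⟨by linarith [hs.2, hq.2], by linarith [hq.1, ht.2]⟩
  rw [show t - s - (t - q) = -(s - q) by ring, abs_neg, abs_of_nonneg (sub_nonneg.2 hq.2)] at this
  simpa [reversedPath, subLeftLim] using this

theorem HolderBound.norm_reversedPath_le (hω : HolderBound β' K T ω) (hβ' : 0 < β') {t : ℝ}
    (ht : t ∈ Ioc 0 T) {s : ℝ} (hs : s ∈ Icc 0 t) : ‖reversedPath ω t s‖ ≤ K * s ^ β' := by
  have := hω.norm_reversedPath_sub_le ht hs (q := 0) ⟨le_rfl, hs.1⟩
  have h0 : reversedPath ω t 0 = 0 := by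
    rw [reversedPath, subLeftLim_eq (hω.continuousOn hβ') ht, sub_zero, sub_self]
  simpa [h0] using this

theorem HolderBound.continuousOn_reversedPath (hω : HolderBound β' K T ω) (hβ' : 0 < β') {t : ℝ}
    (ht : t ∈ Ioc 0 T) : ContinuousOn (reversedPath ω t) (Icc 0 t) := by
  refine ContinuousOn.sub (ContinuousOn.comp (hω.continuousOn hβ')
    (continuous_const.sub continuous_id).continuousOn fun s hs => ?_) continuousOn_const
  exact ⟨by simpa using hs.2, by simp; linarith [hs.1, ht.2]⟩

theorem HolderBound.norm_reversedPath_sub_le' (hω : HolderBound β' K T ω) (hβ' : 0 < β')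
    (hK : 0 ≤ K) {t : ℝ} (ht : t ∈ Ioc 0 T) {s q : ℝ} (hs : s ∈ Ioc 0 t) (hq : q ∈ Ioo 0 s) :
    ‖reversedPath ω t s - reversedPath ω t q‖ ≤ K * s ^ β' * ((s - q) ^ β' * q ^ (-β')) := by
  refine (hω.norm_reversedPath_sub_le ht ⟨hs.1.le, hs.2⟩ ⟨hq.1.le, hq.2.le⟩).trans ?_
  have h1 := one_le_rpow_mul_rpow_neg hq.1 hq.2.le hβ'.le
  have h2 := Real.rpow_nonneg (sub_pos.2 hq.2).le β'
  calc K * (s - q) ^ β' ≤ K * (s - q) ^ β' * (s ^ β' * q ^ (-β')) :=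
        le_mul_of_one_le_right (by positivity) h1
    _ = _ := by ring

variable [NormedSpace ℝ V]

/-- The reversed path vanishes at zero, so its size and its increments both contribute a factor `s ^
β'`, which outweighs the singularity `s ^ (-κ)` of the derivative. -/
theorem HolderBound.norm_weylLeft_reversedPath_le (hω : HolderBound β' K T ω) (hK : 0 ≤ K)
    {κ : ℝ} (hκ : 0 < κ) (hκβ' : κ < β') (hβ'1 : β' < 1) {t : ℝ} (ht : t ∈ Ioc 0 T) {s : ℝ}
    (hs : s ∈ Ioc 0 t) :
    ‖weylLeft κ 0 (reversedPath ω t) s‖ ≤ weylConst κ β' * (2 * K) * s ^ (β' - κ) := by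
  have hβ' := hκ.trans hκβ'
  have hs0 := hs.1
  refine (norm_weylLeft_le hκ hκβ' hβ'1 hs.1 (M := K * s ^ β') (N := K * s ^ β') (by positivity)
    (by positivity) (hω.norm_reversedPath_le hβ' ht ⟨hs.1.le, hs.2⟩)
    fun q hq => hω.norm_reversedPath_sub_le' hβ' hK ht hs hq).trans_eq ?_
  rw [show β' - κ = -κ + β' by ring, Real.rpow_add hs.1]
  ring

theorem HolderBound.exists_norm_weylLeft_le (hω : HolderBound β' K T ω) (hK : 0 ≤ K)
    {α : ℝ} (hα : 1 - β' < α) (hα1 : α < 1) (hβ' : β' < 1) {t : ℝ} (ht : t ∈ Ioc 0 T) :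
    ∃ M, ∀ s ∈ Ioo 0 t, ‖weylLeft (1 - α) 0 (reversedPath ω t) s‖ ≤ M := by
  refine ⟨weylConst (1 - α) β' * (2 * K) * t ^ (β' - (1 - α)), fun s hs => ?_⟩
  refine (hω.norm_weylLeft_reversedPath_le hK (by linarith) (by linarith) hβ' ht
    ⟨hs.1, hs.2.le⟩).trans ?_
  have h0 := weylConst_nonneg (α := 1 - α) (γ := β') (by linarith) (by linarith) hβ'
  have hs0 := hs.1
  gcongr
  · linarith
  · exact hs.2.le

theorem HolderBound.weylAdmissible (hω : HolderBound β' K T ω) (hK : 0 ≤ K) {κ : ℝ} (hκ : 0 < κ)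
    (hκβ' : κ < β') (hβ'1 : β' < 1) {t : ℝ} (ht : t ∈ Ioc 0 T) :
    WeylAdmissible κ t (reversedPath ω t) := by
  have hβ' := hκ.trans hκβ'
  refine weylAdmissible_of_norm_le (M := K * t ^ β') (C := K * t ^ β' * t ^ β') hκβ' hβ'1
    ((hω.continuousOn_reversedPath hβ' ht).mono Ioo_subset_Icc_self) (fun r hr => ?_) ?_
  · have hr0 := hr.1
    refine (hω.norm_reversedPath_le hβ' ht ⟨hr.1.le, hr.2.le⟩).trans ?_
    gcongr
    exact hr.2.le
  · intro r hr q hq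
    have hr0 := hr.1
    have hq0 := hq.1
    have ht0 := ht.1
    have h2 := Real.rpow_nonneg (sub_pos.2 hq.2).le β'
    refine (hω.norm_reversedPath_sub_le' hβ' hK ht ⟨hr.1, hr.2.le⟩ hq).trans ?_
    have h1 := one_le_rpow_mul_rpow_neg (sub_pos.2 hr.2) (by linarith : t - r ≤ t) hβ'.le
    calc K * r ^ β' * ((r - q) ^ β' * q ^ (-β'))
        ≤ K * t ^ β' * ((r - q) ^ β' * q ^ (-β')) := by gcongr; exact hr.2.le
      _ ≤ K * t ^ β' * ((r - q) ^ β' * q ^ (-β')) * (t ^ β' * (t - r) ^ (-β')) :=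
        le_mul_of_one_le_right (by positivity) h1
      _ = _ := by ring

/-- On `[s, t]` write `ω r - ω q = (ω r - ω s) + (ω s - ω q)`. The terms with `ω r - ω s` cancel
against the boundary terms, because `κ ∫_s^t (q - r) ^ (-(1 + κ)) dq = (s - r) ^ (-κ) - (t - r) ^
(-κ)`. What remains are increments of `ω` within `[s, t]`, of size `(t - s) ^ β'`, with weights that
add up to `(s - r) ^ (-κ)`. -/
theorem HolderBound.norm_weylRight_sub_le [CompleteSpace V] (hω : HolderBound β' K T ω)
    (hK : 0 ≤ K) {κ : ℝ}
    (hκ : 0 < κ) (hκβ' : κ < β') (hβ'1 : β' < 1) {r s t : ℝ} (hr : 0 < r) (hrs : r < s)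
    (hst : s < t) (htT : t ≤ T) :
    ‖weylRight κ t (subLeftLim ω t) r - weylRight κ s (subLeftLim ω s) r‖
      ≤ (Real.Gamma (1 - κ))⁻¹ * K * ((t - s) ^ β' * (s - r) ^ (-κ)) := by
  have hβ' := hκ.trans hκβ'
  have hs : 0 < s := hr.trans hrs
  have hcont := hω.continuousOn hβ'
  have ht : t ∈ Ioc 0 T := ⟨hs.trans hst, htT⟩
  have hs' : s ∈ Ioc 0 T := ⟨hs, hst.le.trans htT⟩
  have hg : 0 < Real.Gamma (1 - κ) := Real.Gamma_pos_of_pos (by linarith)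
  have hker : IntervalIntegrable (weylRightKernel κ (subLeftLim ω t) r) volume r t := by
    have h1 : IntervalIntegrable (weylLeftKernel κ (reversedPath ω t) (t - r)) volume 0 (t - r) :=
      intervalIntegrable_weylLeftKernel hκβ' hβ'1 (by linarith)
        (((hω.continuousOn_reversedPath hβ' ht).mono fun x hx =>
          ⟨hx.1.le, by linarith [hx.2]⟩).aestronglyMeasurable measurableSet_Ioo)
        fun q hq => hω.norm_reversedPath_sub_le' hβ' hK ht ⟨by linarith, by linarith⟩ hq
    have := h1.comp_sub_left t
    rw [sub_zero, sub_sub_cancel] at this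
    exact this.symm.congr fun q _ => (weylRightKernel_subLeftLim _ _ _ _ _).symm
  have hkeq : ∀ q, weylRightKernel κ (subLeftLim ω t) r q = (q - r) ^ (-(1 + κ)) • (ω r - ω q) := by
    intro q; simp [weylRightKernel, subLeftLim]
  have hkeq' : ∀ q, weylRightKernel κ (subLeftLim ω s) r q
      = (q - r) ^ (-(1 + κ)) • (ω r - ω q) := by
    intro q; simp [weylRightKernel, subLeftLim]
  simp only [weylRight, subLeftLim_eq hcont ht, subLeftLim_eq hcont hs', hkeq, hkeq']
  replace hker := hker.congr fun q _ => hkeq q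
  have hi1 : IntervalIntegrable (fun q => (q - r) ^ (-(1 + κ)) • (ω r - ω q)) volume r s :=
    hker.mono_set (by rw [uIcc_of_le hrs.le, uIcc_of_le (by linarith)]; gcongr)
  have hi2 : IntervalIntegrable (fun q => (q - r) ^ (-(1 + κ)) • (ω r - ω q)) volume s t :=
    hker.mono_set (by rw [uIcc_of_le hst.le, uIcc_of_le (by linarith)]; gcongr)
  have hpc : ContinuousOn (fun q : ℝ => (q - r) ^ (-(1 + κ))) (Icc s t) := by
    refine ContinuousOn.rpow_const (by fun_prop) fun q hq => Or.inl ?_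
    have := hq.1
    exact (by linarith : 0 < q - r).ne'
  have hpi : IntervalIntegrable (fun q : ℝ => (q - r) ^ (-(1 + κ))) volume s t :=
    ContinuousOn.intervalIntegrable (by rwa [uIcc_of_le hst.le])
  have hci : IntervalIntegrable (fun q : ℝ => (q - r) ^ (-(1 + κ)) • (ω s - ω q)) volume s t := by
    refine ContinuousOn.intervalIntegrable ?_
    rw [uIcc_of_le hst.le]
    exact hpc.smul (continuousOn_const.sub (hcont.mono (Icc_subset_Icc hs.le htT)))
  have hpv : κ * ∫ q in s..t, (q - r) ^ (-(1 + κ)) = (s - r) ^ (-κ) - (t - r) ^ (-κ) := by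
    rw [intervalIntegral.integral_comp_sub_right (fun x => x ^ (-(1 + κ))),
      integral_rpow (Or.inr ⟨by linarith, ?_⟩)]
    · rw [show -(1 + κ) + 1 = -κ by ring]
      field_simp
      ring
    · rw [uIcc_of_le (by linarith)]
      exact fun h => absurd h.1 (by linarith)
  have hsplit : ∫ q in r..t, (q - r) ^ (-(1 + κ)) • (ω r - ω q)
      = (∫ q in r..s, (q - r) ^ (-(1 + κ)) • (ω r - ω q))
        + ((∫ q in s..t, (q - r) ^ (-(1 + κ)) • (ω s - ω q))
          + (∫ q in s..t, (q - r) ^ (-(1 + κ))) • (ω r - ω s)) := by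
    rw [← intervalIntegral.integral_add_adjacent_intervals hi1 hi2,
      ← intervalIntegral.integral_smul_const,
      ← intervalIntegral.integral_add hci]
    · congr 2
      ext q
      rw [← smul_add]
      congr 1
      abel
    · exact ⟨hpi.1.smul_const _, hpi.2.smul_const _⟩
  have hI : ‖∫ q in s..t, (q - r) ^ (-(1 + κ)) • (ω s - ω q)‖
      ≤ (∫ q in s..t, (q - r) ^ (-(1 + κ))) * (K * (t - s) ^ β') := by
    rw [← intervalIntegral.integral_mul_const]
    refine intervalIntegral.norm_integral_le_of_norm_le hst.le (Eventually.of_forall fun q hq => ?_)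
      (hpi.mul_const _)
    have hq1 := hq.1
    have h0 : 0 ≤ (q - r) ^ (-(1 + κ)) := Real.rpow_nonneg (by linarith) _
    rw [norm_smul, Real.norm_of_nonneg h0]
    gcongr
    refine (hω s ⟨hs.le, hs'.2⟩ q ⟨by linarith, hq.2.trans htT⟩).trans ?_
    rw [abs_sub_comm, abs_of_nonneg (by linarith)]
    gcongr
    exact hq.2
  have hst' : ‖ω s - ω t‖ ≤ K * (t - s) ^ β' := by
    have := hω s ⟨hs.le, hs'.2⟩ t ⟨ht.1.le, htT⟩
    rwa [abs_sub_comm, abs_of_nonneg (by linarith)] at this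
  have hpow : 0 ≤ (t - r) ^ (-κ) := Real.rpow_nonneg (by linarith) _
  have hid : (Real.Gamma (1 - κ))⁻¹ • ((t - r) ^ (-κ) • (ω r - ω t)
        + κ • ∫ q in r..t, (q - r) ^ (-(1 + κ)) • (ω r - ω q))
      - (Real.Gamma (1 - κ))⁻¹ • ((s - r) ^ (-κ) • (ω r - ω s)
        + κ • ∫ q in r..s, (q - r) ^ (-(1 + κ)) • (ω r - ω q))
      = (Real.Gamma (1 - κ))⁻¹ • ((t - r) ^ (-κ) • (ω s - ω t)
        + κ • ∫ q in s..t, (q - r) ^ (-(1 + κ)) • (ω s - ω q)) := by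
    rw [hsplit, ← smul_sub]
    congr 1
    rw [smul_add κ, smul_add κ, smul_smul κ, hpv, sub_smul,
      show ω r - ω t = (ω r - ω s) + (ω s - ω t) by abel, smul_add]
    abel
  rw [hid, norm_smul, Real.norm_of_nonneg (by positivity), mul_assoc]
  gcongr
  refine (norm_add_le _ _).trans ?_
  rw [norm_smul, norm_smul, Real.norm_of_nonneg hpow, Real.norm_of_nonneg hκ.le]
  calc (t - r) ^ (-κ) * ‖ω s - ω t‖ + κ * ‖∫ q in s..t, (q - r) ^ (-(1 + κ)) • (ω s - ω q)‖
      ≤ (t - r) ^ (-κ) * (K * (t - s) ^ β')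
        + κ * ((∫ q in s..t, (q - r) ^ (-(1 + κ))) * (K * (t - s) ^ β')) := by gcongr
    _ = ((t - r) ^ (-κ) + κ * ∫ q in s..t, (q - r) ^ (-(1 + κ))) * (K * (t - s) ^ β') := by ring
    _ = K * ((t - s) ^ β' * (s - r) ^ (-κ)) := by rw [hpv]; ring

end HolderPath

/-! ### Weighted Hölder bounds. -/

section WeightedBounds

/-- The norm of `g` in the weighted Hölder space with the exponential weight `e ^ (-ρ t)` is at
most `N`. -/
structure WeightedBound {E : Type*} [NormedAddCommGroup E] (β T ρ N : ℝ) (g : ℝ → E) : Prop where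
  norm_le : ∀ t ∈ Icc 0 T, ‖g t‖ ≤ N * Real.exp (ρ * t)
  sub_le : ∀ s t, 0 < s → s < t → t ≤ T →
    s ^ β * ‖g t - g s‖ ≤ N * Real.exp (ρ * t) * (t - s) ^ β

/-- The bounds on a semigroup that are needed for the regularity of stochastic convolutions. -/
structure SemigroupBounds {V : Type*} [NormedAddCommGroup V] [NormedSpace ℝ V]
    (S : ℝ → V →L[ℝ] V) : Prop where
  norm_le_one : ∀ t, 0 ≤ t → ‖S t‖ ≤ 1
  sub_le : ∀ γ x h : ℝ, 0 ≤ γ → γ ≤ 1 → 0 < x → 0 ≤ h → ‖S (x + h) - S x‖ ≤ h ^ γ * x ^ (-γ)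
  second_difference_le : ∀ p γ x h k : ℝ, 0 ≤ p → p ≤ 1 → 0 ≤ γ → γ ≤ 1 → 0 < x → 0 ≤ h → 0 ≤ k →
    ‖S (x + h + k) - S (x + h) - (S (x + k) - S x)‖ ≤ 4 * (h ^ p * k ^ γ * x ^ (-(p + γ)))

variable {E : Type*} [NormedAddCommGroup E] {β T ρ N : ℝ}

theorem WeightedBound.nonneg {g : ℝ → E} (hg : WeightedBound β T ρ N g) (hT : 0 ≤ T) : 0 ≤ N := by
  have := (norm_nonneg _).trans (hg.norm_le 0 ⟨le_rfl, hT⟩)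
  simpa using this

theorem WeightedBound.norm_sub_le {g : ℝ → E} (hg : WeightedBound β T ρ N g) {q r : ℝ}
    (hq : 0 < q) (hqr : q < r) (hr : r ≤ T) :
    ‖g r - g q‖ ≤ N * Real.exp (ρ * r) * ((r - q) ^ β * q ^ (-β)) := by
  have := hg.sub_le q r hq hqr hr
  rw [Real.rpow_neg hq.le, ← div_eq_mul_inv, ← mul_div_assoc,
    le_div_iff₀ (Real.rpow_pos_of_pos hq _), mul_comm]
  exact this

/-- In terms of the quotient `(r - q) / q`: if it is at most one, lowering the exponent only
increases the power; if it is at least one, the supremum bound for both values suffices, whence the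
factor 2. -/
theorem WeightedBound.norm_sub_le_of_le {g : ℝ → E} (hg : WeightedBound β T ρ N g) (hρ : 0 ≤ ρ)
    {γ : ℝ} (hγ : 0 ≤ γ) (hγβ : γ ≤ β) {q r : ℝ} (hq : 0 < q) (hqr : q < r)
    (hr : r ≤ T) :
    ‖g r - g q‖ ≤ 2 * N * Real.exp (ρ * r) * ((r - q) ^ γ * q ^ (-γ)) := by
  have hN : 0 ≤ N := hg.nonneg (by linarith)
  have hrq : 0 < r - q := sub_pos.2 hqr
  have hquot : ∀ c : ℝ, (r - q) ^ c * q ^ (-c) = ((r - q) / q) ^ c := fun c => by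
    rw [Real.div_rpow hrq.le hq.le, Real.rpow_neg hq.le, div_eq_mul_inv]
  have h0 : 0 ≤ N * Real.exp (ρ * r) := by positivity
  rw [hquot]
  rcases le_total ((r - q) / q) 1 with h | h
  · refine (hg.norm_sub_le hq hqr hr).trans ?_
    rw [hquot]
    calc N * Real.exp (ρ * r) * ((r - q) / q) ^ β ≤ N * Real.exp (ρ * r) * ((r - q) / q) ^ γ := by
          gcongr ?_ * ?_
          exact Real.rpow_le_rpow_of_exponent_ge (by positivity) h hγβ
      _ ≤ 2 * N * Real.exp (ρ * r) * ((r - q) / q) ^ γ := by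
          have : 0 ≤ N * Real.exp (ρ * r) * ((r - q) / q) ^ γ := by positivity
          linarith
  · have h1 : 1 ≤ ((r - q) / q) ^ γ := Real.one_le_rpow h hγ
    have h2 := hg.norm_le r ⟨by linarith, hr⟩
    have h3 : ‖g q‖ ≤ N * Real.exp (ρ * r) := by
      refine (hg.norm_le q ⟨hq.le, by linarith⟩).trans ?_
      gcongr
    calc ‖g r - g q‖ ≤ ‖g r‖ + ‖g q‖ := _root_.norm_sub_le _ _
      _ ≤ 2 * N * Real.exp (ρ * r) := by linarith
      _ ≤ _ := le_mul_of_one_le_right (by positivity) h1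

/-- Away from zero the weight is harmless: to the right of `s / 2` the function is Hölder continuous
with a fixed constant. At zero the bound gives no continuity. -/
theorem WeightedBound.continuousOn {g : ℝ → E} (hg : WeightedBound β T ρ N g) (hβ : 0 < β) :
    ContinuousOn g (Ioc 0 T) := by
  intro s hs
  have hT : 0 ≤ T := hs.1.le.trans hs.2
  have hN : 0 ≤ N := hg.nonneg hT
  set D := N * Real.exp (|ρ| * T) * (s / 2) ^ (-β) with hD
  have hs2 : 0 < s / 2 := half_pos hs.1
  have key : ∀ a b, s / 2 < a → a ≤ b → b ≤ T → ‖g b - g a‖ ≤ D * (b - a) ^ β := by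
    intro a b ha hab hb
    rcases hab.eq_or_lt with rfl | hab
    · simp [Real.zero_rpow hβ.ne']
    have ha0 : 0 < a := hs2.trans ha
    refine (hg.norm_sub_le ha0 hab hb).trans ?_
    have e1 : Real.exp (ρ * b) ≤ Real.exp (|ρ| * T) := by
      refine Real.exp_le_exp.2 ((mul_le_mul_of_nonneg_right (le_abs_self ρ) (by linarith)).trans ?_)
      gcongr
    have e2 : a ^ (-β) ≤ (s / 2) ^ (-β) :=
      Real.rpow_le_rpow_of_nonpos hs2 ha.le (by linarith)
    have h0 : 0 ≤ (b - a) ^ β := Real.rpow_nonneg (by linarith) _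
    calc N * Real.exp (ρ * b) * ((b - a) ^ β * a ^ (-β))
        ≤ N * Real.exp (|ρ| * T) * ((b - a) ^ β * (s / 2) ^ (-β)) := by gcongr
      _ = D * (b - a) ^ β := by rw [hD]; ring
  have key' : ∀ᶠ r in 𝓝[Ioc 0 T] s, ‖g r - g s‖ ≤ D * |r - s| ^ β := by
    filter_upwards [self_mem_nhdsWithin,
      nhdsWithin_le_nhds (Ioi_mem_nhds (half_lt_self hs.1))] with r hr hr2
    rcases le_total s r with h | h
    · rw [abs_of_nonneg (sub_nonneg.2 h)]
      exact key s r (half_lt_self hs.1) h hr.2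
    · rw [abs_sub_comm, abs_of_nonneg (sub_nonneg.2 h), norm_sub_rev]
      exact key r s hr2 h hs.2
  rw [ContinuousWithinAt, tendsto_iff_norm_sub_tendsto_zero]
  refine squeeze_zero' (Eventually.of_forall fun _ => norm_nonneg _) key' ?_
  have : Tendsto (fun r => D * |r - s| ^ β) (𝓝 s) (𝓝 (D * |s - s| ^ β)) := by
    refine Continuous.tendsto ?_ s
    exact continuous_const.mul ((continuous_abs.comp
      (continuous_id.sub continuous_const)).rpow_const fun _ => Or.inr hβ.le)
  rw [sub_self, abs_zero, Real.zero_rpow hβ.ne', mul_zero] at this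
  exact this.mono_left nhdsWithin_le_nhds

theorem WeightedBound.sub {g h : ℝ → E} {N' : ℝ} (hg : WeightedBound β T ρ N g)
    (hh : WeightedBound β T ρ N' h) : WeightedBound β T ρ (N + N') fun t => g t - h t where
  norm_le t ht := by
    refine (_root_.norm_sub_le _ _).trans ?_
    rw [add_mul]
    exact add_le_add (hg.norm_le t ht) (hh.norm_le t ht)
  sub_le s t hs hst ht := by
    have h1 := hg.sub_le s t hs hst ht
    have h2 := hh.sub_le s t hs hst ht
    have hs0 : 0 ≤ s ^ β := Real.rpow_nonneg hs.le _
    calc s ^ β * ‖g t - h t - (g s - h s)‖ ≤ s ^ β * (‖g t - g s‖ + ‖h t - h s‖) := by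
          gcongr
          rw [sub_sub_sub_comm]
          exact _root_.norm_sub_le _ _
      _ ≤ _ := by rw [mul_add, add_mul, add_mul]; exact add_le_add h1 h2

theorem WeightedBound.add {g h : ℝ → E} {N' : ℝ} (hg : WeightedBound β T ρ N g)
    (hh : WeightedBound β T ρ N' h) : WeightedBound β T ρ (N + N') fun t => g t + h t where
  norm_le t ht := by
    refine (norm_add_le _ _).trans ?_
    rw [add_mul]
    exact add_le_add (hg.norm_le t ht) (hh.norm_le t ht)
  sub_le s t hs hst ht := by
    have h1 := hg.sub_le s t hs hst ht
    have h2 := hh.sub_le s t hs hst ht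
    have hs0 : 0 ≤ s ^ β := Real.rpow_nonneg hs.le _
    calc s ^ β * ‖g t + h t - (g s + h s)‖ ≤ s ^ β * (‖g t - g s‖ + ‖h t - h s‖) := by
          gcongr
          rw [add_sub_add_comm]
          exact norm_add_le _ _
      _ ≤ _ := by rw [mul_add, add_mul, add_mul]; exact add_le_add h1 h2

theorem WeightedBound.mono {g : ℝ → E} {N' : ℝ} (hg : WeightedBound β T ρ N g) (h : N ≤ N') :
    WeightedBound β T ρ N' g where
  norm_le t ht := (hg.norm_le t ht).trans (by gcongr)
  sub_le s t hs hst ht := (hg.sub_le s t hs hst ht).trans (by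
    have := Real.rpow_nonneg (sub_pos.2 hst).le β
    gcongr)

end WeightedBounds

/-! ### The convolution integrand and its Weyl derivative. -/

section ConvolutionIntegrand

variable {V : Type*} [NormedAddCommGroup V] [InnerProductSpace ℝ V] {S : ℝ → V →L[ℝ] V}

theorem SemigroupBounds.norm_sub_le (hS : SemigroupBounds S) {γ x y : ℝ} (hγ : 0 ≤ γ)
    (hγ1 : γ ≤ 1) (hx : 0 < x) (hxy : x ≤ y) : ‖S x - S y‖ ≤ (y - x) ^ γ * x ^ (-γ) := by
  have := hS.sub_le γ x (y - x) hγ hγ1 hx (sub_nonneg.2 hxy)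
  rwa [add_sub_cancel, norm_sub_rev] at this

/-- The increment bound with `γ = 1` gives local Lipschitz continuity in operator norm at positive
times. -/
theorem SemigroupBounds.continuousOn (hS : SemigroupBounds S) : ContinuousOn S (Ioi 0) := by
  intro x hx
  have hx : 0 < x := hx
  refine ContinuousAt.continuousWithinAt ?_
  rw [ContinuousAt, tendsto_iff_norm_sub_tendsto_zero]
  have hb : ∀ᶠ y in 𝓝 x, ‖S y - S x‖ ≤ |y - x| * (x / 2)⁻¹ := by
    filter_upwards [Ioi_mem_nhds (half_lt_self hx)] with y hy
    have hy : x / 2 < y := hy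
    have hx2 : 0 < x / 2 := half_pos hx
    rcases le_total x y with h | h
    · have h1 := hS.norm_sub_le zero_le_one le_rfl hx h
      rw [Real.rpow_one, Real.rpow_neg_one] at h1
      rw [norm_sub_rev, abs_of_nonneg (sub_nonneg.2 h)]
      refine h1.trans ?_
      gcongr
      linarith
    · have h1 := hS.norm_sub_le zero_le_one le_rfl (hx2.trans hy) h
      rw [Real.rpow_one, Real.rpow_neg_one] at h1
      rw [abs_sub_comm, abs_of_nonneg (sub_nonneg.2 h)]
      refine h1.trans ?_
      gcongr
  refine squeeze_zero' (Eventually.of_forall fun _ => norm_nonneg _) hb ?_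
  have : Tendsto (fun y => |y - x| * (x / 2)⁻¹) (𝓝 x) (𝓝 (|x - x| * (x / 2)⁻¹)) :=
    Continuous.tendsto (by fun_prop) x
  simpa using this

variable [CompleteSpace V]

/-- The integrand `r ↦ S(t - r) g(r)` of a convolution. -/
noncomputable def convIntegrand (S : ℝ → V →L[ℝ] V) (g : ℝ → HilbertSchmidt V) (t r : ℝ) :
    HilbertSchmidt V :=
  HilbertSchmidt.comp (S (t - r)) (g r)

variable {g : ℝ → HilbertSchmidt V} {β T ρ N : ℝ}

theorem norm_convIntegrand_le (hS : SemigroupBounds S) {t r : ℝ} (hr : r ≤ t) :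
    ‖convIntegrand S g t r‖ ≤ ‖g r‖ :=
  (HilbertSchmidt.norm_comp_le _ _).trans
    (mul_le_of_le_one_left (norm_nonneg _) (hS.norm_le_one _ (sub_nonneg.2 hr)))

theorem continuousOn_convIntegrand (hS : SemigroupBounds S) {s : Set ℝ} {t : ℝ}
    (hg : ContinuousOn g s) (hs : s ⊆ Iio t) : ContinuousOn (convIntegrand S g t) s := by
  have h1 : ContinuousOn (fun r => S (t - r)) s :=
    hS.continuousOn.comp (by fun_prop) fun r hr => sub_pos.2 (mem_Iio.1 (hs hr))
  have h2 : ContinuousOn (fun r => HilbertSchmidt.compL (S (t - r)) (g r)) s :=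
    (HilbertSchmidt.compL.continuous.comp_continuousOn h1).clm_apply hg
  exact h2

/-- The pointwise bounds of the increments of the integrand of a convolution. -/
theorem norm_convIntegrand_sub_le (hS : SemigroupBounds S) (hg : WeightedBound β T ρ N g)
    (hρ : 0 ≤ ρ) (hβ1 : β ≤ 1) {γ : ℝ} (hγ : 0 < γ) (hγβ : γ ≤ β) {t r q : ℝ} (ht : t ≤ T)
    (hr : r ∈ Ioo 0 t) (hq : q ∈ Ioo 0 r) :
    ‖convIntegrand S g t r - convIntegrand S g t q‖
      ≤ N * Real.exp (ρ * r) * (3 * T ^ γ) * (t - r) ^ (-γ) * ((r - q) ^ γ * q ^ (-γ)) := by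
  have hT : 0 ≤ T := by linarith [hr.1, hr.2]
  have hN := hg.nonneg hT
  have hr0 := hr.1
  have hq0 := hq.1
  have htr := sub_pos.2 hr.2
  have hrq := sub_pos.2 hq.2
  have e : convIntegrand S g t r - convIntegrand S g t q
      = HilbertSchmidt.comp (S (t - r)) (g r - g q)
        + HilbertSchmidt.comp (S (t - r) - S (t - q)) (g q) := by
    rw [HilbertSchmidt.comp_sub_right, HilbertSchmidt.comp_sub_left, convIntegrand, convIntegrand]
    abel
  have h1 : ‖HilbertSchmidt.comp (S (t - r)) (g r - g q)‖
      ≤ 1 * (2 * N * Real.exp (ρ * r) * ((r - q) ^ γ * q ^ (-γ))) :=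
    (HilbertSchmidt.norm_comp_le _ _).trans (mul_le_mul (hS.norm_le_one _ htr.le)
      (hg.norm_sub_le_of_le hρ hγ.le hγβ hq.1 hq.2 (hr.2.le.trans ht))
      (norm_nonneg _) zero_le_one)
  have h2 : ‖HilbertSchmidt.comp (S (t - r) - S (t - q)) (g q)‖
      ≤ ((r - q) ^ γ * (t - r) ^ (-γ)) * (N * Real.exp (ρ * r)) := by
    refine (HilbertSchmidt.norm_comp_le _ _).trans (mul_le_mul ?_ ?_ (norm_nonneg _)
      (by positivity))
    · have := hS.norm_sub_le hγ.le (hγβ.trans hβ1) htr (y := t - q) (by linarith [hq.2])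
      rwa [show t - q - (t - r) = r - q by ring] at this
    · refine (hg.norm_le q ⟨hq.1.le, by linarith [hq.2, hr.2]⟩).trans ?_
      gcongr
      exact hq.2.le
  -- The increment of `g` lacks the singularity at `t`, the increment of `S` the one at `q = 0`.
  -- Both are inserted, and the constant becomes `3 = 2 + 1`.
  have t1 : 1 ≤ T ^ γ * (t - r) ^ (-γ) := one_le_rpow_mul_rpow_neg htr (by linarith) hγ.le
  have t2 : 1 ≤ T ^ γ * q ^ (-γ) :=
    one_le_rpow_mul_rpow_neg hq.1 (by linarith [hq.2, hr.2]) hγ.le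
  rw [e]
  refine (norm_add_le _ _).trans ((add_le_add h1 h2).trans ?_)
  calc 1 * (2 * N * Real.exp (ρ * r) * ((r - q) ^ γ * q ^ (-γ)))
        + ((r - q) ^ γ * (t - r) ^ (-γ)) * (N * Real.exp (ρ * r))
      = 2 * N * Real.exp (ρ * r) * ((r - q) ^ γ * q ^ (-γ)) * 1
        + ((r - q) ^ γ * (t - r) ^ (-γ)) * (N * Real.exp (ρ * r)) * 1 := by ring
    _ ≤ 2 * N * Real.exp (ρ * r) * ((r - q) ^ γ * q ^ (-γ)) * (T ^ γ * (t - r) ^ (-γ))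
        + ((r - q) ^ γ * (t - r) ^ (-γ)) * (N * Real.exp (ρ * r)) * (T ^ γ * q ^ (-γ)) := by
        gcongr
    _ = _ := by ring

theorem norm_convIntegrand_le' (hS : SemigroupBounds S) (hg : WeightedBound β T ρ N g)
    {t r : ℝ} (ht : t ≤ T) (hr : r ∈ Ioo 0 t) :
    ‖convIntegrand S g t r‖ ≤ N * Real.exp (ρ * r) :=
  (norm_convIntegrand_le hS hr.2.le).trans (hg.norm_le r ⟨hr.1.le, hr.2.le.trans ht⟩)

theorem weylAdmissible_convIntegrand (hS : SemigroupBounds S) (hg : WeightedBound β T ρ N g)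
    (hρ : 0 ≤ ρ) (hβ1 : β < 1) {α γ : ℝ} (hα : 0 < α) (hαγ : α < γ) (hγβ : γ ≤ β) {t : ℝ}
    (ht : t ≤ T) : WeylAdmissible α t (convIntegrand S g t) := by
  have hγ := hα.trans hαγ
  refine weylAdmissible_of_norm_le (M := N * Real.exp (ρ * T))
    (C := N * Real.exp (ρ * T) * (3 * T ^ γ)) hαγ (hγβ.trans_lt hβ1)
    (continuousOn_convIntegrand hS ((hg.continuousOn (hγ.trans_le hγβ)).mono fun r hr =>
      ⟨hr.1, hr.2.le.trans ht⟩) fun r hr => hr.2) (fun r hr => ?_) fun r hr q hq => ?_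
  · have hN := hg.nonneg (by linarith [hr.1, hr.2])
    refine (norm_convIntegrand_le' hS hg ht hr).trans ?_
    gcongr
    linarith [hr.2]
  · have hT : 0 ≤ T := by linarith [hr.1, hr.2]
    have hN := hg.nonneg hT
    have hq0 := hq.1
    have htr := sub_pos.2 hr.2
    have hrq := sub_pos.2 hq.2
    refine (norm_convIntegrand_sub_le hS hg hρ hβ1.le hγ hγβ ht hr hq).trans ?_
    calc N * Real.exp (ρ * r) * (3 * T ^ γ) * (t - r) ^ (-γ) * ((r - q) ^ γ * q ^ (-γ))
        ≤ N * Real.exp (ρ * T) * (3 * T ^ γ) * (t - r) ^ (-γ) * ((r - q) ^ γ * q ^ (-γ)) := by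
          gcongr
          linarith [hr.2]
      _ = _ := by ring

theorem norm_weylLeft_convIntegrand_le (hS : SemigroupBounds S) (hg : WeightedBound β T ρ N g)
    (hρ : 0 ≤ ρ) (hβ1 : β < 1) {α γ : ℝ} (hα : 0 < α) (hαγ : α < γ) (hγβ : γ ≤ β) {t r : ℝ}
    (ht : t ≤ T) (hr : r ∈ Ioo 0 t) :
    ‖weylLeft α 0 (convIntegrand S g t) r‖
      ≤ weylConst α γ * (4 * T ^ γ) * (N * Real.exp (ρ * r)) * (r ^ (-α) * (t - r) ^ (-γ)) := by
  have hγ := hα.trans hαγ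
  have hT : 0 ≤ T := by linarith [hr.1, hr.2]
  have hN := hg.nonneg hT
  have hr0 := hr.1
  have htr := sub_pos.2 hr.2
  have hw := weylConst_nonneg hα hαγ (hγβ.trans_lt hβ1)
  have t1 : 1 ≤ T ^ γ * (t - r) ^ (-γ) := one_le_rpow_mul_rpow_neg htr (by linarith) hγ.le
  refine (norm_weylLeft_le hα hαγ (hγβ.trans_lt hβ1) hr.1 (M := N * Real.exp (ρ * r))
    (N := N * Real.exp (ρ * r) * (3 * T ^ γ) * (t - r) ^ (-γ)) (by positivity) (by positivity)
    (norm_convIntegrand_le' hS hg ht hr)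
    fun q hq => norm_convIntegrand_sub_le hS hg hρ hβ1.le hγ hγβ ht hr hq).trans ?_
  calc weylConst α γ * (r ^ (-α) * (N * Real.exp (ρ * r)
        + N * Real.exp (ρ * r) * (3 * T ^ γ) * (t - r) ^ (-γ)))
      = weylConst α γ * (r ^ (-α) * (N * Real.exp (ρ * r) * 1
        + N * Real.exp (ρ * r) * (3 * T ^ γ) * (t - r) ^ (-γ))) := by ring
    _ ≤ weylConst α γ * (r ^ (-α) * (N * Real.exp (ρ * r) * (T ^ γ * (t - r) ^ (-γ))
        + N * Real.exp (ρ * r) * (3 * T ^ γ) * (t - r) ^ (-γ))) := by gcongr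
    _ = _ := by ring

theorem intervalIntegrable_weylLeftKernel_convIntegrand (hS : SemigroupBounds S)
    (hg : WeightedBound β T ρ N g) (hρ : 0 ≤ ρ) (hβ1 : β < 1) {α γ : ℝ} (hα : 0 < α) (hαγ : α < γ)
    (hγβ : γ ≤ β) {t r : ℝ} (ht : t ≤ T) (hr : r ∈ Ioo 0 t) :
    IntervalIntegrable (weylLeftKernel α (convIntegrand S g t) r) volume 0 r :=
  intervalIntegrable_weylLeftKernel hαγ (hγβ.trans_lt hβ1) hr.1
    ((weylAdmissible_convIntegrand hS hg hρ hβ1 hα hαγ hγβ ht).aestronglyMeasurable.mono_set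
      (Ioo_subset_Ioo_right hr.2.le))
    fun _ hq => norm_convIntegrand_sub_le hS hg hρ hβ1.le (hα.trans hαγ) hγβ ht hr hq

/-- The end point enters only through `S (t - q) - S (s - q)`, so increments in `q` of the
difference involve second differences of the semigroup. These cost `(s - r) ^ (-(β + γ))` and yield
`(t - s) ^ β`. The constant is `7 = 1 + 6` from the value and the increments. -/
theorem norm_weylLeft_convIntegrand_sub_le (hS : SemigroupBounds S)
    (hg : WeightedBound β T ρ N g) (hρ : 0 ≤ ρ) (hβ1 : β < 1) {α γ : ℝ} (hα : 0 < α) (hαγ : α < γ)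
    (hγβ : γ ≤ β) {s t r : ℝ} (hst : s < t) (ht : t ≤ T) (hr : r ∈ Ioo 0 s) :
    ‖weylLeft α 0 (convIntegrand S g t) r - weylLeft α 0 (convIntegrand S g s) r‖
      ≤ weylConst α γ * (7 * T ^ γ) * (N * Real.exp (ρ * r)) *
        ((t - s) ^ β * (s - r) ^ (-(β + γ)) * r ^ (-α)) := by
  have hγ := hα.trans hαγ
  have hβ := hγ.trans_le hγβ
  have hT : 0 ≤ T := by linarith [hr.1, hr.2]
  have hN := hg.nonneg hT
  have hr0 := hr.1
  have hsr := sub_pos.2 hr.2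
  have hts := sub_pos.2 hst
  have hw := weylConst_nonneg hα hαγ (hγβ.trans_lt hβ1)
  have hS1 : ‖S (t - r) - S (s - r)‖ ≤ (t - s) ^ β * (s - r) ^ (-β) := by
    have := hS.norm_sub_le hβ.le hβ1.le hsr (y := t - r) (by linarith)
    rwa [show t - r - (s - r) = t - s by ring, norm_sub_rev] at this
  have t1 : 1 ≤ T ^ γ * (s - r) ^ (-γ) := one_le_rpow_mul_rpow_neg hsr (by linarith) hγ.le
  have hsplit : (s - r) ^ (-(β + γ)) = (s - r) ^ (-β) * (s - r) ^ (-γ) := by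
    rw [← Real.rpow_add hsr]; ring_nf
  rw [← weylLeft_sub
    (intervalIntegrable_weylLeftKernel_convIntegrand hS hg hρ hβ1 hα hαγ hγβ ht
      ⟨hr.1, hr.2.trans hst⟩)
    (intervalIntegrable_weylLeftKernel_convIntegrand hS hg hρ hβ1 hα hαγ hγβ (hst.le.trans ht) hr)]
  set D := N * Real.exp (ρ * r) * ((t - s) ^ β * (s - r) ^ (-(β + γ))) with hD
  have hD0 : 0 ≤ D := by positivity
  have hval : ∀ q, convIntegrand S g t q - convIntegrand S g s q
      = HilbertSchmidt.comp (S (t - q) - S (s - q)) (g q) := fun q => by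
    rw [HilbertSchmidt.comp_sub_left]; rfl
  have hgr := hg.norm_le r ⟨hr.1.le, by linarith [hr.2]⟩
  have hM : ‖convIntegrand S g t r - convIntegrand S g s r‖ ≤ T ^ γ * D := by
    rw [hval]
    refine (HilbertSchmidt.norm_comp_le _ _).trans ((mul_le_mul hS1 hgr (norm_nonneg _)
      (by positivity)).trans ?_)
    calc (t - s) ^ β * (s - r) ^ (-β) * (N * Real.exp (ρ * r))
        ≤ (t - s) ^ β * (s - r) ^ (-β) * (N * Real.exp (ρ * r)) * (T ^ γ * (s - r) ^ (-γ)) :=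
          le_mul_of_one_le_right (by positivity) t1
      _ = T ^ γ * D := by rw [hD, hsplit]; ring
  have hΔ : ∀ q ∈ Ioo 0 r, ‖convIntegrand S g t r - convIntegrand S g s r
      - (convIntegrand S g t q - convIntegrand S g s q)‖
      ≤ 6 * T ^ γ * D * ((r - q) ^ γ * q ^ (-γ)) := by
    intro q hq
    have hq0 := hq.1
    have hrq := sub_pos.2 hq.2
    have t2 : 1 ≤ T ^ γ * q ^ (-γ) :=
      one_le_rpow_mul_rpow_neg hq.1 (by linarith [hq.2, hr.2]) hγ.le
    -- A first difference of `S` acts on the increment of `g`, and a second difference of `S` acts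
    -- on the value `g q`. They contribute 2 and 4 to the constant 6.
    have e : HilbertSchmidt.comp (S (t - r) - S (s - r)) (g r)
        - HilbertSchmidt.comp (S (t - q) - S (s - q)) (g q)
        = HilbertSchmidt.comp (S (t - r) - S (s - r)) (g r - g q)
          - HilbertSchmidt.comp (S (t - q) - S (t - r) - (S (s - q) - S (s - r))) (g q) := by
      rw [show S (t - q) - S (t - r) - (S (s - q) - S (s - r))
        = (S (t - q) - S (s - q)) - (S (t - r) - S (s - r)) by abel,
        HilbertSchmidt.comp_sub_left (S (t - q) - S (s - q)), HilbertSchmidt.comp_sub_right]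
      abel
    have h1 : ‖HilbertSchmidt.comp (S (t - r) - S (s - r)) (g r - g q)‖
        ≤ ((t - s) ^ β * (s - r) ^ (-β))
          * (2 * N * Real.exp (ρ * r) * ((r - q) ^ γ * q ^ (-γ))) :=
      (HilbertSchmidt.norm_comp_le _ _).trans (mul_le_mul hS1
        (hg.norm_sub_le_of_le hρ hγ.le hγβ hq.1 hq.2 (by linarith [hr.2]))
        (norm_nonneg _) (by positivity))
    have h2 : ‖HilbertSchmidt.comp (S (t - q) - S (t - r) - (S (s - q) - S (s - r))) (g q)‖
        ≤ 4 * ((t - s) ^ β * (r - q) ^ γ * (s - r) ^ (-(β + γ))) * (N * Real.exp (ρ * r)) := by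
      refine (HilbertSchmidt.norm_comp_le _ _).trans (mul_le_mul ?_ ?_ (norm_nonneg _)
        (by positivity))
      · have := hS.second_difference_le β γ (s - r) (t - s) (r - q) hβ.le hβ1.le hγ.le
          (hγβ.trans hβ1.le) hsr hts.le hrq.le
        rwa [show s - r + (t - s) + (r - q) = t - q by ring,
          show s - r + (t - s) = t - r by ring, show s - r + (r - q) = s - q by ring] at this
      · refine (hg.norm_le q ⟨hq.1.le, by linarith [hq.2, hr.2]⟩).trans ?_
        gcongr
        exact hq.2.le
    rw [hval, hval, e]
    refine (norm_sub_le _ _).trans ((add_le_add h1 h2).trans ?_)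
    calc ((t - s) ^ β * (s - r) ^ (-β)) * (2 * N * Real.exp (ρ * r) * ((r - q) ^ γ * q ^ (-γ)))
          + 4 * ((t - s) ^ β * (r - q) ^ γ * (s - r) ^ (-(β + γ))) * (N * Real.exp (ρ * r))
        = ((t - s) ^ β * (s - r) ^ (-β)) * (2 * N * Real.exp (ρ * r) * ((r - q) ^ γ * q ^ (-γ)))
            * 1
          + 4 * ((t - s) ^ β * (r - q) ^ γ * (s - r) ^ (-(β + γ))) * (N * Real.exp (ρ * r)) * 1 := by
          ring
      _ ≤ ((t - s) ^ β * (s - r) ^ (-β)) * (2 * N * Real.exp (ρ * r) * ((r - q) ^ γ * q ^ (-γ)))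
            * (T ^ γ * (s - r) ^ (-γ))
          + 4 * ((t - s) ^ β * (r - q) ^ γ * (s - r) ^ (-(β + γ))) * (N * Real.exp (ρ * r))
            * (T ^ γ * q ^ (-γ)) := by gcongr
      _ = _ := by rw [hD, hsplit]; ring
  refine (norm_weylLeft_le (f := fun r => convIntegrand S g t r - convIntegrand S g s r) hα hαγ
    (hγβ.trans_lt hβ1) hr.1 (M := T ^ γ * D) (N := 6 * T ^ γ * D)
    (by positivity) (by positivity) hM hΔ).trans_eq ?_
  rw [hD]
  ring

end ConvolutionIntegrand

/-! ### The weighted bound for integrals with end point singularities. -/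

section ConvolutionBound

/-- This is the source of smallness for large `ρ`: an additional singularity `(t - r) ^ (-η)` is
accepted in return for `ρ ^ (-η)`. -/
theorem exp_le_exp_mul_rpow {ρ η r t : ℝ} (hρ : 0 < ρ) (hη : 0 ≤ η) (hη1 : η ≤ 1) (hrt : r < t) :
    Real.exp (ρ * r) ≤ Real.exp (ρ * t) * (ρ ^ (-η) * (t - r) ^ (-η)) := by
  have h0 := sub_pos.2 hrt
  have h1 := Real.exp_neg_mul_rpow_le (mul_pos hρ h0).le hη hη1
  have h2 : 0 < (ρ * (t - r)) ^ η := Real.rpow_pos_of_pos (mul_pos hρ h0) _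
  rw [← Real.mul_rpow hρ.le h0.le, Real.rpow_neg (mul_pos hρ h0).le, ← div_eq_mul_inv,
    le_div_iff₀ h2]
  calc Real.exp (ρ * r) * (ρ * (t - r)) ^ η
      = Real.exp (ρ * t) * (Real.exp (-(ρ * (t - r))) * (ρ * (t - r)) ^ η) := by
        rw [← mul_assoc, ← Real.exp_add]; ring_nf
    _ ≤ Real.exp (ρ * t) * 1 := by gcongr
    _ = Real.exp (ρ * t) := mul_one _

/-- The value at `1` of the integral of `(1 - r) ^ (a - 1) * r ^ (-α)`. -/
noncomputable def betaConst (α a : ℝ) : ℝ :=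
  Real.Gamma a * Real.Gamma (1 - α) / Real.Gamma (a + (1 - α))

theorem betaConst_nonneg {α a : ℝ} (hα : α < 1) (ha : 0 < a) : 0 ≤ betaConst α a := by
  have := Real.Gamma_pos_of_pos ha
  have := Real.Gamma_pos_of_pos (sub_pos.2 hα)
  have := Real.Gamma_pos_of_pos (add_pos ha (sub_pos.2 hα))
  unfold betaConst
  positivity

theorem integrableOn_beta_kernel {α a t : ℝ} (hα : α < 1) (ha : 0 < a) (ht : 0 < t) :
    IntegrableOn (fun r => (t - r) ^ (a - 1) * r ^ (-α)) (Ioo 0 t) ∧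
    ∫ r in Ioo 0 t, (t - r) ^ (a - 1) * r ^ (-α) = betaConst α a * t ^ (a - α) := by
  have h1 := intervalIntegrable_sub_rpow_mul_sub_rpow ha (sub_pos.2 hα) ht
  have h2 := integral_sub_rpow_mul_sub_rpow ha (sub_pos.2 hα) ht
  simp only [sub_zero, show 1 - α - 1 = -α by ring, show a + (1 - α) - 1 = a - α by ring] at h1 h2
  rw [intervalIntegral_eq_Ioo ht.le] at h2
  exact ⟨(intervalIntegrable_iff_Ioo ht.le).1 h1, h2⟩

variable {E F G : Type*} [NormedAddCommGroup E] [NormedSpace ℝ E] [NormedAddCommGroup F]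
  [NormedSpace ℝ F] [NormedAddCommGroup G] [NormedSpace ℝ G]

theorem norm_integral_le_betaConst {α a t c : ℝ} (hα : α < 1) (ha : 0 < a) (ht : 0 < t)
    {f : ℝ → E} (hf : ∀ r ∈ Ioo 0 t, ‖f r‖ ≤ c * ((t - r) ^ (a - 1) * r ^ (-α))) :
    ‖∫ r in Ioo 0 t, f r‖ ≤ c * (betaConst α a * t ^ (a - α)) := by
  obtain ⟨h1, h2⟩ := integrableOn_beta_kernel hα ha ht
  rw [← h2, ← integral_const_mul]
  exact norm_integral_le_of_norm_le (h1.const_mul c)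
    ((ae_restrict_mem measurableSet_Ioo).mono hf)

theorem norm_integral_le_betaConst_add {α a b t c d : ℝ} (hα : α < 1) (ha : 0 < a) (hb : 0 < b)
    (ht : 0 < t) {f : ℝ → E} (hf : ∀ r ∈ Ioo 0 t, ‖f r‖ ≤
      c * ((t - r) ^ (a - 1) * r ^ (-α)) + d * ((t - r) ^ (b - 1) * r ^ (-α))) :
    ‖∫ r in Ioo 0 t, f r‖
      ≤ c * (betaConst α a * t ^ (a - α)) + d * (betaConst α b * t ^ (b - α)) := by
  obtain ⟨h1, h2⟩ := integrableOn_beta_kernel hα ha ht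
  obtain ⟨h3, h4⟩ := integrableOn_beta_kernel hα hb ht
  rw [← h2, ← h4, ← integral_const_mul, ← integral_const_mul,
    ← integral_add (h1.const_mul c) (h3.const_mul d)]
  exact norm_integral_le_of_norm_le ((h1.const_mul c).add (h3.const_mul d))
    ((ae_restrict_mem measurableSet_Ioo).mono hf)

/-- The weighted Hölder bound of `t ↦ ∫_0^t B (P t r) (Q t r) dr` for kernels `P` and `Q` with
singularities at the end points. -/
theorem exists_weightedBound_integral (B : E →L[ℝ] F →L[ℝ] G)
    (hB : ∀ x y, ‖B x y‖ ≤ ‖x‖ * ‖y‖) {α β β' η T c₁ c₂ c₃ c₄ : ℝ} (hη : 0 < η) (hηα : η ≤ α)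
    (hαβ : α + η ≤ β) (hββ' : β + 3 * η ≤ β') (hβ' : β' < 1) (hT : 0 ≤ T) (hc₁ : 0 ≤ c₁)
    (hc₂ : 0 ≤ c₂) (hc₃ : 0 ≤ c₃) (hc₄ : 0 ≤ c₄) :
    ∃ C, 0 ≤ C ∧ ∀ (ρ N : ℝ) (P : ℝ → ℝ → E) (Q : ℝ → ℝ → F), 0 < ρ → 0 ≤ N →
      (∀ t ∈ Ioc 0 T, ∀ r ∈ Ioo 0 t,
        ‖P t r‖ ≤ c₁ * (N * Real.exp (ρ * r)) * (r ^ (-α) * (t - r) ^ (-(α + η)))) →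
      (∀ t ∈ Ioc 0 T, ∀ r ∈ Ioo 0 t, ‖Q t r‖ ≤ c₂ * (t - r) ^ (β' + α - 1)) →
      (∀ s t, s < t → t ≤ T → ∀ r ∈ Ioo 0 s,
        ‖Q t r - Q s r‖ ≤ c₃ * ((t - s) ^ β' * (s - r) ^ (α - 1))) →
      (∀ s t, s < t → t ≤ T → ∀ r ∈ Ioo 0 s, ‖P t r - P s r‖ ≤
        c₄ * (N * Real.exp (ρ * r)) * ((t - s) ^ β * (s - r) ^ (-(β + (α + η))) * r ^ (-α))) →
      (∀ t ∈ Ioc 0 T, IntegrableOn (fun r => B (P t r) (Q t r)) (Ioo 0 t)) →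
      WeightedBound β T ρ (C * ρ ^ (-η) * N) fun t => ∫ r in 0..t, B (P t r) (Q t r) := by
  have hα : 0 < α := hη.trans_le hηα
  have hα1 : α < 1 := by linarith
  have hβ : 0 < β := by linarith
  have ha : 0 < β' - 2 * η := by linarith
  have hb : 0 < β' - β - 2 * η := by linarith
  have hB1 := betaConst_nonneg hα1 ha
  have hB2 := betaConst_nonneg hα1 hη
  have hB3 := betaConst_nonneg hα1 hb
  -- `C₁` belongs to the supremum bound. In the bound of increments, `C₂` comes from the integral
  -- over `(s, t)`, `C₃` from the increment of `Q` and `C₄` from the increment of `P` on `(0, s)`.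
  set C₁ := c₁ * c₂ * betaConst α (β' - 2 * η) * T ^ (β' - 2 * η - α) with hC₁
  set C₂ := c₁ * c₂ * T ^ (β - α) * T ^ (β' - 2 * η - β) / (β' - 2 * η) with hC₂
  set C₃ := c₁ * c₃ * betaConst α η * T ^ (β + η - α) * T ^ (β' - 3 * η - β) with hC₃
  set C₄ := c₄ * c₂ * betaConst α (β' - β - 2 * η) * T ^ (β' - 2 * η - α) with hC₄
  have hC₁0 : 0 ≤ C₁ := by positivity
  have hC₂0 : 0 ≤ C₂ := by positivity
  have hC₃0 : 0 ≤ C₃ := by positivity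
  have hC₄0 : 0 ≤ C₄ := by positivity
  refine ⟨C₁ + (C₂ + (C₃ + C₄)), by positivity, fun ρ N P Q hρ hN hP hQ hQd hPd hint => ?_⟩
  have hexp : ∀ {r t : ℝ}, r < t →
      Real.exp (ρ * r) ≤ Real.exp (ρ * t) * (ρ ^ (-η) * (t - r) ^ (-η)) :=
    fun h => exp_le_exp_mul_rpow hρ hη.le (by linarith) h
  have hρη : 0 ≤ ρ ^ (-η) := Real.rpow_nonneg hρ.le _
  -- The powers of `t - r` add up to `-η - (α + η) + (β' + α - 1) = β' - 2 η - 1`.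
  have hPQ : ∀ t ∈ Ioc 0 T, ∀ r ∈ Ioo 0 t, ‖B (P t r) (Q t r)‖ ≤
      c₁ * c₂ * (ρ ^ (-η) * N * Real.exp (ρ * t)) *
        ((t - r) ^ (β' - 2 * η - 1) * r ^ (-α)) := by
    intro t ht r hr
    have hr0 := hr.1
    have htr := sub_pos.2 hr.2
    calc ‖B (P t r) (Q t r)‖ ≤ ‖P t r‖ * ‖Q t r‖ := hB _ _
      _ ≤ (c₁ * (N * Real.exp (ρ * r)) * (r ^ (-α) * (t - r) ^ (-(α + η))))
          * (c₂ * (t - r) ^ (β' + α - 1)) :=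
        mul_le_mul (hP t ht r hr) (hQ t ht r hr) (norm_nonneg _) (by positivity)
      _ ≤ (c₁ * (N * (Real.exp (ρ * t) * (ρ ^ (-η) * (t - r) ^ (-η))))
          * (r ^ (-α) * (t - r) ^ (-(α + η)))) * (c₂ * (t - r) ^ (β' + α - 1)) := by
        gcongr
        exact hexp hr.2
      _ = c₁ * c₂ * (ρ ^ (-η) * N * Real.exp (ρ * t)) *
          (((t - r) ^ (-η) * (t - r) ^ (-(α + η)) * (t - r) ^ (β' + α - 1)) * r ^ (-α)) := by ring
      _ = _ := by
        rw [← Real.rpow_add htr, ← Real.rpow_add htr]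
        ring_nf
  constructor
  · intro t ht
    rcases ht.1.eq_or_lt with rfl | ht0
    · simp only [intervalIntegral.integral_same, norm_zero]
      positivity
    rw [intervalIntegral_eq_Ioo ht.1]
    refine (norm_integral_le_betaConst hα1 ha ht0 (hPQ t ⟨ht0, ht.2⟩)).trans ?_
    have h1 : t ^ (β' - 2 * η - α) ≤ T ^ (β' - 2 * η - α) :=
      Real.rpow_le_rpow ht0.le ht.2 (by linarith)
    calc c₁ * c₂ * (ρ ^ (-η) * N * Real.exp (ρ * t)) *
          (betaConst α (β' - 2 * η) * t ^ (β' - 2 * η - α))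
        ≤ c₁ * c₂ * (ρ ^ (-η) * N * Real.exp (ρ * t)) *
          (betaConst α (β' - 2 * η) * T ^ (β' - 2 * η - α)) := by gcongr
      _ = C₁ * ρ ^ (-η) * N * Real.exp (ρ * t) := by rw [hC₁]; ring
      _ ≤ _ := by
        gcongr
        linarith [add_nonneg hC₂0 (add_nonneg hC₃0 hC₄0)]
  · intro s t hs hst htT
    have ht0 := hs.trans hst
    have hts := sub_pos.2 hst
    have ht : t ∈ Ioc 0 T := ⟨ht0, htT⟩
    have hs' : s ∈ Ioc 0 T := ⟨hs, hst.le.trans htT⟩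
    have hit := hint t ht
    have his := hint s hs'
    have hit0 : IntegrableOn (fun r => B (P t r) (Q t r)) (Ioo 0 s) :=
      hit.mono_set (Ioo_subset_Ioo_right hst.le)
    have hit1 : IntegrableOn (fun r => B (P t r) (Q t r)) (Ioo s t) :=
      hit.mono_set (Ioo_subset_Ioo_left hs.le)
    have hdecomp : (∫ r in 0..t, B (P t r) (Q t r)) - ∫ r in 0..s, B (P s r) (Q s r)
        = (∫ r in s..t, B (P t r) (Q t r))
          + ∫ r in Ioo 0 s, (B (P t r) (Q t r) - B (P s r) (Q s r)) := by
      rw [integral_sub hit0 his, ← intervalIntegral_eq_Ioo hs.le, ← intervalIntegral_eq_Ioo hs.le,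
        ← intervalIntegral.integral_add_adjacent_intervals
          ((intervalIntegrable_iff_Ioo hs.le).2 hit0) ((intervalIntegrable_iff_Ioo hst.le).2 hit1)]
      abel
    set D := ρ ^ (-η) * N * Real.exp (ρ * t) with hD
    have hD0 : 0 ≤ D := by positivity
    have hsβ : 0 ≤ s ^ β := Real.rpow_nonneg hs.le _
    -- Here `r ^ (-α) ≤ s ^ (-α)`, which the weight `s ^ β` absorbs because `α ≤ β`.
    have b1 : ‖∫ r in s..t, B (P t r) (Q t r)‖
        ≤ c₁ * c₂ * D * s ^ (-α) * ((t - s) ^ (β' - 2 * η) / (β' - 2 * η)) := by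
      have hii : IntervalIntegrable (fun r => (t - r) ^ (β' - 2 * η - 1)) volume s t := by
        have := (intervalIntegral.intervalIntegrable_rpow' (a := 0) (b := t - s)
          (r := β' - 2 * η - 1) (by linarith)).comp_sub_left t
        rw [sub_zero, sub_sub_cancel] at this
        exact this.symm
      have hv : ∫ r in s..t, (t - r) ^ (β' - 2 * η - 1)
          = (t - s) ^ (β' - 2 * η) / (β' - 2 * η) := by
        rw [intervalIntegral.integral_comp_sub_left (fun x => x ^ (β' - 2 * η - 1)), sub_self,
          integral_rpow (Or.inl (by linarith)), sub_add_cancel, Real.zero_rpow ha.ne', sub_zero]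
      rw [← hv, ← intervalIntegral.integral_const_mul, intervalIntegral_eq_Ioo hst.le,
        intervalIntegral_eq_Ioo hst.le]
      refine norm_integral_le_of_norm_le
        (((intervalIntegrable_iff_Ioo hst.le).1 hii).const_mul _) ?_
      filter_upwards [ae_restrict_mem measurableSet_Ioo] with r hr
      have htr := sub_pos.2 hr.2
      refine (hPQ t ht r ⟨hs.trans hr.1, hr.2⟩).trans ?_
      calc c₁ * c₂ * D * ((t - r) ^ (β' - 2 * η - 1) * r ^ (-α))
          ≤ c₁ * c₂ * D * ((t - r) ^ (β' - 2 * η - 1) * s ^ (-α)) := by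
            gcongr ?_ * (_ * ?_)
            exact Real.rpow_le_rpow_of_nonpos hs hr.1.le (by linarith)
        _ = _ := by ring
    have b2 : ‖∫ r in Ioo 0 s, (B (P t r) (Q t r) - B (P s r) (Q s r))‖
        ≤ c₁ * c₃ * D * (t - s) ^ (β' - 3 * η) * (betaConst α η * s ^ (η - α))
          + c₄ * c₂ * D * (t - s) ^ β *
            (betaConst α (β' - β - 2 * η) * s ^ (β' - β - 2 * η - α)) := by
      refine norm_integral_le_betaConst_add hα1 hη hb hs fun r hr => ?_
      have hr0 := hr.1
      have hsr := sub_pos.2 hr.2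
      have htr : 0 < t - r := by linarith
      have e : B (P t r) (Q t r) - B (P s r) (Q s r)
          = B (P t r) (Q t r - Q s r) + B (P t r - P s r) (Q s r) := by
        simp only [map_sub, sub_apply]
        abel
      have p1 : ‖B (P t r) (Q t r - Q s r)‖
          ≤ c₁ * c₃ * D * (t - s) ^ (β' - 3 * η) * ((s - r) ^ (η - 1) * r ^ (-α)) := by
        -- The power `(t - r) ^ (-(α + 2 η))` is distributed: `-3 η` goes to `t - s`, leaving `β' -
        -- 3 η ≥ β`, and `-(α - η)` goes to `s - r`, where together with `α - 1` it gives the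
        -- integrable exponent `η - 1`.
        have w1 : (t - r) ^ (-(3 * η)) ≤ (t - s) ^ (-(3 * η)) :=
          Real.rpow_le_rpow_of_nonpos hts (by linarith) (by linarith)
        have w2 : (t - r) ^ (-(α - η)) ≤ (s - r) ^ (-(α - η)) :=
          Real.rpow_le_rpow_of_nonpos hsr (by linarith) (by linarith)
        calc ‖B (P t r) (Q t r - Q s r)‖ ≤ ‖P t r‖ * ‖Q t r - Q s r‖ := hB _ _
          _ ≤ (c₁ * (N * Real.exp (ρ * r)) * (r ^ (-α) * (t - r) ^ (-(α + η))))
              * (c₃ * ((t - s) ^ β' * (s - r) ^ (α - 1))) :=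
            mul_le_mul (hP t ht r ⟨hr.1, by linarith⟩) (hQd s t hst htT r hr) (norm_nonneg _)
              (by positivity)
          _ ≤ (c₁ * (N * (Real.exp (ρ * t) * (ρ ^ (-η) * (t - r) ^ (-η))))
              * (r ^ (-α) * (t - r) ^ (-(α + η)))) * (c₃ * ((t - s) ^ β' * (s - r) ^ (α - 1))) := by
            gcongr
            exact hexp (by linarith)
          _ = c₁ * c₃ * D * (t - s) ^ β' * r ^ (-α) *
              (((t - r) ^ (-η) * (t - r) ^ (-(α + η))) * (s - r) ^ (α - 1)) := by rw [hD]; ring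
          _ = c₁ * c₃ * D * (t - s) ^ β' * r ^ (-α) *
              (((t - r) ^ (-(3 * η)) * (t - r) ^ (-(α - η))) * (s - r) ^ (α - 1)) := by
            rw [← Real.rpow_add htr, ← Real.rpow_add htr]
            ring_nf
          _ ≤ c₁ * c₃ * D * (t - s) ^ β' * r ^ (-α) *
              (((t - s) ^ (-(3 * η)) * (s - r) ^ (-(α - η))) * (s - r) ^ (α - 1)) := by
            gcongr
          _ = c₁ * c₃ * D * ((t - s) ^ β' * (t - s) ^ (-(3 * η))) *
              (((s - r) ^ (-(α - η)) * (s - r) ^ (α - 1)) * r ^ (-α)) := by ring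
          _ = _ := by
            rw [← Real.rpow_add hts, ← Real.rpow_add hsr]
            ring_nf
      have p2 : ‖B (P t r - P s r) (Q s r)‖ ≤ c₄ * c₂ * D * (t - s) ^ β *
          ((s - r) ^ (β' - β - 2 * η - 1) * r ^ (-α)) := by
        have hexp' : Real.exp (ρ * r) ≤ Real.exp (ρ * t) * (ρ ^ (-η) * (s - r) ^ (-η)) := by
          refine (hexp hr.2).trans ?_
          gcongr
        calc ‖B (P t r - P s r) (Q s r)‖ ≤ ‖P t r - P s r‖ * ‖Q s r‖ := hB _ _
          _ ≤ (c₄ * (N * Real.exp (ρ * r)) *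
              ((t - s) ^ β * (s - r) ^ (-(β + (α + η))) * r ^ (-α)))
              * (c₂ * (s - r) ^ (β' + α - 1)) :=
            mul_le_mul (hPd s t hst htT r hr) (hQ s hs' r hr) (norm_nonneg _) (by positivity)
          _ ≤ (c₄ * (N * (Real.exp (ρ * t) * (ρ ^ (-η) * (s - r) ^ (-η)))) *
              ((t - s) ^ β * (s - r) ^ (-(β + (α + η))) * r ^ (-α)))
              * (c₂ * (s - r) ^ (β' + α - 1)) := by gcongr
          _ = c₄ * c₂ * D * (t - s) ^ β * (((s - r) ^ (-η) * (s - r) ^ (-(β + (α + η)))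
              * (s - r) ^ (β' + α - 1)) * r ^ (-α)) := by rw [hD]; ring
          _ = _ := by
            rw [← Real.rpow_add hsr, ← Real.rpow_add hsr]
            ring_nf
      rw [e]
      exact (norm_add_le _ _).trans (add_le_add p1 p2)
    have hs1 : s ^ (β - α) ≤ T ^ (β - α) := Real.rpow_le_rpow hs.le hs'.2 (by linarith)
    have hs2 : s ^ (β + η - α) ≤ T ^ (β + η - α) := Real.rpow_le_rpow hs.le hs'.2 (by linarith)
    have hs3 : s ^ (β' - 2 * η - α) ≤ T ^ (β' - 2 * η - α) :=
      Real.rpow_le_rpow hs.le hs'.2 (by linarith)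
    have htsT : t - s ≤ T := by linarith
    have ht1 := rpow_le_rpow_sub_mul_rpow hts htsT (by linarith : β ≤ β' - 2 * η)
    have ht2 := rpow_le_rpow_sub_mul_rpow hts htsT (by linarith : β ≤ β' - 3 * η)
    have htβ : 0 ≤ (t - s) ^ β := Real.rpow_nonneg hts.le _
    have f1 : s ^ β * (c₁ * c₂ * D * s ^ (-α) * ((t - s) ^ (β' - 2 * η) / (β' - 2 * η)))
        ≤ C₂ * D * (t - s) ^ β := by
      calc s ^ β * (c₁ * c₂ * D * s ^ (-α) * ((t - s) ^ (β' - 2 * η) / (β' - 2 * η)))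
          = c₁ * c₂ * D * s ^ (β - α) * ((t - s) ^ (β' - 2 * η) / (β' - 2 * η)) := by
            rw [show β - α = β + -α by ring, Real.rpow_add hs]; ring
        _ ≤ c₁ * c₂ * D * T ^ (β - α) * (T ^ (β' - 2 * η - β) * (t - s) ^ β / (β' - 2 * η)) := by
            gcongr
        _ = _ := by rw [hC₂]; ring
    have f2 : s ^ β * (c₁ * c₃ * D * (t - s) ^ (β' - 3 * η) * (betaConst α η * s ^ (η - α)))
        ≤ C₃ * D * (t - s) ^ β := by
      calc s ^ β * (c₁ * c₃ * D * (t - s) ^ (β' - 3 * η) * (betaConst α η * s ^ (η - α)))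
          = c₁ * c₃ * D * (t - s) ^ (β' - 3 * η) * (betaConst α η * s ^ (β + η - α)) := by
            rw [show β + η - α = β + (η - α) by ring, Real.rpow_add hs]; ring
        _ ≤ c₁ * c₃ * D * (T ^ (β' - 3 * η - β) * (t - s) ^ β) *
            (betaConst α η * T ^ (β + η - α)) := by gcongr
        _ = _ := by rw [hC₃]; ring
    have f3 : s ^ β * (c₄ * c₂ * D * (t - s) ^ β *
          (betaConst α (β' - β - 2 * η) * s ^ (β' - β - 2 * η - α)))
        ≤ C₄ * D * (t - s) ^ β := by
      calc s ^ β * (c₄ * c₂ * D * (t - s) ^ β *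
            (betaConst α (β' - β - 2 * η) * s ^ (β' - β - 2 * η - α)))
          = c₄ * c₂ * D * (t - s) ^ β *
            (betaConst α (β' - β - 2 * η) * s ^ (β' - 2 * η - α)) := by
            rw [show β' - 2 * η - α = β + (β' - β - 2 * η - α) by ring, Real.rpow_add hs]; ring
        _ ≤ c₄ * c₂ * D * (t - s) ^ β *
            (betaConst α (β' - β - 2 * η) * T ^ (β' - 2 * η - α)) := by gcongr
        _ = _ := by rw [hC₄]; ring
    rw [hdecomp]
    calc s ^ β * ‖(∫ r in s..t, B (P t r) (Q t r))
            + ∫ r in Ioo 0 s, (B (P t r) (Q t r) - B (P s r) (Q s r))‖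
        ≤ s ^ β * (c₁ * c₂ * D * s ^ (-α) * ((t - s) ^ (β' - 2 * η) / (β' - 2 * η))
          + (c₁ * c₃ * D * (t - s) ^ (β' - 3 * η) * (betaConst α η * s ^ (η - α))
          + c₄ * c₂ * D * (t - s) ^ β *
            (betaConst α (β' - β - 2 * η) * s ^ (β' - β - 2 * η - α)))) := by
          gcongr
          exact (norm_add_le _ _).trans (add_le_add b1 b2)
      _ ≤ C₂ * D * (t - s) ^ β + (C₃ * D * (t - s) ^ β + C₄ * D * (t - s) ^ β) := by
          rw [mul_add, mul_add]
          exact add_le_add f1 (add_le_add f2 f3)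
      _ = (C₂ + (C₃ + C₄)) * ρ ^ (-η) * N * Real.exp (ρ * t) * (t - s) ^ β := by rw [hD]; ring
      _ ≤ (C₁ + (C₂ + (C₃ + C₄))) * ρ ^ (-η) * N * Real.exp (ρ * t) * (t - s) ^ β := by
          gcongr ?_ * _ * _ * _ * _
          linarith

end ConvolutionBound

/-! ### Pathwise convolutions with the semigroup. -/

section Convolution

variable {V : Type*} [NormedAddCommGroup V] [InnerProductSpace ℝ V] [CompleteSpace V]

/-- The pathwise convolution `∫_0^t S(t - r) g(r) dω` of order `α`. -/
noncomputable def pathConvolution (S : ℝ → V →L[ℝ] V) (ω : ℝ → V) (α : ℝ)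
    (g : ℝ → HilbertSchmidt V) (t : ℝ) : V :=
  zahleIntegral α (convIntegrand S g t) ω 0 t

variable {S : ℝ → V →L[ℝ] V} {ω : ℝ → V} {g h : ℝ → HilbertSchmidt V} {α β β' K T ρ N N' : ℝ}

theorem weylAdmissible_convIntegrand' (hS : SemigroupBounds S) (hg : WeightedBound β T ρ N g)
    (hρ : 0 ≤ ρ) (hα : 0 < α) (hαβ : α < β) (hβ1 : β < 1) {t : ℝ} (ht : t ∈ Ioc 0 T) :
    WeylAdmissible α t (convIntegrand S g t) :=
  weylAdmissible_convIntegrand hS hg hρ hβ1 hα hαβ le_rfl ht.2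

theorem integrableOn_pathConvolution (hS : SemigroupBounds S) (hω : HolderBound β' K T ω)
    (hK : 0 ≤ K) (hα : 1 - β' < α) (hαβ : α < β) (hββ' : β < β') (hβ' : β' < 1)
    (hg : WeightedBound β T ρ N g) (hρ : 0 ≤ ρ) {t : ℝ} (ht : t ∈ Ioc 0 T) :
    IntegrableOn (fun r => HilbertSchmidt.toCLML (weylLeft α 0 (convIntegrand S g t) r)
      (weylLeft (1 - α) 0 (reversedPath ω t) (t - r))) (Ioo 0 t) := by
  obtain ⟨M, hM⟩ := hω.exists_norm_weylLeft_le hK hα (by linarith) hβ' ht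
  exact (integrableOn_zahleIntegrand (by linarith) (by linarith)
    (weylAdmissible_convIntegrand' hS hg hρ (by linarith) hαβ (by linarith) ht)
    (hω.weylAdmissible hK (by linarith) (by linarith) hβ' ht) hM).1

theorem zahleIntegrable_convIntegrand (hS : SemigroupBounds S) (hω : HolderBound β' K T ω)
    (hK : 0 ≤ K) (hα : 1 - β' < α) (hαβ : α < β) (hββ' : β < β') (hβ' : β' < 1)
    (hg : WeightedBound β T ρ N g) (hρ : 0 ≤ ρ) (hgc : ContinuousOn g (Icc 0 T)) {t : ℝ}
    (ht : t ∈ Ioc 0 T) : ZahleIntegrable α (convIntegrand S g t) ω 0 t := by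
  obtain ⟨M, hM⟩ := hω.exists_norm_weylLeft_le hK hα (by linarith) hβ' ht
  refine zahleIntegrable_of_weylAdmissible (by linarith) (by linarith) ht.1
    (weylAdmissible_convIntegrand' hS hg hρ (by linarith) hαβ (by linarith) ht)
    ⟨convIntegrand S g t 0, ?_⟩
    ((hω.continuousOn (by linarith)).mono (Icc_subset_Icc_right ht.2))
    (hω.weylAdmissible hK (by linarith) (by linarith) hβ' ht) hM
  -- The end point `t`, where `S` need not be norm continuous, is excluded; only the limit at zero
  -- is required.
  have hc : ContinuousOn (convIntegrand S g t) (Ico 0 t) :=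
    continuousOn_convIntegrand hS (hgc.mono fun r hr => ⟨hr.1, hr.2.le.trans ht.2⟩) fun r hr => hr.2
  exact ((hc 0 ⟨le_rfl, ht.1⟩).mono_of_mem_nhdsWithin (Ico_mem_nhdsGT ht.1)).tendsto

theorem pathConvolution_eq_of_lt (hS : SemigroupBounds S) (hω : HolderBound β' K T ω)
    (hK : 0 ≤ K) {α' : ℝ} (hα : 1 - β' < α) (hαα' : α < α') (hαβ : α' < β) (hββ' : β < β')
    (hβ' : β' < 1) (hg : WeightedBound β T ρ N g) (hρ : 0 ≤ ρ) {t : ℝ} (ht : t ∈ Ioc 0 T) :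
    pathConvolution S ω α g t = pathConvolution S ω α' g t := by
  obtain ⟨M, hM⟩ := hω.exists_norm_weylLeft_le hK hα (by linarith) hβ' ht
  exact zahleIntegral_eq_of_lt (by linarith) hαα' (by linarith) ht.1.le
    (weylAdmissible_convIntegrand' hS hg hρ (by linarith) (by linarith) (by linarith) ht)
    (weylAdmissible_convIntegrand' hS hg hρ (by linarith) hαβ (by linarith) ht)
    (hω.weylAdmissible hK (by linarith) (by linarith) hβ' ht)
    (hω.weylAdmissible hK (by linarith) (by linarith) hβ' ht) hM

theorem pathConvolution_zero : pathConvolution S ω α g 0 = 0 := by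
  simp [pathConvolution, zahleIntegral]

/-- The convolution does not depend on the order of the pathwise integral. -/
theorem pathConvolution_eq (hS : SemigroupBounds S) (hω : HolderBound β' K T ω)
    (hK : 0 ≤ K) {α' : ℝ} (hα : 1 - β' < α) (hαβ : α < β) (hα' : 1 - β' < α') (hαβ' : α' < β)
    (hββ' : β < β') (hβ' : β' < 1) (hg : WeightedBound β T ρ N g) (hρ : 0 ≤ ρ) {t : ℝ}
    (ht : t ∈ Icc 0 T) : pathConvolution S ω α g t = pathConvolution S ω α' g t := by
  rcases ht.1.eq_or_lt with rfl | ht0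
  · rw [pathConvolution_zero, pathConvolution_zero]
  rcases lt_trichotomy α α' with h | rfl | h
  · exact pathConvolution_eq_of_lt hS hω hK hα h hαβ' hββ' hβ' hg hρ ⟨ht0, ht.2⟩
  · rfl
  · exact (pathConvolution_eq_of_lt hS hω hK hα' h hαβ hββ' hβ' hg hρ ⟨ht0, ht.2⟩).symm

theorem pathConvolution_sub (hS : SemigroupBounds S) (hω : HolderBound β' K T ω)
    (hK : 0 ≤ K) (hα : 1 - β' < α) (hαβ : α < β) (hββ' : β < β') (hβ' : β' < 1)
    (hg : WeightedBound β T ρ N g) (hh : WeightedBound β T ρ N' h) (hρ : 0 ≤ ρ) {t : ℝ}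
    (ht : t ∈ Icc 0 T) : pathConvolution S ω α (fun r => g r - h r) t
      = pathConvolution S ω α g t - pathConvolution S ω α h t := by
  rcases ht.1.eq_or_lt with rfl | ht0
  · simp [pathConvolution_zero]
  have ht' : t ∈ Ioc 0 T := ⟨ht0, ht.2⟩
  have h1 := integrableOn_pathConvolution hS hω hK hα hαβ hββ' hβ' hg hρ ht'
  have h2 := integrableOn_pathConvolution hS hω hK hα hαβ hββ' hβ' hh hρ ht'
  simp only [pathConvolution, zahleIntegral, zahleIntegrand_eq]
  rw [intervalIntegral_eq_Ioo ht.1, intervalIntegral_eq_Ioo ht.1, intervalIntegral_eq_Ioo ht.1,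
    sub_neg_eq_add, neg_add_eq_sub, neg_eq_iff_eq_neg, neg_sub (∫ r in Ioo 0 t, _),
    ← integral_sub h1 h2]
  refine setIntegral_congr_fun measurableSet_Ioo fun r hr => ?_
  have e : convIntegrand S (fun r => g r - h r) t
      = fun r => convIntegrand S g t r - convIntegrand S h t r := by
    ext1 r
    exact HilbertSchmidt.comp_sub_right _ _ _
  simp only [e]
  rw [weylLeft_sub
    (intervalIntegrable_weylLeftKernel_convIntegrand hS hg hρ (by linarith) (by linarith) hαβ
      le_rfl ht.2 hr)
    (intervalIntegrable_weylLeftKernel_convIntegrand hS hh hρ (by linarith) (by linarith) hαβ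
      le_rfl ht.2 hr), map_sub, sub_apply]

/-- The convolution is bounded in the weighted Hölder norm, with a bound that vanishes as the
weight parameter `ρ` grows. -/
theorem exists_weightedBound_pathConvolution (hS : SemigroupBounds S) (hω : HolderBound β' K T ω)
    (hK : 0 ≤ K) (hα : 1 - β' < α) (hαβ : α < β) (hββ' : β < β') (hβ' : β' < 1) (hT : 0 ≤ T) :
    ∃ η C : ℝ, 0 < η ∧ 0 ≤ C ∧ ∀ (ρ N : ℝ) (g : ℝ → HilbertSchmidt V), 0 < ρ →
      WeightedBound β T ρ N g →
      WeightedBound β T ρ (C * ρ ^ (-η) * N) (pathConvolution S ω α g) := by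
  have hα0 : 0 < α := by linarith
  have hκ : 0 < 1 - α := by linarith
  have hκβ' : 1 - α < β' := by linarith
  -- The conditions leave room because `0 < α < β < β'`. The Weyl derivatives of the integrand are
  -- then estimated with Hölder exponent `α + η`.
  obtain ⟨η, hη, hη1, hη2, hη3⟩ : ∃ η > 0, η ≤ α ∧ α + η ≤ β ∧ β + 3 * η ≤ β' := by
    refine ⟨min (min α (β - α)) ((β' - β) / 3), ?_, ?_, ?_, ?_⟩
    · exact lt_min (lt_min hα0 (by linarith)) (by linarith)
    · exact (min_le_left _ _).trans (min_le_left _ _)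
    · linarith [(min_le_left (min α (β - α)) ((β' - β) / 3)).trans (min_le_right _ _)]
    · linarith [min_le_right (min α (β - α)) ((β' - β) / 3)]
  have hw1 := weylConst_nonneg hα0 (by linarith : α < α + η) (by linarith)
  have hw2 := weylConst_nonneg hκ hκβ' hβ'
  have hg := Real.Gamma_pos_of_pos (by linarith : 0 < 1 - (1 - α))
  -- The negative bilinear map accounts for the sign in `zahleIntegral`.
  obtain ⟨C, hC, h⟩ := exists_weightedBound_integral (-HilbertSchmidt.toCLML (V := V))
    (fun x y => by
      rw [neg_apply, neg_apply, norm_neg]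
      exact (ContinuousLinearMap.le_opNorm _ _).trans
        (mul_le_mul_of_nonneg_right (HilbertSchmidt.norm_toCLM_le _) (norm_nonneg _)))
    (c₁ := weylConst α (α + η) * (4 * T ^ (α + η))) (c₂ := weylConst (1 - α) β' * (2 * K))
    (c₃ := (Real.Gamma (1 - (1 - α)))⁻¹ * K) (c₄ := weylConst α (α + η) * (7 * T ^ (α + η)))
    hη hη1 hη2 hη3 hβ' hT (by positivity) (by positivity) (by positivity) (by positivity)
  refine ⟨η, C, hη, hC, fun ρ N g hρ hgN => ?_⟩
  have := h ρ N (fun t r => weylLeft α 0 (convIntegrand S g t) r)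
    (fun t r => weylLeft (1 - α) 0 (reversedPath ω t) (t - r)) hρ (hgN.nonneg hT)
    (fun t ht r hr => norm_weylLeft_convIntegrand_le hS hgN hρ.le (by linarith) hα0 (by linarith)
      hη2 ht.2 hr)
    (fun t ht r hr => ?_) (fun s t hst ht r hr => ?_)
    (fun s t hst ht r hr => norm_weylLeft_convIntegrand_sub_le hS hgN hρ.le (by linarith) hα0
      (by linarith) hη2 hst ht hr) (fun t ht => ?_)
  · convert this using 2 with t
    simp only [pathConvolution, zahleIntegral, zahleIntegrand_eq]
    rw [← intervalIntegral.integral_neg]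
    rfl
  · have := hω.norm_weylLeft_reversedPath_le hK hκ hκβ' hβ' ht (s := t - r)
      ⟨sub_pos.2 hr.2, by linarith [hr.1]⟩
    rwa [show β' - (1 - α) = β' + α - 1 by ring] at this
  · have := hω.norm_weylRight_sub_le hK hκ hκβ' hβ' hr.1 hr.2 hst ht
    rw [weylRight_subLeftLim, weylRight_subLeftLim] at this
    rwa [neg_sub] at this
  · have := (integrableOn_pathConvolution hS hω hK hα hαβ hββ' hβ' hgN hρ.le ht).neg
    exact this

end Convolution

/-! ### Increments of the nonlinearity. -/

section Nonlinearity

variable {E F : Type*} [NormedAddCommGroup E] [NormedSpace ℝ E] [NormedAddCommGroup F]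
  [NormedSpace ℝ F] {G : E → F}

/-- The four-point bound controls Hölder increments of `G ∘ u - G ∘ v`. It is the mean value
inequality for the difference of `G` along the segments from `y` to `x` and from `y'` to `x'`: the
derivative splits into `DG` applied to the difference of directions and an increment of `DG`, which
is Lipschitz by the bound on the second derivative. -/
theorem IsTwiceDiffBounded.exists_norm_sub_le (hG : IsTwiceDiffBounded G) :
    ∃ L, 0 ≤ L ∧ (∀ x y, ‖G x - G y‖ ≤ L * ‖x - y‖) ∧
      ∀ x y x' y', ‖G x - G y - (G x' - G y')‖
        ≤ L * (‖x - y - (x' - y')‖ + (‖x - x'‖ + ‖y - y'‖) * ‖x' - y'‖) := by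
  obtain ⟨C₁, hC₁⟩ := hG.bounded_fderiv
  obtain ⟨C₂, hC₂⟩ := hG.bounded_fderiv_fderiv
  set L := max C₁ C₂ with hL
  have h1 : ∀ x, ‖fderiv ℝ G x‖ ≤ L := fun x => (hC₁ x).trans (le_max_left _ _)
  have h2 : ∀ x y, ‖fderiv ℝ G x - fderiv ℝ G y‖ ≤ L * ‖x - y‖ := fun x y =>
    convex_univ.norm_image_sub_le_of_norm_fderiv_le
      (fun z _ => hG.differentiable_fderiv z) (fun z _ => (hC₂ z).trans (le_max_right _ _))
      (mem_univ y) (mem_univ x)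
  have hL0 : 0 ≤ L := (norm_nonneg _).trans (h1 0)
  refine ⟨L, hL0, fun x y => convex_univ.norm_image_sub_le_of_norm_fderiv_le
    (fun z _ => hG.differentiable z) (fun z _ => h1 z) (mem_univ y) (mem_univ x), ?_⟩
  intro x y x' y'
  have hline : ∀ a b : E, ∀ θ : ℝ, HasDerivAt (fun θ : ℝ => G (b + θ • (a - b)))
      (fderiv ℝ G (b + θ • (a - b)) (a - b)) θ := by
    intro a b θ
    have h3 : HasDerivAt (fun θ : ℝ => b + θ • (a - b)) (a - b) θ := by
      simpa using ((hasDerivAt_id θ).smul_const (a - b)).const_add b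
    exact (hG.differentiable _).hasFDerivAt.comp_hasDerivAt θ h3
  have hmv := norm_image_sub_le_of_norm_deriv_le_segment_01'
    (f := fun θ : ℝ => G (y + θ • (x - y)) - G (y' + θ • (x' - y')))
    (C := L * (‖x - y - (x' - y')‖ + (‖x - x'‖ + ‖y - y'‖) * ‖x' - y'‖))
    (fun θ _ => ((hline x y θ).sub (hline x' y' θ)).hasDerivWithinAt) ?_
  · simp only [one_smul, zero_smul, add_zero, add_sub_cancel] at hmv
    rwa [sub_sub_sub_comm] at hmv
  · intro θ hθ
    set p := y + θ • (x - y)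
    set p' := y' + θ • (x' - y')
    have hpp : ‖p - p'‖ ≤ ‖x - x'‖ + ‖y - y'‖ := by
      have : p - p' = θ • (x - x') + (1 - θ) • (y - y') := by
        simp only [p, p', smul_sub, sub_smul, one_smul]
        abel
      rw [this]
      refine (norm_add_le _ _).trans (add_le_add ?_ ?_)
      · rw [norm_smul, Real.norm_of_nonneg hθ.1]
        exact mul_le_of_le_one_left (norm_nonneg _) hθ.2.le
      · rw [norm_smul, Real.norm_of_nonneg (by linarith [hθ.2])]
        exact mul_le_of_le_one_left (norm_nonneg _) (by linarith [hθ.1])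
    have e : fderiv ℝ G p (x - y) - fderiv ℝ G p' (x' - y')
        = fderiv ℝ G p (x - y - (x' - y')) + (fderiv ℝ G p - fderiv ℝ G p') (x' - y') := by
      simp only [map_sub, sub_apply]
      abel
    rw [e, mul_add]
    refine (norm_add_le _ _).trans (add_le_add ?_ ?_)
    · exact (fderiv ℝ G p).le_of_opNorm_le (h1 p) _
    · rw [← mul_assoc]
      exact ContinuousLinearMap.le_of_opNorm_le _ ((h2 p p').trans (by gcongr)) _

end Nonlinearity

/-! ### Contraction in weighted norms. -/

section FixedPoint

variable {E : Type*} [NormedAddCommGroup E] {β T ρ N : ℝ}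

/-- On the bounded interval all weights give equivalent norms. Passing from weight zero to `ρ` costs
nothing; the way back in `WeightedBound.to_zero` costs `e ^ (ρ T)`. -/
theorem WeightedBound.of_zero {g : ℝ → E} (hg : WeightedBound β T 0 N g) (hT : 0 ≤ T)
    (hρ : 0 ≤ ρ) : WeightedBound β T ρ N g := by
  have hN := hg.nonneg hT
  have h : ∀ t, 0 ≤ t → N * Real.exp (0 * t) ≤ N * Real.exp (ρ * t) := fun t ht => by
    gcongr
  exact ⟨fun t ht => (hg.norm_le t ht).trans (h t ht.1), fun s t hs hst ht =>
    (hg.sub_le s t hs hst ht).trans (mul_le_mul_of_nonneg_right (h t (hs.trans hst).le)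
      (Real.rpow_nonneg (sub_pos.2 hst).le β))⟩

theorem WeightedBound.to_zero {g : ℝ → E} (hg : WeightedBound β T ρ N g) (hT : 0 ≤ T)
    (hρ : 0 ≤ ρ) : WeightedBound β T 0 (N * Real.exp (ρ * T)) g := by
  have hN := hg.nonneg hT
  have h : ∀ t, t ≤ T → N * Real.exp (ρ * t) ≤ N * Real.exp (ρ * T) * Real.exp (0 * t) :=
    fun t ht => by
      rw [zero_mul, Real.exp_zero, mul_one]
      gcongr
  exact ⟨fun t ht => (hg.norm_le t ht).trans (h t ht.2), fun s t hs hst ht =>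
    (hg.sub_le s t hs hst ht).trans (mul_le_mul_of_nonneg_right (h t ht)
      (Real.rpow_nonneg (sub_pos.2 hst).le β))⟩

theorem WeightedBound.congr {g h : ℝ → E} (hg : WeightedBound β T ρ N g)
    (hgh : EqOn g h (Icc 0 T)) : WeightedBound β T ρ N h where
  norm_le t ht := by
    rw [← hgh ht]
    exact hg.norm_le t ht
  sub_le s t hs hst ht := by
    rw [← hgh ⟨(hs.trans hst).le, ht⟩, ← hgh ⟨hs.le, hst.le.trans ht⟩]
    exact hg.sub_le s t hs hst ht

/-- Balls are closed under pointwise convergence, so completeness of `E` replaces completeness of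
the function space. -/
theorem WeightedBound.of_tendsto {x : ℕ → ℝ → E} {u : ℝ → E}
    (hx : ∀ᶠ n in atTop, WeightedBound β T ρ N (x n))
    (hu : ∀ t ∈ Icc 0 T, Tendsto (fun n => x n t) atTop (𝓝 (u t))) :
    WeightedBound β T ρ N u where
  norm_le t ht := le_of_tendsto (hu t ht).norm (hx.mono fun _ h => h.norm_le t ht)
  sub_le s t hs hst ht := by
    have h1 := hu t ⟨(hs.trans hst).le, ht⟩
    have h2 := hu s ⟨hs.le, hst.le.trans ht⟩
    exact le_of_tendsto ((h1.sub h2).norm.const_mul _) (hx.mono fun _ h => h.sub_le s t hs hst ht)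

theorem WeightedBound.zero (hN : 0 ≤ N) : WeightedBound β T ρ N (fun _ => (0 : E)) where
  norm_le t ht := by
    rw [norm_zero]
    positivity
  sub_le s t hs hst ht := by
    have := Real.rpow_nonneg (sub_pos.2 hst).le β
    simp only [sub_zero, norm_zero, mul_zero]
    positivity

/-- Two fixed points of a map that halves weighted distances agree. -/
theorem eqOn_of_weightedBound_half {Ψ : (ℝ → E) → ℝ → E} {u v : ℝ → E}
    (h : ∀ N, WeightedBound β T ρ N (fun t => u t - v t) →
      WeightedBound β T ρ (N / 2) (fun t => Ψ u t - Ψ v t))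
    (huv : WeightedBound β T ρ N fun t => u t - v t) (hu : EqOn (Ψ u) u (Icc 0 T))
    (hv : EqOn (Ψ v) v (Icc 0 T)) : EqOn u v (Icc 0 T) := by
  have hn : ∀ n : ℕ, WeightedBound β T ρ (N * (1 / 2) ^ n) fun t => u t - v t := by
    intro n
    induction n with
    | zero => simpa using huv
    | succ n ih =>
      have := (h _ ih).congr (h := fun t => u t - v t) fun t ht => by
        simp only [hu ht, hv ht]
      convert this using 1
      ring
  intro t ht
  have h1 : Tendsto (fun n : ℕ => N * (1 / 2) ^ n * Real.exp (ρ * t)) atTop (𝓝 0) := by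
    have := ((tendsto_pow_atTop_nhds_zero_of_lt_one (r := (1 / 2 : ℝ)) (by norm_num)
      (by norm_num)).const_mul N).mul_const (Real.exp (ρ * t))
    simpa using this
  exact sub_eq_zero.1 (norm_le_zero_iff.1 (ge_of_tendsto' h1 fun n => (hn n).norm_le t ht))

/-- A map that leaves a weighted ball invariant and halves weighted distances in it has a fixed
point there. -/
theorem exists_fixedPoint_of_weightedBound [CompleteSpace E] {Ψ : (ℝ → E) → ℝ → E} {ρ' R : ℝ}
    (hT : 0 ≤ T) (hρ : 0 ≤ ρ) (hρ' : 0 ≤ ρ') (hR : 0 ≤ R)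
    (hinv : ∀ u, WeightedBound β T ρ R u → WeightedBound β T ρ R (Ψ u))
    (h : ∀ u v N, WeightedBound β T ρ R u → WeightedBound β T ρ R v →
      WeightedBound β T ρ' N (fun t => u t - v t) →
      WeightedBound β T ρ' (N / 2) (fun t => Ψ u t - Ψ v t)) :
    ∃ u, WeightedBound β T ρ R u ∧ EqOn (Ψ u) u (Icc 0 T) := by
  set x : ℕ → ℝ → E := fun n => Ψ^[n] fun _ => 0 with hx
  have hsucc : ∀ n, x (n + 1) = Ψ (x n) := fun n => Function.iterate_succ_apply' Ψ n _
  have hball : ∀ n, WeightedBound β T ρ R (x n) := by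
    intro n
    induction n with
    | zero => exact WeightedBound.zero hR
    | succ n ih =>
      rw [hsucc]
      exact hinv _ ih
  -- The iterates are bounded with weight `ρ`, their distances are measured with weight `ρ'`; the
  -- passage goes through weight zero.
  obtain ⟨M, hM⟩ : ∃ M, WeightedBound β T ρ' M fun t => x 0 t - x 1 t :=
    ⟨_, (((hball 0).sub (hball 1)).to_zero hT hρ).of_zero hT hρ'⟩
  have hM0 : 0 ≤ M := hM.nonneg hT
  have hstep : ∀ n : ℕ, WeightedBound β T ρ' (M * (1 / 2) ^ n) fun t => x n t - x (n + 1) t := by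
    intro n
    induction n with
    | zero => simpa using hM
    | succ n ih =>
      have := h _ _ _ (hball n) (hball (n + 1)) ih
      rw [← hsucc, ← hsucc] at this
      convert this using 1
      ring
  -- Partial geometric sum of the successive distances.
  have hsum : ∀ n k : ℕ, WeightedBound β T ρ' (2 * M * (1 / 2) ^ n * (1 - (1 / 2) ^ k))
      fun t => x n t - x (n + k) t := by
    intro n k
    induction k with
    | zero => simpa using WeightedBound.zero le_rfl
    | succ k ih =>
      have := ih.add (hstep (n + k))
      simp only [sub_add_sub_cancel] at this
      rwa [show 2 * M * (1 / 2) ^ n * (1 - (1 / 2) ^ k) + M * (1 / 2) ^ (n + k)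
        = 2 * M * (1 / 2) ^ n * (1 - (1 / 2) ^ (k + 1)) by rw [pow_add, pow_succ]; ring] at this
  have hlim : ∀ t, ∃ l, t ∈ Icc 0 T → Tendsto (fun n => x n t) atTop (𝓝 l) := by
    intro t
    by_cases ht : t ∈ Icc 0 T
    · have hc : CauchySeq fun n => x n t :=
        cauchySeq_of_le_geometric (1 / 2) (M * Real.exp (ρ' * t)) (by norm_num) fun n => by
          rw [dist_eq_norm, mul_right_comm]
          exact (hstep n).norm_le t ht
      obtain ⟨l, hl⟩ := cauchySeq_tendsto_of_complete hc
      exact ⟨l, fun _ => hl⟩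
    · exact ⟨0, fun h => absurd h ht⟩
  choose u hu using hlim
  have hub : WeightedBound β T ρ R u := .of_tendsto (Eventually.of_forall hball) hu
  have hux : ∀ n : ℕ, WeightedBound β T ρ' (2 * M * (1 / 2) ^ n) fun t => x n t - u t := by
    intro n
    refine .of_tendsto (x := fun k t => x n t - x (n + k) t) (Eventually.of_forall fun k =>
      (hsum n k).mono (mul_le_of_le_one_right (by positivity) ?_)) fun t ht =>
      tendsto_const_nhds.sub ((tendsto_add_atTop_iff_nat n).2 (hu t ht) |>.congr fun k => by
        rw [add_comm])
    linarith [show (0 : ℝ) ≤ (1 / 2) ^ k by positivity]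
  refine ⟨u, hub, fun t ht => ?_⟩
  have h1 : Tendsto (fun n : ℕ => 2 * M * (1 / 2) ^ n / 2 * Real.exp (ρ' * t)) atTop (𝓝 0) := by
    have := (((tendsto_pow_atTop_nhds_zero_of_lt_one (r := (1 / 2 : ℝ)) (by norm_num)
      (by norm_num)).const_mul (2 * M)).div_const 2).mul_const (Real.exp (ρ' * t))
    simpa using this
  -- The limit lies in the same ball, so the contraction applies to the pair `x n`, `u` and gives `Ψ
  -- (x n) → Ψ u` pointwise.
  have h2 : Tendsto (fun n => x (n + 1) t) atTop (𝓝 (Ψ u t)) := by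
    rw [tendsto_iff_norm_sub_tendsto_zero]
    refine squeeze_zero (fun _ => norm_nonneg _) (fun n => ?_) h1
    rw [hsucc]
    exact (h _ _ _ (hball n) hub (hux n)).norm_le t ht
  exact tendsto_nhds_unique h2 ((tendsto_add_atTop_iff_nat 1).2 (hu t ht))

end FixedPoint

/-! ### The nonlinearity and the initial value in weighted norms. -/

section MildEquation

variable {V F : Type*} [NormedAddCommGroup V] [NormedAddCommGroup F] {β T ρ N L R : ℝ}

theorem WeightedBound.comp_lipschitz {G : V → F} {u : ℝ → V} (hu : WeightedBound β T ρ R u)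
    (hρ : 0 ≤ ρ) (hL : 0 ≤ L) (hG : ∀ x y, ‖G x - G y‖ ≤ L * ‖x - y‖) :
    WeightedBound β T ρ (‖G 0‖ + L * R) fun t => G (u t) where
  norm_le t ht := by
    have h1 : ‖G (u t)‖ ≤ ‖G 0‖ + L * ‖u t‖ := by
      have := norm_le_norm_add_norm_sub' (G (u t)) (G 0)
      have h2 := hG (u t) 0
      rw [sub_zero] at h2
      linarith
    have h2 : ‖G 0‖ ≤ ‖G 0‖ * Real.exp (ρ * t) :=
      le_mul_of_one_le_right (norm_nonneg _) (Real.one_le_exp (mul_nonneg hρ ht.1))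
    have h3 := mul_le_mul_of_nonneg_left (hu.norm_le t ht) hL
    rw [add_mul, mul_assoc]
    linarith
  sub_le s t hs hst ht := by
    have hts := Real.rpow_nonneg (sub_pos.2 hst).le β
    have h1 := mul_le_mul_of_nonneg_left (hG (u t) (u s)) (Real.rpow_nonneg hs.le β)
    have h2 := mul_le_mul_of_nonneg_left (hu.sub_le s t hs hst ht) hL
    have h3 : 0 ≤ ‖G 0‖ * Real.exp (ρ * t) * (t - s) ^ β := by positivity
    calc s ^ β * ‖G (u t) - G (u s)‖ ≤ L * (s ^ β * ‖u t - u s‖) := by linarith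
      _ ≤ L * (R * Real.exp (ρ * t) * (t - s) ^ β) := h2
      _ ≤ _ := by linarith

/-- In the four-point bound the quadratic term multiplies increments of `u` and `v` by `u s - v s`.
Bounding those increments with weight zero keeps a single factor `e ^ (ρ t)`, at the price of a
constant that depends on the radius `R`. -/
theorem WeightedBound.comp_sub {G : V → F} {u v : ℝ → V} (hu : WeightedBound β T 0 R u)
    (hv : WeightedBound β T 0 R v) (huv : WeightedBound β T ρ N fun t => u t - v t) (hT : 0 ≤ T)
    (hρ : 0 ≤ ρ) (hL : 0 ≤ L) (hG : ∀ x y, ‖G x - G y‖ ≤ L * ‖x - y‖)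
    (hG' : ∀ x y x' y', ‖G x - G y - (G x' - G y')‖
      ≤ L * (‖x - y - (x' - y')‖ + (‖x - x'‖ + ‖y - y'‖) * ‖x' - y'‖)) :
    WeightedBound β T ρ (L * (1 + 2 * R) * N) fun t => G (u t) - G (v t) := by
  have hN := huv.nonneg hT
  have hR := hu.nonneg hT
  constructor
  · intro t ht
    have h1 := mul_le_mul_of_nonneg_left (huv.norm_le t ht) hL
    have h2 : 0 ≤ 2 * (L * R * N * Real.exp (ρ * t)) := by positivity
    calc _ ≤ L * (N * Real.exp (ρ * t)) := (hG _ _).trans h1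
      _ ≤ _ := by linarith
  · intro s t hs hst ht
    have hs0 := Real.rpow_nonneg hs.le β
    have hts := Real.rpow_nonneg (sub_pos.2 hst).le β
    have h1 := hu.sub_le s t hs hst ht
    have h2 := hv.sub_le s t hs hst ht
    rw [zero_mul, Real.exp_zero, mul_one] at h1 h2
    have h3 : ‖u s - v s‖ ≤ N * Real.exp (ρ * t) := by
      refine (huv.norm_le s ⟨hs.le, hst.le.trans ht⟩).trans ?_
      gcongr
    calc s ^ β * ‖G (u t) - G (v t) - (G (u s) - G (v s))‖
        ≤ s ^ β * (L * (‖u t - v t - (u s - v s)‖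
          + (‖u t - u s‖ + ‖v t - v s‖) * ‖u s - v s‖)) :=
          mul_le_mul_of_nonneg_left (hG' _ _ _ _) hs0
      _ = L * (s ^ β * ‖u t - v t - (u s - v s)‖
          + (s ^ β * ‖u t - u s‖ + s ^ β * ‖v t - v s‖) * ‖u s - v s‖) := by ring
      _ ≤ L * (N * Real.exp (ρ * t) * (t - s) ^ β
          + (R * (t - s) ^ β + R * (t - s) ^ β) * (N * Real.exp (ρ * t))) := by
          refine mul_le_mul_of_nonneg_left (add_le_add (huv.sub_le s t hs hst ht) ?_) hL
          gcongr
      _ = _ := by ring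

theorem MemWeightedHolder.exists_weightedBound [InnerProductSpace ℝ V] {u : ℝ → V}
    (hu : MemWeightedHolder β 0 T u) : ∃ R, WeightedBound β T 0 R u := by
  obtain ⟨C, hC⟩ := hu.bounded
  obtain ⟨M, hM⟩ := isCompact_Icc.exists_bound_of_continuousOn hu.continuousOn
  refine ⟨max M C, fun t ht => ?_, fun s t hs hst ht => ?_⟩
  · rw [zero_mul, Real.exp_zero, mul_one]
    exact (hM t ht).trans (le_max_left _ _)
  · rw [zero_mul, Real.exp_zero, mul_one, ← div_le_iff₀ (Real.rpow_pos_of_pos (sub_pos.2 hst) β)]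
    have := hC s t hs hst ht
    rw [sub_zero] at this
    rw [mul_div_assoc]
    exact this.trans (le_max_right _ _)

theorem WeightedBound.memWeightedHolder [InnerProductSpace ℝ V] {u : ℝ → V}
    (hu : WeightedBound β T 0 R u) (hβ : 0 < β) (h0 : Tendsto u (𝓝[>] 0) (𝓝 (u 0))) :
    MemWeightedHolder β 0 T u where
  continuousOn := by
    intro t ht
    rcases ht.1.eq_or_lt with rfl | ht0
    · have : ContinuousWithinAt u (Ioi 0) 0 := h0
      exact (continuousWithinAt_insert_self.2 this).mono fun r hr => by
        rcases hr.1.eq_or_lt with rfl | h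
        exacts [Or.inl rfl, Or.inr h]
    · refine (hu.continuousOn hβ t ⟨ht0, ht.2⟩).mono_of_mem_nhdsWithin ?_
      exact inter_mem (mem_nhdsWithin_of_mem_nhds (Ioi_mem_nhds ht0))
        (mem_of_superset self_mem_nhdsWithin fun r hr => hr.2)
  bounded := ⟨R, fun s t hs hst ht => by
    have := hu.sub_le s t hs hst ht
    rw [zero_mul, Real.exp_zero, mul_one,
      ← div_le_iff₀ (Real.rpow_pos_of_pos (sub_pos.2 hst) β), mul_div_assoc] at this
    rwa [sub_zero]⟩

/-- The singularity `s ^ (-β)` of the semigroup increment is exactly what the weight `s ^ β`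
compensates; this lets every initial value in `V` be admitted. -/
theorem SemigroupBounds.weightedBound_orbit [InnerProductSpace ℝ V] {S : ℝ → V →L[ℝ] V}
    (hS : SemigroupBounds S) (hβ : 0 ≤ β) (hβ1 : β ≤ 1) (x : V) :
    WeightedBound β T 0 ‖x‖ fun t => S t x where
  norm_le t ht := by
    rw [zero_mul, Real.exp_zero, mul_one]
    exact (S t).le_of_opNorm_le (hS.norm_le_one t ht.1) x |>.trans_eq (one_mul _)
  sub_le s t hs hst ht := by
    have h1 := ContinuousLinearMap.le_of_opNorm_le _ (hS.norm_sub_le hβ hβ1 hs hst.le) x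
    rw [sub_apply, norm_sub_rev] at h1
    have h2 := mul_le_mul_of_nonneg_left h1 (Real.rpow_nonneg hs.le β)
    rw [zero_mul, Real.exp_zero, mul_one]
    refine h2.trans_eq ?_
    rw [Real.rpow_neg hs.le]
    field_simp [(Real.rpow_pos_of_pos hs β).ne']

end MildEquation

theorem exists_holderBound_of_mem_holderPaths {V : Type*} [NormedAddCommGroup V] {ω : ℝ → V} {β' : ℝ}
    (hβ' : 0 < β')
    (hω : ω ∈ holderPaths V β') (T : ℝ) : ∃ K, 0 ≤ K ∧ HolderBound β' K T ω := by
  obtain ⟨C, hC⟩ := hω.2 0 T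
  refine ⟨C, C.2, fun r hr q hq => ?_⟩
  have := hC.dist_le hr hq
  rwa [dist_eq_norm, Real.dist_eq, Real.coe_toNNReal _ hβ'.le] at this

/-! ### The fixed point map and the main theorem. -/

section MildSolutionMap

variable {V : Type*} [NormedAddCommGroup V] [InnerProductSpace ℝ V] [CompleteSpace V] {S : ℝ → V →L[ℝ] V}
  {ω : ℝ → V} {G : V → HilbertSchmidt V} {α β β' K T : ℝ}

theorem IsGeneratorOf.semigroupBounds {A : V →ₗ.[ℝ] V}
    (hA : IsPosSymmWithCompactInverse (-A)) (hS : IsGeneratorOf A S) : SemigroupBounds S where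
  norm_le_one _ ht := norm_semigroup_le_one hA hS ht
  sub_le _ _ _ hγ hγ1 hx hh := norm_semigroup_sub_le hA hS hγ hγ1 hx hh
  second_difference_le _ _ _ _ _ hp hp1 hγ hγ1 hx hh hk :=
    norm_semigroup_second_difference_le hA hS hp hp1 hγ hγ1 hx hh hk

/-- The right-hand side of the mild equation. -/
noncomputable def mildMap (S : ℝ → V →L[ℝ] V) (G : V → HilbertSchmidt V) (ω : ℝ → V) (u₀ : V)
    (α : ℝ) (u : ℝ → V) (t : ℝ) : V :=
  S t u₀ + pathConvolution S ω α (fun r => G (u r)) t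

variable {u₀ : V} {u v : ℝ → V} {R ρ : ℝ}

theorem exists_mul_rpow_neg_le {η C ε : ℝ} (hη : 0 < η) (hε : 0 < ε) :
    ∃ ρ, 0 < ρ ∧ C * ρ ^ (-η) ≤ ε := by
  have h : Tendsto (fun ρ : ℝ => C * ρ ^ (-η)) atTop (𝓝 0) := by
    simpa using (tendsto_rpow_neg_atTop hη).const_mul C
  obtain ⟨ρ, h1, h2⟩ := ((h.eventually_le_const hε).and (eventually_gt_atTop 0)).exists
  exact ⟨ρ, h2, h1⟩

/-- The right-hand side of the mild equation leaves a weighted ball invariant. -/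
theorem exists_weightedBound_mildMap (hS : SemigroupBounds S) (hω : HolderBound β' K T ω)
    (hK : 0 ≤ K) (hα : 1 - β' < α) (hαβ : α < β) (hββ' : β < β') (hβ' : β' < 1) (hT : 0 ≤ T)
    (hG : IsTwiceDiffBounded G) (u₀ : V) : ∃ ρ R, 0 < ρ ∧ 0 ≤ R ∧
      ∀ u, WeightedBound β T ρ R u → WeightedBound β T ρ R (mildMap S G ω u₀ α u) := by
  obtain ⟨L, hL, hG1, -⟩ := hG.exists_norm_sub_le
  obtain ⟨η, C, hη, hC, h⟩ := exists_weightedBound_pathConvolution hS hω hK hα hαβ hββ' hβ' hT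
  -- For `u` in the ball of radius `‖u₀‖ + 1`, `G ∘ u` has bound `‖G 0‖ + L (‖u₀‖ + 1)`. The orbit
  -- uses `‖u₀‖` of the radius, so the convolution has to stay below 1; the last summand only makes
  -- the divisor positive.
  have hD : 0 < ‖G 0‖ + L * (‖u₀‖ + 1) + 1 := by positivity
  obtain ⟨ρ, hρ, hρC⟩ := exists_mul_rpow_neg_le (C := C) hη (inv_pos.2 hD)
  refine ⟨ρ, ‖u₀‖ + 1, hρ, by positivity, fun u hu => ?_⟩
  have h1 := h ρ _ _ hρ (hu.comp_lipschitz hρ.le hL hG1)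
  refine (((hS.weightedBound_orbit (by linarith) (by linarith) u₀).of_zero hT hρ.le).add h1).mono ?_
  gcongr
  calc _ ≤ (‖G 0‖ + L * (‖u₀‖ + 1) + 1)⁻¹ * (‖G 0‖ + L * (‖u₀‖ + 1) + 1) :=
        mul_le_mul hρC (le_add_of_nonneg_right zero_le_one) (by positivity) (by positivity)
    _ = 1 := inv_mul_cancel₀ hD.ne'

/-- The right-hand side of the mild equation halves weighted distances in a ball. -/
theorem exists_weightedBound_mildMap_sub (hS : SemigroupBounds S) (hω : HolderBound β' K T ω)
    (hK : 0 ≤ K) (hα : 1 - β' < α) (hαβ : α < β) (hββ' : β < β') (hβ' : β' < 1) (hT : 0 ≤ T)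
    (hG : IsTwiceDiffBounded G) (u₀ : V) (hR : 0 ≤ R) : ∃ ρ, 0 < ρ ∧
      ∀ u v N, WeightedBound β T 0 R u → WeightedBound β T 0 R v →
        WeightedBound β T ρ N (fun t => u t - v t) →
        WeightedBound β T ρ (N / 2) fun t => mildMap S G ω u₀ α u t - mildMap S G ω u₀ α v t := by
  obtain ⟨L, hL, hG1, hG2⟩ := hG.exists_norm_sub_le
  obtain ⟨η, C, hη, hC, h⟩ := exists_weightedBound_pathConvolution hS hω hK hα hαβ hββ' hβ' hT
  -- `L (1 + 2 R)` is the Lipschitz constant from `WeightedBound.comp_sub`; the factor 2 gives the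
  -- halving.
  have hD : 0 < 2 * (L * (1 + 2 * R) + 1) := by positivity
  obtain ⟨ρ, hρ, hρC⟩ := exists_mul_rpow_neg_le (C := C) hη (inv_pos.2 hD)
  refine ⟨ρ, hρ, fun u v N hu hv huv => ?_⟩
  have hN := huv.nonneg hT
  have h1 := (h ρ _ _ hρ (hu.comp_sub hv huv hT hρ.le hL hG1 hG2)).congr
    (h := fun t => mildMap S G ω u₀ α u t - mildMap S G ω u₀ α v t) fun t ht => by
      rw [pathConvolution_sub hS hω hK hα hαβ hββ' hβ' (hu.comp_lipschitz le_rfl hL hG1)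
        (hv.comp_lipschitz le_rfl hL hG1) le_rfl ht]
      exact (add_sub_add_left_eq_sub _ _ _).symm
  refine h1.mono ?_
  calc _ ≤ (2 * (L * (1 + 2 * R) + 1))⁻¹ * ((L * (1 + 2 * R) + 1) * N) := by
        gcongr
        linarith
    _ = N / 2 := by
        field_simp

/-- The bound holds for every weight, so at time `t` the weight `ρ = t⁻¹` may be taken: then `e ^ (ρ
t)` is the constant `e` and `ρ ^ (-η) = t ^ η` tends to zero. -/
theorem tendsto_pathConvolution_zero (hS : SemigroupBounds S) (hω : HolderBound β' K T ω)
    (hK : 0 ≤ K) (hα : 1 - β' < α) (hαβ : α < β) (hββ' : β < β') (hβ' : β' < 1) (hT : 0 < T)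
    {g : ℝ → HilbertSchmidt V} (hg : WeightedBound β T 0 R g) :
    Tendsto (pathConvolution S ω α g) (𝓝[>] 0) (𝓝 0) := by
  obtain ⟨η, C, hη, hC, h⟩ := exists_weightedBound_pathConvolution hS hω hK hα hαβ hββ' hβ' hT.le
  have h1 : Tendsto (fun t : ℝ => C * t ^ η * R * Real.exp 1) (𝓝[>] 0) (𝓝 0) := by
    have : Tendsto (fun t : ℝ => t ^ η) (𝓝 0) (𝓝 (0 ^ η)) :=
      (Real.continuousAt_rpow_const 0 η (Or.inr hη.le)).tendsto
    rw [Real.zero_rpow hη.ne'] at this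
    have := ((this.const_mul C).mul_const R).mul_const (Real.exp 1)
    simp only [mul_zero, zero_mul] at this
    exact this.mono_left nhdsWithin_le_nhds
  rw [tendsto_zero_iff_norm_tendsto_zero]
  refine squeeze_zero' (Eventually.of_forall fun _ => norm_nonneg _) ?_ h1
  filter_upwards [Ioo_mem_nhdsGT hT] with t ht
  have ht' : 0 < t⁻¹ := inv_pos.2 ht.1
  have := (h t⁻¹ _ _ ht' (hg.of_zero hT.le ht'.le)).norm_le t ⟨ht.1.le, ht.2.le⟩
  rwa [inv_mul_cancel₀ ht.1.ne', Real.inv_rpow ht.1.le, ← Real.rpow_neg ht.1.le, neg_neg] at this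

end MildSolutionMap

theorem theoremt1 {V : Type*} [NormedAddCommGroup V] [InnerProductSpace ℝ V] [CompleteSpace V]
    [TopologicalSpace.SeparableSpace V]
    (A : V →ₗ.[ℝ] V) (hA : IsPosSymmWithCompactInverse (-A))
    (S : ℝ → V →L[ℝ] V) (hS : IsGeneratorOf A S)
    (β β' : ℝ) (hβ : 1 / 2 < β) (hββ' : β < β') (hβ' : β' < 1)
    (ω : ℝ → V) (hω : ω ∈ holderPaths V β')
    (G : V → HilbertSchmidt V) (hG : IsTwiceDiffBounded G)
    (u₀ : V) (T : ℝ) (hT : 0 < T) :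
    ∃ u : ℝ → V, MemWeightedHolder β 0 T u ∧
      (∀ α : ℝ, 1 - β' < α → α < β → IsMildSolution S G ω u₀ T α u) ∧
      ∀ (α : ℝ) (v : ℝ → V), 1 - β' < α → α < β → MemWeightedHolder β 0 T v →
        IsMildSolution S G ω u₀ T α v → EqOn v u (Icc 0 T) := by
  have hS' := hS.semigroupBounds hA
  obtain ⟨K, hK, hω'⟩ := exists_holderBound_of_mem_holderPaths (by linarith) hω T
  obtain ⟨L, hL, hG1, -⟩ := hG.exists_norm_sub_le
  -- One auxiliary order for the whole argument, available because `1 - β' < 1 / 2 < β`; every other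
  -- admissible order gives the same convolution.
  obtain ⟨γ, hγ, hγβ⟩ : ∃ γ, 1 - β' < γ ∧ γ < β := exists_between (by linarith)
  have hGc : Continuous G := hG.differentiable.continuous
  have hconv : ∀ {α : ℝ} {w : ℝ → V} {N : ℝ}, 1 - β' < α → α < β → WeightedBound β T 0 N w →
      ∀ t ∈ Icc 0 T, zahleIntegral α (mildIntegrand S G w t) ω 0 t
        = pathConvolution S ω γ (fun r => G (w r)) t := fun hα hαβ hw t ht =>
    pathConvolution_eq hS' hω' hK hα hαβ hγ hγβ hββ' hβ' (hw.comp_lipschitz le_rfl hL hG1) le_rfl ht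
  obtain ⟨ρ, R, hρ, hR, hinv⟩ :=
    exists_weightedBound_mildMap hS' hω' hK hγ hγβ hββ' hβ' hT.le hG u₀
  -- The contraction is needed on the invariant ball, whose radius for weight zero is `R * e ^ (ρ
  -- T)`; the weight `ρ'` depends on it.
  obtain ⟨ρ', hρ', hcontr⟩ := exists_weightedBound_mildMap_sub hS' hω' hK hγ hγβ hββ' hβ' hT.le hG
    u₀ (R := R * Real.exp (ρ * T)) (by positivity)
  obtain ⟨u, hu, hfix⟩ := exists_fixedPoint_of_weightedBound hT.le hρ.le hρ'.le hR hinv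
    fun u v N hu hv => hcontr u v N (hu.to_zero hT.le hρ.le) (hv.to_zero hT.le hρ.le)
  have hu0 := hu.to_zero hT.le hρ.le
  have hzero : u 0 = u₀ := by
    rw [← hfix ⟨le_rfl, hT.le⟩, mildMap, pathConvolution_zero, hS.semigroup.zero, add_zero,
      ContinuousLinearMap.id_apply]
  have hmem : MemWeightedHolder β 0 T u := by
    refine hu0.memWeightedHolder (by linarith) ?_
    have := (hS.semigroup.tendsto_zero u₀).add (tendsto_pathConvolution_zero hS' hω' hK hγ hγβ hββ'
      hβ' hT (hu0.comp_lipschitz le_rfl hL hG1))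
    rw [add_zero] at this
    rw [hzero]
    refine this.congr' ?_
    filter_upwards [Ioo_mem_nhdsGT hT] with t ht
    exact hfix ⟨ht.1.le, ht.2.le⟩
  refine ⟨u, hmem, fun α hα hαβ => ⟨fun t ht => ?_, fun t ht => ?_⟩, fun α v hα hαβ hv hsol => ?_⟩
  · exact zahleIntegrable_convIntegrand hS' hω' hK hα hαβ hββ' hβ'
      (hu0.comp_lipschitz le_rfl hL hG1) le_rfl (hGc.comp_continuousOn hmem.continuousOn) ht
  · rw [hconv hα hαβ hu0 t ht]
    exact (hfix ht).symm
  · obtain ⟨M, hM⟩ := hv.exists_weightedBound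
    -- A competing solution has its own radius. Both are put in a common larger ball, where a new
    -- weight `ρ₂` gives contraction.
    have hu1 := hu0.mono (le_max_left (R * Real.exp (ρ * T)) M)
    have hM1 := hM.mono (le_max_right (R * Real.exp (ρ * T)) M)
    obtain ⟨ρ₂, hρ₂, hcontr₂⟩ := exists_weightedBound_mildMap_sub hS' hω' hK hγ hγβ hββ' hβ' hT.le hG
      u₀ (hM1.nonneg hT.le)
    refine eqOn_of_weightedBound_half (fun N => hcontr₂ v u N hM1 hu1)
      ((hM1.sub hu1).of_zero hT.le hρ₂.le) (fun t ht => ?_) hfix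
    rw [hsol.equation t ht, hconv hα hαβ hM t ht, mildMap]
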